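/- Let $S^3\subset\mathbb{C}^2$ be the unit sphere and let $\Psi_t(z_1,z_2)=(e^{it}z_1,e^{it}z_2)$, $t\in\mathbb{R}$, be the Hopf flow. For an integer $d\ge 1$ let $L(d,1)=S^3/\mathbb{Z}_d$ be the quotient of $S^3$ by the free $\mathbb{Z}_d$-action generated by $\Psi_{2\pi/d}$, with its induced smooth structure; $\Psi_t$ commutes with this action and induces a flow on $L(d,1)$, again called the Hopf flow. For a flow $\Phi$ on a smooth $3$-manifold $M$, a $d$-section is a compact, smoothly embedded surface $\Sigma\subset M$, possibly with boundary, such that $\partial\Sigma$ is a union of orbits, the interior $\mathrm{Int}(\Sigma)$ is transverse to the flow, and every orbit of $\Phi$ either intersects $\mathrm{Int}(\Sigma)$ in exactly $d$ points or is a component of $\partial\Sigma$. A $d$-section is always oriented such that the flow intersects it positively. **Proposition.** Let $d\ge 1$ and let $\Sigma\subset S^3$ be a $d$-section for the Hopf flow. Then there is a $d$-section $\Sigma'\subset S^3$ for the Hopf flow such that 1. $\Sigma$ and $\Sigma'$ are isotopic as oriented surfaces, i.e. there is a smooth ambient isotopy $(H_t)$ of $S^3$ with $H_0=\mathrm{id}$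 and $H_1(\Sigma)=\Sigma'$ such that $H_1$ maps the orientation of $\Sigma$ to that of $\Sigma'$; 2. $\Sigma'$ is invariant under the $\mathbb{Z}_d$-action generated by $\Psi_{2\pi/d}$, i.e. $\Psi_{2\pi/d}(\Sigma')=\Sigma'$; 3. $\Sigma'$ descends to a $1$-section in $L(d,1)$, i.e. the image of $\Sigma'$ under the quotient map $S^3\to L(d,1)$ is a $1$-section for the Hopf flow on $L(d,1)$. -/

import Mathlib

open scoped Manifold ContDiff

noncomputable section

namespace HopfSection

/-! ### Embedded surfaces in 3-manifolds and sections of flows -/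

/-- Euclidean 3-space, the model space of the 3-manifolds considered here. -/
abbrev E3 : Type := EuclideanSpace ℝ (Fin 3)

section Surfaces

variable {M : Type} [TopologicalSpace M] [ChartedSpace E3 M]

/-- A smooth chart in which `S` is the coordinate plane `x₂ = 0`. -/
def IsSliceChart (S : Set M) (φ : OpenPartialHomeomorph M E3) : Prop :=
  φ ∈ IsManifold.maximalAtlas (𝓡 3) ∞ M ∧ ∀ x ∈ φ.source, (x ∈ S ↔ φ x 2 = 0)

/-- A smooth chart in which `S` is the half-plane `x₂ = 0`, `x₀ ≥ 0`. -/
def IsHalfSliceChart (S : Set M) (φ : OpenPartialHomeomorph M E3) : Prop :=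
  φ ∈ IsManifold.maximalAtlas (𝓡 3) ∞ M ∧
    ∀ x ∈ φ.source, (x ∈ S ↔ φ x 2 = 0 ∧ 0 ≤ φ x 0)

/-- The interior points of the surface `S` (in the sense of manifolds with boundary). -/
def surfInterior (S : Set M) : Set M :=
  {p | p ∈ S ∧ ∃ φ, IsSliceChart S φ ∧ p ∈ φ.source}

/-- The boundary points of the surface `S` (in the sense of manifolds with boundary). -/
def surfBoundary (S : Set M) : Set M :=
  {p | p ∈ S ∧ ∃ φ, IsHalfSliceChart S φ ∧ p ∈ φ.source ∧ φ p 0 = 0}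

/-- `S` is a compact, smoothly embedded surface, possibly with boundary, in the 3-manifold `M`. -/
def IsCompactSurface (S : Set M) : Prop :=
  IsCompact S ∧ ∀ p ∈ S, p ∈ surfInterior S ∨ p ∈ surfBoundary S

/-- The orbit of the point `p` under the flow `Φ`. -/
def flowOrbit (Φ : ℝ → M → M) (p : M) : Set M := Set.range fun t => Φ t p

/-- The speed, in the coordinate normal to the slice, at which a curve `γ` crosses the surface
at time `0`; here `φ` is a slice chart of the surface around `γ 0`. -/
def normalSpeed (φ : OpenPartialHomeomorph M E3) (γ : ℝ → M) : ℝ :=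
  deriv (fun t => φ (γ t) 2) 0

/-- `S` is a `d`-section for the flow `Φ`: a compact embedded surface whose boundary is a union of
orbits and whose interior is transverse to the flow, such that every orbit either meets the
interior of `S` in exactly `d` points or is a component of the boundary of `S`. -/
structure IsDSection (Φ : ℝ → M → M) (d : ℕ) (S : Set M) : Prop where
  compactSurface : IsCompactSurface S
  boundary_invariant : ∀ p ∈ surfBoundary S, flowOrbit Φ p ⊆ surfBoundary S
  transverse : ∀ φ, IsSliceChart S φ → ∀ p ∈ φ.source, p ∈ S →
    normalSpeed φ (fun t => Φ t p) ≠ 0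
  orbits : ∀ p : M, (flowOrbit Φ p ∩ surfInterior S).encard = d ∨
    ∃ q ∈ surfBoundary S, flowOrbit Φ p = connectedComponentIn (surfBoundary S) q

/-- `H` is a smooth ambient isotopy of `M` (time is allowed to range over all of `ℝ`; only the
times in `[0, 1]` matter). -/
def IsSmoothIsotopy (H : ℝ → M ≃ₘ^∞⟮𝓡 3, 𝓡 3⟯ M) : Prop :=
  ContMDiff (𝓘(ℝ, ℝ).prod (𝓡 3)) (𝓡 3) ∞ (fun q : ℝ × M => H q.1 q.2) ∧ ∀ x, H 0 x = x

/-- The surfaces `S` and `S'`, both transverse to the flow `Φ` and oriented so that `Φ` crosses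
them positively, are isotopic as oriented surfaces: some smooth ambient isotopy carries `S` to
`S'`, and its final diffeomorphism carries the flow direction along the interior of `S` to the
side of `S'` into which the flow points. -/
def IsotopicSections (Φ : ℝ → M → M) (S S' : Set M) : Prop :=
  ∃ H : ℝ → M ≃ₘ^∞⟮𝓡 3, 𝓡 3⟯ M, IsSmoothIsotopy H ∧ H 1 '' S = S' ∧
    ∀ φ, IsSliceChart S' φ → ∀ p ∈ S, H 1 p ∈ φ.source →
      0 < normalSpeed φ (fun t => H 1 (Φ t p)) * normalSpeed φ (fun t => Φ t (H 1 p))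

end Surfaces

/-! ### The 3-sphere and the Hopf flow -/

/-- The unit sphere in `ℂ²`. -/
abbrev Sphere3 : Type := Metric.sphere (0 : EuclideanSpace ℂ (Fin 2)) 1

instance finrank_fact : Fact (Module.finrank ℝ (EuclideanSpace ℂ (Fin 2)) = 3 + 1) :=
  ⟨by rw [← Module.finrank_mul_finrank ℝ ℂ (EuclideanSpace ℂ (Fin 2))]; simp⟩

/-- Complex numbers of modulus one act on the sphere by scalar multiplication. -/
instance circleAction : MulAction Circle Sphere3 where
  smul c x := ⟨(c : ℂ) • (x : EuclideanSpace ℂ (Fin 2)), by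
    rw [mem_sphere_zero_iff_norm, norm_smul, mem_sphere_zero_iff_norm.1 x.2, Circle.norm_coe, one_mul]⟩
  one_smul _ := Subtype.ext (one_smul ℂ _)
  mul_smul _ _ _ := Subtype.ext (mul_smul (_ : ℂ) _ _)

theorem coe_circle_smul (c : Circle) (x : Sphere3) :
    ((c • x : Sphere3) : EuclideanSpace ℂ (Fin 2)) = (c : ℂ) • (x : EuclideanSpace ℂ (Fin 2)) :=
  rfl

/-- The Hopf flow `Ψ_t (z₁, z₂) = (e^{it} z₁, e^{it} z₂)`. -/
def hopfFlow (t : ℝ) (x : Sphere3) : Sphere3 := Circle.exp t • x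

/-! ### The lens space `L(d,1)` -/

/-- The cyclic group generated by `e^{2πi/d}`; through it `ℤ_d` acts on the sphere, with generator
`Ψ_{2π/d}`. -/
abbrev deckGroup (d : ℕ) : Subgroup Circle :=
  Subgroup.zpowers (Circle.exp (2 * Real.pi / d))

/-- The lens space `L(d,1)`, with the quotient topology and the charted space structure that make
the projection from the sphere a local homeomorphism compatible with charts. -/
abbrev LensSpace (d : ℕ) : Type := MulAction.orbitRel.Quotient (deckGroup d) Sphere3

instance deckGroup_finite (d : ℕ) : Finite (deckGroup d) := by
  change Finite (Subgroup.zpowers (Circle.exp (2 * Real.pi / d)) : Set Circle)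
  rw [Set.finite_coe_iff, finite_zpowers]
  rcases Nat.eq_zero_or_pos d with rfl | hd
  · simp
  · refine isOfFinOrder_iff_pow_eq_one.2 ⟨d, hd, ?_⟩
    rw [← Circle.exp_nsmul, nsmul_eq_mul, mul_div_cancel₀ _ (by positivity), Circle.exp_two_pi]

theorem contMDiff_circle_smul (c : Circle) :
    ContMDiff (𝓡 3) (𝓡 3) ∞ (fun x : Sphere3 => c • x) := by
  have h : ContMDiff (𝓡 3) 𝓘(ℝ, EuclideanSpace ℂ (Fin 2)) ∞
      (fun x : Sphere3 => (c : ℂ) • (x : EuclideanSpace ℂ (Fin 2))) := by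
    have h1 : ContDiff ℝ ∞ (fun v : EuclideanSpace ℂ (Fin 2) => (c : ℂ) • v) := by fun_prop
    exact h1.contMDiff.comp contMDiff_coe_sphere
  exact h.codRestrict_sphere _

instance circle_continuousConstSMul : ContinuousConstSMul Circle Sphere3 :=
  ⟨fun c => (contMDiff_circle_smul c).continuous⟩

instance circle_isCancelSMul : IsCancelSMul Circle Sphere3 where
  left_cancel' c x y h := by simpa using h
  right_cancel' c c' x h := by
    have hx : (x : EuclideanSpace ℂ (Fin 2)) ≠ 0 := by
      intro h0; have := mem_sphere_zero_iff_norm.1 x.2; simp [h0] at this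
    have := congrArg Subtype.val h
    rw [coe_circle_smul, coe_circle_smul] at this
    exact Subtype.ext (smul_left_injective ℂ hx this)

instance deck_continuousConstSMul (d : ℕ) : ContinuousConstSMul (deckGroup d) Sphere3 :=
  ⟨fun c => (contMDiff_circle_smul (c : Circle)).continuous⟩

instance deck_isCancelSMul (d : ℕ) : IsCancelSMul (deckGroup d) Sphere3 where
  left_cancel' c x y h := by simpa using h
  right_cancel' c c' x h := Subtype.ext (IsCancelSMul.right_cancel (c : Circle) (c' : Circle) x h)

/-- The quotient projection from the sphere to the lens space. -/
def lensProj (d : ℕ) (x : Sphere3) : LensSpace d := Quotient.mk _ x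

theorem lensProj_eq_iff (d : ℕ) (x y : Sphere3) :
    lensProj d x = lensProj d y ↔ ∃ g : deckGroup d, g • y = x :=
  Quotient.eq

theorem isLocalHomeomorph_lensProj (d : ℕ) : IsLocalHomeomorph (lensProj d) :=
  (isQuotientCoveringMap_quotientMk_of_properlyDiscontinuousSMul
    (G := deckGroup d) (E := Sphere3)).isCoveringMap.isLocalHomeomorph

/-- The charted space structure on `L(d,1)` is that of a smooth manifold. -/
instance lensSpace_isManifold (d : ℕ) : IsManifold (𝓡 3) ∞ (LensSpace d) := by
  apply isManifold_of_contDiffOn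
  rintro _ _ ⟨p, rfl⟩ ⟨p', rfl⟩
  generalize (Quotient.mk_surjective.hasRightInverse.choose p : Sphere3) = a
  generalize (Quotient.mk_surjective.hasRightInverse.choose p' : Sphere3) = a'
  set hf := isLocalHomeomorph_lensProj d with hf_def
  change ContDiffOn ℝ ∞ ((𝓡 3) ∘ ((hf.localInverseAt a).trans (chartAt E3 a)).symm.trans
    ((hf.localInverseAt a').trans (chartAt E3 a')) ∘ (𝓡 3).symm)
    ((𝓡 3).symm ⁻¹' (((hf.localInverseAt a).trans (chartAt E3 a)).symm.trans
    ((hf.localInverseAt a').trans (chartAt E3 a'))).source ∩ Set.range (𝓡 3))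
  have hsymm : ∀ z, (hf.localInverseAt a).symm z = lensProj d z := fun z => by simp
  have hsymm' : ∀ z, (hf.localInverseAt a').symm z = lensProj d z := fun z => by simp
  intro v hv
  set e := hf.localInverseAt a with he
  set e' := hf.localInverseAt a' with he'
  simp only [Set.mem_inter_iff, Set.mem_preimage, OpenPartialHomeomorph.trans_source,
    OpenPartialHomeomorph.symm_source, OpenPartialHomeomorph.trans_target,
    OpenPartialHomeomorph.coe_trans_symm, Function.comp_apply, hsymm] at hv
  obtain ⟨⟨⟨hv1, hv2⟩, hv3, hv4⟩, -⟩ := hv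
  change v ∈ (chartAt E3 a).target at hv1
  change (chartAt E3 a).symm v ∈ e.target at hv2
  change lensProj d ((chartAt E3 a).symm v) ∈ e'.source at hv3
  change e' (lensProj d ((chartAt E3 a).symm v)) ∈ (chartAt E3 a').source at hv4
  set y := (chartAt E3 a).symm v with hy
  -- the two local sections differ by a deck transformation near `y`
  obtain ⟨g, hg⟩ := (lensProj_eq_iff d (e' (lensProj d y)) y).1 (by
    rw [← hsymm', e'.left_inv hv3])
  have hproj : ∀ z : Sphere3, lensProj d (g • z) = lensProj d z := fun z =>
    (lensProj_eq_iff d _ _).2 ⟨g, rfl⟩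
  have hcont : ContinuousAt (fun u => g • (chartAt E3 a).symm u) v :=
    ((contMDiff_circle_smul (g : Circle)).continuous.continuousAt).comp
      ((chartAt E3 a).symm.continuousAt hv1)
  have hev : ∀ᶠ u in nhds v, g • (chartAt E3 a).symm u ∈ e'.target :=
    hcont.eventually_mem (e'.open_target.mem_nhds (by
      rw [← hy, hg]; exact e'.map_source hv3))
  have hloc : (fun u => chartAt E3 a' (g • (chartAt E3 a).symm u)) =ᶠ[nhds v]
      fun u => chartAt E3 a' (e' (lensProj d ((chartAt E3 a).symm u))) := by
    filter_upwards [hev] with u hu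
    rw [← hproj, ← hsymm', e'.right_inv hu]
  have hsm : ContMDiffAt (𝓡 3) (𝓡 3) ∞ (fun u => chartAt E3 a' (g • (chartAt E3 a).symm u)) v := by
    have h1 : ContMDiffAt (𝓡 3) (𝓡 3) ∞ (chartAt E3 a).symm v :=
      contMDiffOn_chart_symm.contMDiffAt ((chartAt E3 a).open_target.mem_nhds hv1)
    have h2 : ContMDiffAt (𝓡 3) (𝓡 3) ∞ (fun x : Sphere3 => g • x) ((chartAt E3 a).symm v) :=
      (contMDiff_circle_smul (g : Circle)).contMDiffAt
    have h3 : ContMDiffAt (𝓡 3) (𝓡 3) ∞ (chartAt E3 a') (g • (chartAt E3 a).symm v) :=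
      contMDiffOn_chart.contMDiffAt ((chartAt E3 a').open_source.mem_nhds (by
        rw [← hy, hg]; exact hv4))
    exact ContMDiffAt.comp v h3 (ContMDiffAt.comp v h2 h1)
  have hfin := (hsm.contDiffAt.congr_of_eventuallyEq hloc.symm).contDiffWithinAt
    (s := (𝓡 3).symm ⁻¹' ((e.trans (chartAt E3 a)).symm.trans
      (e'.trans (chartAt E3 a'))).source ∩ Set.range (𝓡 3))
  refine hfin.congr (fun u _ => ?_) ?_ <;> simp [← hsymm]

/-- The flow on the lens space induced by the Hopf flow. -/
def lensFlow (d : ℕ) (t : ℝ) : LensSpace d → LensSpace d :=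
  Quotient.map (hopfFlow t) (by
    rintro x y ⟨g, rfl⟩
    exact ⟨g, smul_comm (g : Circle) (Circle.exp t) y⟩)

end HopfSection

/-! Pushing a surface along the Hopf flow, for a time that varies with the point, keeps it
transverse as long as that time grows along the flow at a rate above -1 (`exists_shear`,
`exists_isotopicSections_of_shear`). The aim is to push so that the `d` hits of each orbit become
equally spaced. The right time is an average: a point of `S` whose orbit hits `S` at the times t₁,
…, t_d in (0, 2π] is moved for (t₁ + … + t_d)/d. Seen from the next hit, τ later, every time is
smaller by τ, except that the time of that hit becomes 2π instead of 0; so consecutive hits land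
exactly 2π/d apart (`IsDSection.exists_next_hit`). Off `S` one adds to the sum a phase growing from
0 to 2π between consecutive hits. It cancels the jump of the sum at a hit, which makes `drift`
smooth, and since it grows, the rate stays above -1 (`IsDSection.drift_spec`).

The average does not extend over the boundary orbits, so it is multiplied by a flow-invariant cutoff
vanishing near them. The result is still invariant provided that `S` was already invariant near its
boundary (`IsDSection.exists_invariant`).

To arrange this near the boundary orbit through `k`, take unitary coordinates z₁, z₂ in which the
orbit is z₂ = 0. On `S`, z₂ vanishes only to first order at the boundary (`fderiv_zTwo_ne_zero`), so
by Hadamard's lemma its phase extends smoothly (`IsDSection.exists_phase`), and near the orbit `S`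
satisfies arg z₂ = n arg z₁ + β with β smooth (`exists_angle`, `IsDSection.exists_isAngle`). Let X
be the Hopf vector field. Transversality says that Xβ + n - 1 has no zero on the interior of `S`
near the orbit; it has one sign there, and integration along the closed orbit shows that n - 1 is
nonzero of the same sign (`IsAngle.sign_mul_pos`). Rotating z₂ by -χβ, with χ a cutoff, therefore
preserves transversality (`shear_pos`) and yields arg z₂ = n arg z₁ near the orbit
(`IsDSection.exists_straighten`). Such a straight section is locally all of that surface, which
orbits meet |n - 1| times; hence |n - 1| = `d` and `S` is invariant there
(`IsDSection.invariant_of_straight`). The boundary has finitely many orbits, which are treated one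
at a time.

For an invariant section the `d` hits of an orbit form one deck orbit, so the quotient meets each
non-boundary orbit once (`IsDSection.lensProj_image`). -/

set_option linter.unusedSectionVars false

namespace HopfSection
open scoped Topology
open Set Filter

/-! ### Surfaces in 3-manifolds: locality, interior and boundary -/

section Surfaces

variable {M N : Type} [TopologicalSpace M] [ChartedSpace E3 M] [IsManifold (𝓡 3) ∞ M]
  [TopologicalSpace N] [ChartedSpace E3 N] [IsManifold (𝓡 3) ∞ N]

/-- `e` is a local diffeomorphism from `M` to `N` that carries `S` to `S'`. -/
structure IsPairDiffeo (e : OpenPartialHomeomorph M N) (S : Set M) (S' : Set N) : Prop where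
  smooth : ContMDiffOn (𝓡 3) (𝓡 3) ∞ e e.source
  smooth_symm : ContMDiffOn (𝓡 3) (𝓡 3) ∞ e.symm e.target
  mem_iff : ∀ x ∈ e.source, (x ∈ S ↔ e x ∈ S')

theorem IsPairDiffeo.symm {e : OpenPartialHomeomorph M N} {S : Set M} {S' : Set N}
    (h : IsPairDiffeo e S S') : IsPairDiffeo e.symm S' S where
  smooth := h.smooth_symm
  smooth_symm := by simpa using h.smooth
  mem_iff x hx := by
    rw [h.mem_iff _ (e.map_target hx), e.right_inv hx]

theorem trans_mem_maximalAtlas {e : OpenPartialHomeomorph M N}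
    (h : ContMDiffOn (𝓡 3) (𝓡 3) ∞ e e.source) (h' : ContMDiffOn (𝓡 3) (𝓡 3) ∞ e.symm e.target)
    {φ : OpenPartialHomeomorph N E3} (hφ : φ ∈ IsManifold.maximalAtlas (𝓡 3) ∞ N) :
    e.trans φ ∈ IsManifold.maximalAtlas (𝓡 3) ∞ M := by
  apply OpenPartialHomeomorph.mem_maximalAtlas_of_contMDiffOn
  · exact (contMDiffOn_of_mem_maximalAtlas hφ).comp (h.mono (by simp)) (by
      intro x hx; simp at hx; exact hx.2)
  · exact h'.comp ((contMDiffOn_symm_of_mem_maximalAtlas hφ).mono (by simp)) (by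
      intro x hx; simp at hx; exact hx.2)

theorem IsPairDiffeo.isSliceChart {e : OpenPartialHomeomorph M N} {S : Set M} {S' : Set N}
    (h : IsPairDiffeo e S S') {φ : OpenPartialHomeomorph N E3} (hφ : IsSliceChart S' φ) :
    IsSliceChart S (e.trans φ) := by
  refine ⟨trans_mem_maximalAtlas h.smooth h.smooth_symm hφ.1, fun x hx => ?_⟩
  simp only [OpenPartialHomeomorph.trans_source, mem_inter_iff, mem_preimage] at hx
  rw [h.mem_iff x hx.1, hφ.2 _ hx.2]; rfl

theorem IsPairDiffeo.isHalfSliceChart {e : OpenPartialHomeomorph M N} {S : Set M} {S' : Set N}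
    (h : IsPairDiffeo e S S') {φ : OpenPartialHomeomorph N E3} (hφ : IsHalfSliceChart S' φ) :
    IsHalfSliceChart S (e.trans φ) := by
  refine ⟨trans_mem_maximalAtlas h.smooth h.smooth_symm hφ.1, fun x hx => ?_⟩
  simp only [OpenPartialHomeomorph.trans_source, mem_inter_iff, mem_preimage] at hx
  rw [h.mem_iff x hx.1, hφ.2 _ hx.2]; rfl

theorem IsPairDiffeo.mem_surfInterior_of {e : OpenPartialHomeomorph M N} {S : Set M} {S' : Set N}
    (h : IsPairDiffeo e S S') {p : M} (hp : p ∈ e.source) (hi : e p ∈ surfInterior S') :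
    p ∈ surfInterior S := by
  obtain ⟨h1, φ, hφ, h2⟩ := hi
  exact ⟨(h.mem_iff p hp).2 h1, e.trans φ, h.isSliceChart hφ, by simp [hp, h2]⟩

theorem IsPairDiffeo.mem_surfBoundary_of {e : OpenPartialHomeomorph M N} {S : Set M} {S' : Set N}
    (h : IsPairDiffeo e S S') {p : M} (hp : p ∈ e.source) (hi : e p ∈ surfBoundary S') :
    p ∈ surfBoundary S := by
  obtain ⟨h1, φ, hφ, h2, h3⟩ := hi
  exact ⟨(h.mem_iff p hp).2 h1, e.trans φ, h.isHalfSliceChart hφ, by simp [hp, h2], h3⟩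

theorem IsPairDiffeo.mem_surfInterior_iff {e : OpenPartialHomeomorph M N} {S : Set M} {S' : Set N}
    (h : IsPairDiffeo e S S') {p : M} (hp : p ∈ e.source) :
    p ∈ surfInterior S ↔ e p ∈ surfInterior S' :=
  ⟨fun hi => h.symm.mem_surfInterior_of (e.map_source hp) (by rwa [e.left_inv hp]),
    h.mem_surfInterior_of hp⟩

theorem IsPairDiffeo.mem_surfBoundary_iff {e : OpenPartialHomeomorph M N} {S : Set M} {S' : Set N}
    (h : IsPairDiffeo e S S') {p : M} (hp : p ∈ e.source) :
    p ∈ surfBoundary S ↔ e p ∈ surfBoundary S' :=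
  ⟨fun hi => h.symm.mem_surfBoundary_of (e.map_source hp) (by rwa [e.left_inv hp]),
    h.mem_surfBoundary_of hp⟩

theorem isPairDiffeo_diffeomorph (H : M ≃ₘ^∞⟮𝓡 3, 𝓡 3⟯ N) (S : Set M) :
    IsPairDiffeo H.toHomeomorph.toOpenPartialHomeomorph S (H '' S) where
  smooth := H.contMDiff.contMDiffOn
  smooth_symm := H.symm.contMDiff.contMDiffOn
  mem_iff _ _ := (H.injective.mem_set_image (s := S)).symm

theorem diffeomorph_mem_surfInterior_iff (H : M ≃ₘ^∞⟮𝓡 3, 𝓡 3⟯ N) (S : Set M) (p : M) :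
    H p ∈ surfInterior (H '' S) ↔ p ∈ surfInterior S :=
  ((isPairDiffeo_diffeomorph H S).mem_surfInterior_iff (mem_univ p)).symm

theorem diffeomorph_mem_surfBoundary_iff (H : M ≃ₘ^∞⟮𝓡 3, 𝓡 3⟯ N) (S : Set M) (p : M) :
    H p ∈ surfBoundary (H '' S) ↔ p ∈ surfBoundary S :=
  ((isPairDiffeo_diffeomorph H S).mem_surfBoundary_iff (mem_univ p)).symm

theorem IsCompactSurface.image (H : M ≃ₘ^∞⟮𝓡 3, 𝓡 3⟯ N) {S : Set M} (h : IsCompactSurface S) :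
    IsCompactSurface (H '' S) := by
  refine ⟨h.1.image H.continuous, ?_⟩
  rintro _ ⟨p, hp, rfl⟩
  rw [diffeomorph_mem_surfInterior_iff, diffeomorph_mem_surfBoundary_iff]
  exact h.2 p hp

/-- On the open part of the chart where the first coordinate is positive, the half-plane condition
is just `φ x 2 = 0`, so the restricted chart is a slice chart. -/
theorem IsHalfSliceChart.mem_surfInterior {S : Set M} {φ : OpenPartialHomeomorph M E3}
    (h : IsHalfSliceChart S φ) {p : M} (hp : p ∈ φ.source) (hS : p ∈ S) (h0 : 0 < φ p 0) :
    p ∈ surfInterior S := by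
  have hc : ContinuousOn (fun x => φ x 0) φ.source :=
    (EuclideanSpace.proj (𝕜 := ℝ) (0 : Fin 3)).continuous.comp_continuousOn φ.continuousOn
  have hU : IsOpen (φ.source ∩ (fun x => φ x 0) ⁻¹' Ioi 0) :=
    hc.isOpen_inter_preimage φ.open_source isOpen_Ioi
  have := (IsManifold.mem_maximalAtlas_iff_contMDiffOn φ).1 h.1
  refine ⟨hS, φ.restr _, ⟨(φ.restr (φ.source ∩ (fun x => φ x 0) ⁻¹' Ioi 0)
    |>.mem_maximalAtlas_of_contMDiffOn (this.1.mono (by simp)) (this.2.mono (by simp))),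
    fun x hx => ?_⟩, ?_⟩
  · rw [OpenPartialHomeomorph.restr_source, hU.interior_eq] at hx
    rw [h.2 x hx.1]
    exact ⟨fun h => h.1, fun h => ⟨h, le_of_lt hx.2.2⟩⟩
  · rw [OpenPartialHomeomorph.restr_source, hU.interior_eq]
    exact ⟨hp, hp, h0⟩

theorem contDiffAt_transition {φ ψ : OpenPartialHomeomorph M E3}
    (hφ : φ ∈ IsManifold.maximalAtlas (𝓡 3) ∞ M) (hψ : ψ ∈ IsManifold.maximalAtlas (𝓡 3) ∞ M)
    {p : M} (hp : p ∈ φ.source) (hp' : p ∈ ψ.source) :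
    ContDiffAt ℝ ∞ (fun x => ψ (φ.symm x)) (φ p) := by
  have h1 : ContMDiffAt (𝓡 3) (𝓡 3) ∞ φ.symm (φ p) :=
    contMDiffAt_symm_of_mem_maximalAtlas hφ (φ.map_source hp)
  have h2 : ContMDiffAt (𝓡 3) (𝓡 3) ∞ ψ (φ.symm (φ p)) := by
    rw [φ.left_inv hp]; exact contMDiffAt_of_mem_maximalAtlas hψ hp'
  exact contMDiffAt_iff_contDiffAt.1 (h2.comp _ h1)

/-- The reverse transition is a left inverse near the point, so by the chain rule its derivative is
a left inverse of this one. -/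
theorem fderiv_transition_injective {φ ψ : OpenPartialHomeomorph M E3}
    (hφ : φ ∈ IsManifold.maximalAtlas (𝓡 3) ∞ M) (hψ : ψ ∈ IsManifold.maximalAtlas (𝓡 3) ∞ M)
    {p : M} (hp : p ∈ φ.source) (hp' : p ∈ ψ.source) :
    Function.Injective (fderiv ℝ (fun x => ψ (φ.symm x)) (φ p)) := by
  have h1 := (contDiffAt_transition hφ hψ hp hp').differentiableAt (by simp)
  have h2 := (contDiffAt_transition hψ hφ hp' hp).differentiableAt (by simp)
  have h3 : (fun x => φ (ψ.symm x)) ∘ (fun x => ψ (φ.symm x)) =ᶠ[𝓝 (φ p)] id := by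
    have hc : ContinuousAt φ.symm (φ p) := φ.symm.continuousAt (φ.map_source hp)
    have e1 : ∀ᶠ x in 𝓝 (φ p), φ.symm x ∈ ψ.source :=
      hc.eventually_mem (ψ.open_source.mem_nhds (by rwa [φ.left_inv hp]))
    filter_upwards [e1, φ.open_target.mem_nhds (φ.map_source hp)] with x hx hx'
    simp [ψ.left_inv hx, φ.right_inv hx']
  have h4 : HasFDerivAt (fun x => φ (ψ.symm x)) (fderiv ℝ (fun x => φ (ψ.symm x)) (ψ p))
      ((fun x => ψ (φ.symm x)) (φ p)) := by
    simpa [φ.left_inv hp] using h2.hasFDerivAt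
  have h5 := (HasFDerivAt.comp (f := fun x => ψ (φ.symm x)) (φ p) h4 h1.hasFDerivAt).congr_of_eventuallyEq h3.symm
  have h6 := h5.unique (hasFDerivAt_id (𝕜 := ℝ) (φ p))
  intro v w hvw
  have := congrArg (fderiv ℝ (fun x => φ (ψ.symm x)) (ψ p)) hvw
  have e := fun v => DFunLike.congr_fun h6 v
  simp only [ContinuousLinearMap.comp_apply, ContinuousLinearMap.id_apply] at e
  rwa [e, e] at this

/-- Points near `φ p` in the coordinate plane lie on the surface. -/
theorem IsSliceChart.line_mem {S : Set M} {φ : OpenPartialHomeomorph M E3} (h : IsSliceChart S φ)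
    {p : M} (hp : p ∈ φ.source) (hS : p ∈ S) {v : E3} (hv : v 2 = 0) :
    ∀ᶠ t : ℝ in 𝓝 0, φ p + t • v ∈ φ.target ∧ φ.symm (φ p + t • v) ∈ S := by
  have hc : ContinuousAt (fun t : ℝ => φ p + t • v) 0 := by fun_prop
  have : ∀ᶠ t : ℝ in 𝓝 0, φ p + t • v ∈ φ.target :=
    hc.eventually_mem (φ.open_target.mem_nhds (by simpa using φ.map_source hp))
  filter_upwards [this] with t ht
  refine ⟨ht, (h.2 _ (φ.map_target ht)).2 ?_⟩
  rw [φ.right_inv ht]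
  simp [hv, (h.2 p hp).1 hS]

/-- Both notions only ask for some chart, so a point might a priori be of both kinds. A slice chart
provides a plane of directions of lines contained in `S`. Read in a half-slice chart, the first
coordinate has a minimum along such a line at `p` and the third vanishes. So the derivative of the
transition maps a plane into a line, against its injectivity. -/
theorem not_mem_surfBoundary_of_mem_surfInterior {S : Set M} {p : M} (h : p ∈ surfInterior S) :
    p ∉ surfBoundary S := by
  rintro ⟨-, ψ, hψ, hp', h0⟩
  obtain ⟨hS, φ, hφ, hp⟩ := h
  set T : E3 → E3 := fun x => ψ (φ.symm x) with hT
  have hd := (contDiffAt_transition hφ.1 hψ.1 hp hp').differentiableAt (by simp)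
  have hinj := fderiv_transition_injective hφ.1 hψ.1 hp hp'
  set L := fderiv ℝ T (φ p)
  have key : ∀ v : E3, v 2 = 0 → L v 0 = 0 ∧ L v 2 = 0 := by
    intro v hv
    have hγ : HasDerivAt (fun t : ℝ => φ p + t • v) v 0 := by
      simpa using ((hasDerivAt_id (0:ℝ)).smul_const v).const_add (φ p)
    have hL : HasDerivAt (fun t : ℝ => T (φ p + t • v)) (L v) 0 := by
      have : HasFDerivAt T L (φ p + (0:ℝ) • v) := by simpa using hd.hasFDerivAt
      exact this.comp_hasDerivAt 0 hγ
    have hi : ∀ i : Fin 3, HasDerivAt (fun t : ℝ => T (φ p + t • v) i) (L v i) 0 := fun i =>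
      ((EuclideanSpace.proj (𝕜 := ℝ) i).hasFDerivAt).comp_hasDerivAt 0 hL
    have hev : ∀ᶠ t : ℝ in 𝓝 0, T (φ p + t • v) 2 = 0 ∧ 0 ≤ T (φ p + t • v) 0 := by
      have hc : ContinuousAt (fun t : ℝ => φ.symm (φ p + t • v)) 0 := by
        refine ContinuousAt.comp (g := φ.symm) ?_ (by fun_prop)
        simpa using φ.symm.continuousAt (φ.map_source hp)
      filter_upwards [hφ.line_mem hp hS hv, hc.eventually_mem (ψ.open_source.mem_nhds (by
        simpa [φ.left_inv hp] using hp'))] with t ht ht'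
      exact (hψ.2 _ ht').1 ht.2
    constructor
    · have : IsLocalMin (fun t : ℝ => T (φ p + t • v) 0) 0 := by
        filter_upwards [hev] with t ht
        simpa [hT, φ.left_inv hp, h0] using ht.2
      rw [← (hi 0).deriv, this.deriv_eq_zero]
    · have : (fun t : ℝ => T (φ p + t • v) 2) =ᶠ[𝓝 0] fun _ => 0 := by
        filter_upwards [hev] with t ht using ht.1
      rw [← (hi 2).deriv, this.deriv_eq, deriv_const]
  set e0 : E3 := EuclideanSpace.single 0 1
  set e1 : E3 := EuclideanSpace.single 1 1
  obtain ⟨a0, a2⟩ := key e0 (by simp [e0])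
  obtain ⟨b0, b2⟩ := key e1 (by simp [e1])
  -- Both images have only a middle coordinate, so this combination cancels. Injectivity then gives
  -- `L e0 1 = 0`, whence `L e0 = 0`.
  have hz : L ((L e1 1) • e0 - (L e0 1) • e1) = L 0 := by
    rw [map_sub, map_smul, map_smul, map_zero]
    ext i; fin_cases i <;> simp [a0, a2, b0, b2, mul_comm]
  have hz := hinj hz
  have c0 := congrArg (fun v : E3 => v 0) hz
  have c1 := congrArg (fun v : E3 => v 1) hz
  simp [e0, e1] at c0 c1
  have : L e0 = L 0 := by
    rw [map_zero]; ext i; fin_cases i <;> simp [a0, a2, e0, c1]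
  have := congrArg (fun v : E3 => v 0) (hinj this)
  simp [e0] at this

theorem surfBoundary_subset (S : Set M) : surfBoundary S ⊆ S := fun _ h => h.1

theorem IsCompactSurface.mem_surfInterior_iff {S : Set M} (h : IsCompactSurface S) {p : M} :
    p ∈ surfInterior S ↔ p ∈ S ∧ p ∉ surfBoundary S :=
  ⟨fun hp => ⟨hp.1, not_mem_surfBoundary_of_mem_surfInterior hp⟩,
    fun hp => (h.2 p hp.1).resolve_right hp.2⟩

theorem eventually_mem_surfInterior {S : Set M} {p : M} (h : p ∈ surfInterior S) :
    ∀ᶠ x in 𝓝 p, x ∈ S → x ∈ surfInterior S := by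
  obtain ⟨-, φ, hφ, hp⟩ := h
  filter_upwards [φ.open_source.mem_nhds hp] with x hx hxS using ⟨hxS, φ, hφ, hx⟩

/-- Interior points are open in `S` and are not boundary points, so the boundary is closed in a
compact set. -/
theorem IsCompactSurface.isCompact_surfBoundary [T2Space M] {S : Set M} (h : IsCompactSurface S) :
    IsCompact (surfBoundary S) := by
  refine h.1.of_isClosed_subset ?_ (surfBoundary_subset S)
  rw [← isOpen_compl_iff, isOpen_iff_mem_nhds]
  intro p hp
  by_cases hS : p ∈ S
  · filter_upwards [eventually_mem_surfInterior (h.mem_surfInterior_iff.2 ⟨hS, hp⟩)] with x hx hx'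
    exact not_mem_surfBoundary_of_mem_surfInterior (hx hx'.1) hx'
  · filter_upwards [h.1.isClosed.isOpen_compl.mem_nhds hS] with x hx hx' using hx hx'.1

theorem IsHalfSliceChart.mem_surfBoundary_iff {S : Set M} {φ : OpenPartialHomeomorph M E3}
    (h : IsHalfSliceChart S φ) {p : M} (hp : p ∈ φ.source) :
    p ∈ surfBoundary S ↔ φ p 2 = 0 ∧ φ p 0 = 0 := by
  constructor
  · intro hb
    obtain ⟨h2, h0⟩ := (h.2 p hp).1 hb.1
    refine ⟨h2, le_antisymm (not_lt.1 fun h1 => ?_) h0⟩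
    exact not_mem_surfBoundary_of_mem_surfInterior (h.mem_surfInterior hp hb.1 h1) hb
  · rintro ⟨h2, h0⟩
    exact ⟨(h.2 p hp).2 ⟨h2, h0.ge⟩, φ, h, hp, h0⟩

/-- The derivative of a function vanishing on a surface is a multiple of the conormal. -/
theorem IsSliceChart.exists_deriv_eq_mul_normalSpeed {S : Set M} {φ : OpenPartialHomeomorph M E3}
    (h : IsSliceChart S φ) {p : M} (hp : p ∈ φ.source) (hS : p ∈ S) {q : M → ℝ}
    (hq : ContMDiffAt (𝓡 3) 𝓘(ℝ, ℝ) ∞ q p) (h0 : ∀ᶠ x in 𝓝 p, x ∈ S → q x = 0) :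
    ∃ l : ℝ, ∀ γ : ℝ → M, γ 0 = p → MDifferentiableAt 𝓘(ℝ, ℝ) (𝓡 3) γ 0 →
      deriv (fun t => q (γ t)) 0 = l * normalSpeed φ γ := by
  set r : E3 → ℝ := fun x => q (φ.symm x) with hr
  have hrd : DifferentiableAt ℝ r (φ p) := by
    have h1 : ContMDiffAt (𝓡 3) (𝓡 3) ∞ φ.symm (φ p) :=
      contMDiffAt_symm_of_mem_maximalAtlas h.1 (φ.map_source hp)
    have h2 : ContMDiffAt (𝓡 3) 𝓘(ℝ, ℝ) ∞ q (φ.symm (φ p)) := by rwa [φ.left_inv hp]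
    exact (contMDiffAt_iff_contDiffAt.1 (h2.comp _ h1)).differentiableAt (by simp)
  set L := fderiv ℝ r (φ p)
  have key : ∀ v : E3, v 2 = 0 → L v = 0 := by
    intro v hv
    have hγ : HasDerivAt (fun t : ℝ => φ p + t • v) v 0 := by
      simpa using ((hasDerivAt_id (0:ℝ)).smul_const v).const_add (φ p)
    have hL : HasDerivAt (fun t : ℝ => r (φ p + t • v)) (L v) 0 := by
      have : HasFDerivAt r L (φ p + (0:ℝ) • v) := by simpa using hrd.hasFDerivAt
      exact this.comp_hasDerivAt 0 hγ
    have hev : (fun t : ℝ => r (φ p + t • v)) =ᶠ[𝓝 0] fun _ => 0 := by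
      have hc : ContinuousAt (fun t : ℝ => φ.symm (φ p + t • v)) 0 := by
        refine ContinuousAt.comp (g := φ.symm) ?_ (by fun_prop)
        simpa using φ.symm.continuousAt (φ.map_source hp)
      have h0' : ∀ᶠ x in 𝓝 (φ.symm (φ p + (0:ℝ) • v)), x ∈ S → q x = 0 := by
        simpa [φ.left_inv hp] using h0
      filter_upwards [h.line_mem hp hS hv, hc.eventually h0'] with t ht ht'
      exact ht' ht.2
    rw [← hL.deriv, hev.deriv_eq, deriv_const]
  -- `L` kills the coordinate plane, so it sees only the normal coordinate of a velocity. The factor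
  -- does not depend on the curve.
  refine ⟨L (EuclideanSpace.single 2 1), fun γ hγ0 hγ => ?_⟩
  have hφ : MDifferentiableAt (𝓡 3) (𝓡 3) φ (γ 0) := by
    rw [hγ0]; exact (contMDiffAt_of_mem_maximalAtlas h.1 hp).mdifferentiableAt (by simp)
  have hd : DifferentiableAt ℝ (fun t => φ (γ t)) 0 :=
    mdifferentiableAt_iff_differentiableAt.1 (hφ.comp 0 hγ)
  set v := deriv (fun t => φ (γ t)) 0
  have hv : HasDerivAt (fun t => φ (γ t)) v 0 := hd.hasDerivAt
  have hn : normalSpeed φ γ = v 2 :=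
    (((EuclideanSpace.proj (𝕜 := ℝ) (2 : Fin 3)).hasFDerivAt).comp_hasDerivAt 0 hv).deriv
  have h1 : HasDerivAt (fun t => r (φ (γ t))) (L v) 0 := by
    have : HasFDerivAt r L (φ (γ 0)) := by rw [hγ0]; exact hrd.hasFDerivAt
    exact this.comp_hasDerivAt 0 hv
  have h2 : (fun t => q (γ t)) =ᶠ[𝓝 0] fun t => r (φ (γ t)) := by
    have : ∀ᶠ t in 𝓝 (0:ℝ), γ t ∈ φ.source :=
      hγ.continuousAt.eventually_mem (φ.open_source.mem_nhds (by rwa [hγ0]))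
    filter_upwards [this] with t ht
    simp [hr, φ.left_inv ht]
  rw [h2.deriv_eq, h1.deriv, hn]
  have hdec : v = (v - EuclideanSpace.single 2 (v 2)) + (v 2) • EuclideanSpace.single 2 1 := by
    ext i; fin_cases i <;> simp
  rw [hdec, map_add, key _ (by simp), map_smul]
  simp [mul_comm]

end Surfaces

end HopfSection

namespace HopfSection
open scoped Topology
open Set Filter

/-! ### Smooth flows and implicit functions -/

section Flows

variable {M : Type} [TopologicalSpace M] [ChartedSpace E3 M] [IsManifold (𝓡 3) ∞ M]

/-- A smooth action of `ℝ` on `M`. -/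
structure IsSmoothFlow (Θ : ℝ → M → M) : Prop where
  smooth : ContMDiff (𝓘(ℝ, ℝ).prod (𝓡 3)) (𝓡 3) ∞ (fun q : ℝ × M => Θ q.1 q.2)
  zero : ∀ x, Θ 0 x = x
  add : ∀ s t x, Θ (s + t) x = Θ s (Θ t x)

/-- The derivative of `f` along the flow `Θ`. -/
def flowDeriv (Θ : ℝ → M → M) (f : M → ℝ) (x : M) : ℝ := deriv (fun t => f (Θ t x)) 0

theorem contDiffAt_comp_chart_symm {F : Type} [NormedAddCommGroup F] [NormedSpace ℝ F]
    {G : ℝ × M → F} {t0 : ℝ} {x0 : M}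
    (hG : ContMDiffAt (𝓘(ℝ, ℝ).prod (𝓡 3)) 𝓘(ℝ, F) ∞ G (t0, x0)) {φ : OpenPartialHomeomorph M E3}
    (hφ : φ ∈ IsManifold.maximalAtlas (𝓡 3) ∞ M) (hx : x0 ∈ φ.source) :
    ContDiffAt ℝ ∞ (fun y : ℝ × E3 => G (y.1, φ.symm y.2)) (t0, φ x0) := by
  rw [← contMDiffAt_iff_contDiffAt]
  have h1 : ContMDiffAt 𝓘(ℝ, ℝ × E3) 𝓘(ℝ, ℝ) ∞ (fun y : ℝ × E3 => y.1) (t0, φ x0) :=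
    contDiff_fst.contMDiff.contMDiffAt
  have h2 : ContMDiffAt 𝓘(ℝ, ℝ × E3) (𝓡 3) ∞ (fun y : ℝ × E3 => y.2) (t0, φ x0) :=
    contDiff_snd.contMDiff.contMDiffAt
  have h3 : ContMDiffAt (𝓡 3) (𝓡 3) ∞ φ.symm (φ x0) :=
    contMDiffAt_symm_of_mem_maximalAtlas hφ (φ.map_source hx)
  have h4 := h1.prodMk (h3.comp (t0, φ x0) h2)
  refine ContMDiffAt.comp (t0, φ x0) (g := G) ?_ h4
  simpa [φ.left_inv hx] using hG

theorem continuousAt_deriv_of_contMDiffAt {G : ℝ × M → ℝ} {x0 : M}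
    (hG : ContMDiffAt (𝓘(ℝ, ℝ).prod (𝓡 3)) 𝓘(ℝ, ℝ) ∞ G (0, x0)) :
    ContinuousAt (fun x => deriv (fun t => G (t, x)) 0) x0 := by
  set φ := chartAt E3 x0
  have hx : x0 ∈ φ.source := mem_chart_source E3 x0
  have hφ : φ ∈ IsManifold.maximalAtlas (𝓡 3) ∞ M := IsManifold.chart_mem_maximalAtlas x0
  set K : ℝ × E3 → ℝ := fun y => G (y.1, φ.symm y.2)
  have hK : ContDiffAt ℝ ∞ K (0, φ x0) := contDiffAt_comp_chart_symm hG hφ hx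
  have hev : ∀ᶠ y in 𝓝 ((0 : ℝ), φ x0), DifferentiableAt ℝ K y := by
    have : ContDiffAt ℝ 1 K (0, φ x0) := hK.of_le (by simp)
    filter_upwards [this.eventually (by simp)] with y hy using hy.differentiableAt (by simp)
  have hc : ContinuousAt (fun y => fderiv ℝ K y (1, 0)) (0, φ x0) := by
    have : ContinuousAt (fderiv ℝ K) (0, φ x0) :=
      (hK.fderiv_right (m := 0) (by simp)).continuousAt
    exact this.clm_apply continuousAt_const
  have hm : ContinuousAt (fun x : M => ((0 : ℝ), φ x)) x0 :=
    continuousAt_const.prodMk (φ.continuousAt hx)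
  have h1 : ContinuousAt (fun x => fderiv ℝ K (0, φ x) (1, 0)) x0 :=
    ContinuousAt.comp (f := fun x : M => ((0 : ℝ), φ x)) hc hm
  refine h1.congr ?_
  filter_upwards [hm.eventually hev, φ.open_source.mem_nhds hx] with x hx1 hx2
  have h2 : HasDerivAt (fun t : ℝ => (t, φ x)) ((1 : ℝ), (0 : E3)) 0 :=
    (hasDerivAt_id (0 : ℝ)).prodMk (hasDerivAt_const _ _)
  have h3 := (hx1.hasFDerivAt.comp_hasDerivAt (f := fun t : ℝ => (t, φ x)) 0 h2).deriv
  rw [← h3]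
  simp [K, Function.comp_def, φ.left_inv hx2]

/-- The implicit function theorem for one real equation on `ℝ × M`, solved for the real variable. -/
theorem exists_implicit_time {F : ℝ × M → ℝ} {t0 : ℝ} {x0 : M}
    (hF : ContMDiffAt (𝓘(ℝ, ℝ).prod (𝓡 3)) 𝓘(ℝ, ℝ) ∞ F (t0, x0)) (h0 : F (t0, x0) = 0)
    (hd : deriv (fun t => F (t, x0)) t0 ≠ 0) :
    ∃ τ : M → ℝ, ContMDiffAt (𝓡 3) 𝓘(ℝ, ℝ) ∞ τ x0 ∧ τ x0 = t0 ∧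
      ∀ᶠ y in 𝓝 (t0, x0), (F y = 0 ↔ y.1 = τ y.2) := by
  set φ := chartAt E3 x0
  have hx : x0 ∈ φ.source := mem_chart_source E3 x0
  have hφ : φ ∈ IsManifold.maximalAtlas (𝓡 3) ∞ M := IsManifold.chart_mem_maximalAtlas x0
  set K : E3 × ℝ → ℝ := fun y => F (y.2, φ.symm y.1) with hKdef
  have hK : ContDiffAt ℝ ∞ K (φ x0, t0) := by
    have h1 := contDiffAt_comp_chart_symm hF hφ hx
    exact ContDiffAt.comp (φ x0, t0) (f := fun y : E3 × ℝ => (y.2, y.1))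
      (g := fun y : ℝ × E3 => F (y.1, φ.symm y.2)) h1 (by fun_prop)
  have hinv : (fderiv ℝ K (φ x0, t0) ∘L .inr ℝ E3 ℝ).IsInvertible := by
    have h2 : HasDerivAt (fun t : ℝ => (φ x0, t)) ((0 : E3), (1 : ℝ)) t0 :=
      (hasDerivAt_const _ _).prodMk (hasDerivAt_id t0)
    have h3 := ((hK.differentiableAt (by simp)).hasFDerivAt.comp_hasDerivAt
      (f := fun t : ℝ => (φ x0, t)) t0 h2).deriv
    have h4 : fderiv ℝ K (φ x0, t0) (0, 1) ≠ 0 := by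
      rw [← h3]; simpa [K, Function.comp_def, φ.left_inv hx] using hd
    refine ⟨ContinuousLinearEquiv.unitsEquivAut ℝ (Units.mk0 _ h4), ?_⟩
    ext; simp
  set τ := hK.implicitFunction (by simp) hinv
  refine ⟨fun x => τ (φ x), ?_, ?_, ?_⟩
  · have h1 : ContMDiffAt (𝓡 3) 𝓘(ℝ, ℝ) ∞ τ (φ x0) :=
      (hK.contDiffAt_implicitFunction (by simp) hinv).contMDiffAt
    exact h1.comp x0 (contMDiffAt_of_mem_maximalAtlas hφ hx)
  · exact hK.implicitFunction_apply_self (by simp) hinv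
  · have h1 := hK.eventually_apply_eq_iff_implicitFunction (by simp) hinv
    have hm : ContinuousAt (fun y : ℝ × M => (φ y.2, y.1)) (t0, x0) := by
      refine ContinuousAt.prodMk ?_ continuousAt_fst
      exact ContinuousAt.comp (g := φ) (φ.continuousAt hx) continuousAt_snd
    have hs : ∀ᶠ y : ℝ × M in 𝓝 (t0, x0), y.2 ∈ φ.source :=
      continuousAt_snd.eventually_mem (φ.open_source.mem_nhds hx)
    filter_upwards [hm.eventually h1, hs] with y hy hy'
    have e0 : K (φ x0, t0) = 0 := by simp [K, φ.left_inv hx, h0]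
    simp only [K, φ.left_inv hy'] at hy
    rw [show F (t0, φ.symm (φ x0)) = 0 from e0] at hy
    rw [hy]; exact eq_comm

variable {Θ Ψ : ℝ → M → M}

theorem IsSmoothFlow.smooth_curve (h : IsSmoothFlow Θ) (x : M) :
    ContMDiff 𝓘(ℝ, ℝ) (𝓡 3) ∞ (fun t => Θ t x) :=
  h.smooth.comp (contMDiff_id.prodMk contMDiff_const)

theorem IsSmoothFlow.neg_cancel (h : IsSmoothFlow Θ) (t : ℝ) (x : M) : Θ (-t) (Θ t x) = x := by
  rw [← h.add, neg_add_cancel, h.zero]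

theorem IsSmoothFlow.cancel_neg (h : IsSmoothFlow Θ) (t : ℝ) (x : M) : Θ t (Θ (-t) x) = x := by
  rw [← h.add, add_neg_cancel, h.zero]

theorem IsSmoothFlow.contMDiffAt_comp (h : IsSmoothFlow Θ) {f : M → ℝ} {t0 : ℝ} {x0 : M}
    (hf : ContMDiffAt (𝓡 3) 𝓘(ℝ, ℝ) ∞ f (Θ t0 x0)) :
    ContMDiffAt (𝓘(ℝ, ℝ).prod (𝓡 3)) 𝓘(ℝ, ℝ) ∞ (fun q : ℝ × M => f (Θ q.1 q.2)) (t0, x0) :=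
  ContMDiffAt.comp (t0, x0) (g := f) hf h.smooth.contMDiffAt

theorem IsSmoothFlow.continuousAt_flowDeriv (h : IsSmoothFlow Θ) {f : M → ℝ} {x0 : M}
    (hf : ContMDiffAt (𝓡 3) 𝓘(ℝ, ℝ) ∞ f x0) : ContinuousAt (flowDeriv Θ f) x0 :=
  continuousAt_deriv_of_contMDiffAt (G := fun q : ℝ × M => f (Θ q.1 q.2))
    (h.contMDiffAt_comp (by rwa [h.zero]))

theorem IsSmoothFlow.hasDerivAt (h : IsSmoothFlow Θ) {f : M → ℝ} {t0 : ℝ} {x0 : M}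
    (hf : ContMDiffAt (𝓡 3) 𝓘(ℝ, ℝ) ∞ f (Θ t0 x0)) :
    HasDerivAt (fun t => f (Θ t x0)) (flowDeriv Θ f (Θ t0 x0)) t0 := by
  have h1 : ContMDiffAt 𝓘(ℝ, ℝ) 𝓘(ℝ, ℝ) ∞ (fun t => f (Θ t x0)) t0 :=
    ContMDiffAt.comp t0 (g := f) hf (h.smooth_curve x0).contMDiffAt
  have h2 := ((contMDiffAt_iff_contDiffAt.1 h1).differentiableAt (by simp)).hasDerivAt
  have h3 : flowDeriv Θ f (Θ t0 x0) = deriv (fun t => f (Θ t x0)) t0 := by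
    unfold flowDeriv
    simp_rw [← h.add]
    rw [deriv_comp_add_const (f := fun t => f (Θ t x0)), zero_add]
  rw [h3]; exact h2

/-- The derivative of `f` along a curve `t ↦ Θ_{σ(t)} Ψ_t p`. -/
theorem hasDerivAt_comp_two_flows (hΘ : IsSmoothFlow Θ) (hΨ : IsSmoothFlow Ψ) {f : M → ℝ} {p : M}
    (hf : ContMDiffAt (𝓡 3) 𝓘(ℝ, ℝ) ∞ f p) {σ : ℝ → ℝ} {σ' : ℝ} (hσ : HasDerivAt σ σ' 0)
    (h0 : σ 0 = 0) :
    HasDerivAt (fun t => f (Θ (σ t) (Ψ t p))) (flowDeriv Ψ f p + σ' * flowDeriv Θ f p) 0 := by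
  set G : ℝ × ℝ → ℝ := fun y => f (Θ y.1 (Ψ y.2 p)) with hG
  have hGd : DifferentiableAt ℝ G (0, 0) := by
    have h1 : ContMDiffAt 𝓘(ℝ, ℝ × ℝ) 𝓘(ℝ, ℝ) ∞ (fun y : ℝ × ℝ => y.1) (0, 0) :=
      contDiff_fst.contMDiff.contMDiffAt
    have h2 : ContMDiffAt 𝓘(ℝ, ℝ × ℝ) 𝓘(ℝ, ℝ) ∞ (fun y : ℝ × ℝ => y.2) (0, 0) :=
      contDiff_snd.contMDiff.contMDiffAt
    have h3 := h1.prodMk ((hΨ.smooth_curve p).contMDiffAt.comp ((0 : ℝ), (0 : ℝ)) h2)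
    have h4 := ContMDiffAt.comp ((0 : ℝ), (0 : ℝ)) (g := fun q : ℝ × M => Θ q.1 q.2)
      hΘ.smooth.contMDiffAt h3
    have h5 : ContMDiffAt 𝓘(ℝ, ℝ × ℝ) 𝓘(ℝ, ℝ) ∞ G (0, 0) :=
      ContMDiffAt.comp ((0 : ℝ), (0 : ℝ)) (g := f) (by simpa [hΘ.zero, hΨ.zero] using hf) h4
    exact (contMDiffAt_iff_contDiffAt.1 h5).differentiableAt (by simp)
  have key : ∀ {a b : ℝ → ℝ} {a' b' : ℝ}, HasDerivAt a a' 0 → HasDerivAt b b' 0 → a 0 = 0 → b 0 = 0 →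
      HasDerivAt (fun t => G (a t, b t)) (fderiv ℝ G (0, 0) (a', b')) 0 := by
    intro a b a' b' ha hb ha0 hb0
    have : HasFDerivAt G (fderiv ℝ G (0, 0)) (a 0, b 0) := by
      rw [ha0, hb0]; exact hGd.hasFDerivAt
    exact this.comp_hasDerivAt (f := fun t => (a t, b t)) 0 (ha.prodMk hb)
  have e1 : flowDeriv Ψ f p = fderiv ℝ G (0, 0) (0, 1) := by
    rw [← (key (hasDerivAt_const (0:ℝ) (0:ℝ)) (hasDerivAt_id (0:ℝ)) rfl rfl).deriv]
    simp [G, flowDeriv, hΘ.zero]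
  have e2 : flowDeriv Θ f p = fderiv ℝ G (0, 0) (1, 0) := by
    rw [← (key (hasDerivAt_id (0:ℝ)) (hasDerivAt_const (0:ℝ) (0:ℝ)) rfl rfl).deriv]
    simp [G, flowDeriv, hΨ.zero]
  have := key hσ (hasDerivAt_id (0:ℝ)) h0 rfl
  have e3 : flowDeriv Ψ f p + σ' * flowDeriv Θ f p = fderiv ℝ G (0, 0) (σ', 1) := by
    rw [e1, e2, ← smul_eq_mul, ← map_smul, ← map_add]
    simp
  rw [e3]; exact this

end Flows

/-! ### Shearing a manifold along a flow -/

section Shear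

variable {M : Type} [TopologicalSpace M] [ChartedSpace E3 M] [IsManifold (𝓡 3) ∞ M]
  {Θ Ψ : ℝ → M → M}

/-- The equation says that the shear `x ↦ Θ (α x) x` sends `Θ (-b) y` to `y`. Its left side is
strictly increasing in `b`, with derivative `1 + flowDeriv Θ α > 0`, and it changes sign because `α`
is bounded on a compact manifold. -/
theorem exists_unique_shear_time [CompactSpace M] (hΘ : IsSmoothFlow Θ) {α : M → ℝ}
    (hα : ContMDiff (𝓡 3) 𝓘(ℝ, ℝ) ∞ α) (hY : ∀ x, -1 < flowDeriv Θ α x) (y : M) :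
    ∃! b : ℝ, b - α (Θ (-b) y) = 0 := by
  have hd : ∀ b, HasDerivAt (fun b => b - α (Θ (-b) y)) (1 + flowDeriv Θ α (Θ (-b) y)) b := by
    intro b
    have h1 := hΘ.hasDerivAt (t0 := -b) (x0 := y) hα.contMDiffAt
    have h2 := h1.comp b (hasDerivAt_neg b)
    have h3 := (hasDerivAt_id b).sub h2
    rw [mul_neg_one, sub_neg_eq_add] at h3
    exact h3
  have hmono : StrictMono (fun b => b - α (Θ (-b) y)) := by
    refine strictMono_of_deriv_pos fun b => ?_
    rw [(hd b).deriv]; linarith [hY (Θ (-b) y)]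
  have hcont : Continuous (fun b => b - α (Θ (-b) y)) :=
    continuous_iff_continuousAt.2 fun b => (hd b).continuousAt
  obtain ⟨C, hC⟩ := isCompact_univ.exists_bound_of_continuousOn hα.continuous.continuousOn
  have hC' : ∀ x, |α x| ≤ C := fun x => hC x (mem_univ x)
  have h1 : (fun b => b - α (Θ (-b) y)) (-C) ≤ 0 := by
    have := (abs_le.1 (hC' (Θ (-(-C)) y))).1; simp only; linarith
  have h2 : 0 ≤ (fun b => b - α (Θ (-b) y)) C := by
    have := (abs_le.1 (hC' (Θ (-C) y))).2; simp only; linarith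
  obtain ⟨b, hb⟩ := mem_range_of_exists_le_of_exists_ge hcont ⟨_, h1⟩ ⟨_, h2⟩
  exact ⟨b, hb, fun b' hb' => hmono.injective (hb'.trans hb.symm)⟩

/-- The inverse moves `y` back for the unique time `β y`. The implicit function theorem gives a
smooth local solution, which agrees with `β` by uniqueness. -/
theorem exists_shear [CompactSpace M] (hΘ : IsSmoothFlow Θ) {α : M → ℝ}
    (hα : ContMDiff (𝓡 3) 𝓘(ℝ, ℝ) ∞ α) (hY : ∀ x, -1 < flowDeriv Θ α x) :
    ∃ D : M ≃ₘ^∞⟮𝓡 3, 𝓡 3⟯ M, ∀ x, D x = Θ (α x) x := by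
  choose β hβ hβu using exists_unique_shear_time hΘ hα hY
  have hβs : ContMDiff (𝓡 3) 𝓘(ℝ, ℝ) ∞ β := by
    intro y0
    set F : ℝ × M → ℝ := fun q => q.1 - α (Θ (-q.1) q.2) with hF
    have hFs : ContMDiff (𝓘(ℝ, ℝ).prod (𝓡 3)) 𝓘(ℝ, ℝ) ∞ F := by
      have h1 : ContMDiff (𝓘(ℝ, ℝ).prod (𝓡 3)) 𝓘(ℝ, ℝ) ∞ (fun q : ℝ × M => q.1) := contMDiff_fst
      have h2 : ContMDiff (𝓘(ℝ, ℝ).prod (𝓡 3)) (𝓘(ℝ, ℝ).prod (𝓡 3)) ∞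
          (fun q : ℝ × M => (-q.1, q.2)) :=
        (contDiff_neg.contMDiff.comp h1).prodMk contMDiff_snd
      exact h1.sub (hα.comp (hΘ.smooth.comp h2))
    have hd : deriv (fun t => F (t, y0)) (β y0) ≠ 0 := by
      have h1 := hΘ.hasDerivAt (t0 := -β y0) (x0 := y0) hα.contMDiffAt
      have h2 := (hasDerivAt_id (β y0)).sub (h1.comp (β y0) (hasDerivAt_neg (β y0)))
      have h3 : deriv (fun t => F (t, y0)) (β y0) = 1 - flowDeriv Θ α (Θ (-β y0) y0) * -1 :=
        h2.deriv
      rw [h3]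
      have := hY (Θ (-β y0) y0)
      intro h; linarith
    obtain ⟨τ, hτs, hτ0, hτ⟩ := exists_implicit_time (hFs (β y0, y0)) (hβ y0) hd
    refine hτs.congr_of_eventuallyEq ?_
    have hm : ContinuousAt (fun y => (τ y, y)) y0 := hτs.continuousAt.prodMk continuousAt_id
    have : ∀ᶠ y in 𝓝 y0, F (τ y, y) = 0 ↔ τ y = τ y := by
      have h' : ∀ᶠ q in 𝓝 (τ y0, y0), (F q = 0 ↔ q.1 = τ q.2) := by rwa [hτ0]
      exact hm.eventually h'
    filter_upwards [this] with y hy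
    exact (hβu y (τ y) (hy.2 rfl)).symm
  refine ⟨⟨⟨fun x => Θ (α x) x, fun y => Θ (-β y) y, ?_, ?_⟩, ?_, ?_⟩, fun x => rfl⟩
  · intro x
    have : β (Θ (α x) x) = α x := by
      refine (hβu _ (α x) ?_).symm
      simp [hΘ.neg_cancel]
    simp only [this, hΘ.neg_cancel]
  · intro y
    have : α (Θ (-β y) y) = β y := by
      have := hβ y; simp only at this; linarith
    simp only [this, hΘ.cancel_neg]
  · exact hΘ.smooth.comp (hα.prodMk contMDiff_id)
  · exact hΘ.smooth.comp ((contDiff_neg.contMDiff.comp hβs).prodMk contMDiff_id)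

/-- Isotopies of sections obtained by shearing along a flow commuting with the given one. -/
theorem exists_isotopicSections_of_shear [CompactSpace M] (hΘ : IsSmoothFlow Θ)
    (hΨ : IsSmoothFlow Ψ) (hcomm : ∀ s t x, Θ s (Ψ t x) = Ψ t (Θ s x)) {α : M → ℝ}
    (hα : ContMDiff (𝓡 3) 𝓘(ℝ, ℝ) ∞ α) (hY : ∀ x, -1 < flowDeriv Θ α x) {S : Set M}
    (hS : ∀ φ, IsSliceChart S φ → ∀ p ∈ φ.source, p ∈ S →
      0 < normalSpeed φ (fun t => Ψ t p) * (normalSpeed φ (fun t => Ψ t p) -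
        flowDeriv Ψ α p / (1 + flowDeriv Θ α p) * normalSpeed φ (fun t => Θ t p))) :
    ∃ D : M ≃ₘ^∞⟮𝓡 3, 𝓡 3⟯ M, (∀ x, D x = Θ (α x) x) ∧ IsotopicSections Ψ S (D '' S) ∧
      ∀ φ, IsSliceChart (D '' S) φ → ∀ p ∈ φ.source, p ∈ D '' S →
        normalSpeed φ (fun t => Ψ t p) ≠ 0 := by
  -- Scaling `α` by a factor in [0, 1] keeps its rate along `Θ` above -1, so every stage of the
  -- isotopy is again a shear.
  have hH : ∀ s : ℝ, ∃ D : M ≃ₘ^∞⟮𝓡 3, 𝓡 3⟯ M, ∀ x, D x = Θ (Real.smoothTransition s * α x) x := by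
    intro s
    refine exists_shear hΘ (α := fun x => Real.smoothTransition s * α x)
      (contMDiff_const.mul hα) fun x => ?_
    have h0 := Real.smoothTransition.nonneg s
    have h1 := Real.smoothTransition.le_one s
    have : flowDeriv Θ (fun x => Real.smoothTransition s * α x) x =
        Real.smoothTransition s * flowDeriv Θ α x := by
      simp [flowDeriv]
    rw [this]
    have := hY x
    by_cases h : 0 ≤ flowDeriv Θ α x
    · have := mul_nonneg h0 h; linarith
    · nlinarith
  choose H hH using hH
  have hH1 : ∀ x, H 1 x = Θ (α x) x := fun x => by simp [hH, Real.smoothTransition.one]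
  have key : ∀ φ, IsSliceChart (H 1 '' S) φ → ∀ p ∈ S, H 1 p ∈ φ.source →
      0 < normalSpeed φ (fun t => H 1 (Ψ t p)) * normalSpeed φ (fun t => Ψ t (H 1 p)) := by
    intro φ hφ p hpS hp
    set e := (H 1).toHomeomorph.toOpenPartialHomeomorph
    have hφ' : IsSliceChart S (e.trans φ) := (isPairDiffeo_diffeomorph (H 1) S).isSliceChart hφ
    have hp' : p ∈ (e.trans φ).source := by
      rw [OpenPartialHomeomorph.trans_source]; exact ⟨mem_univ p, hp⟩
    set u : M → ℝ := fun x => φ (H 1 x) 2 with hu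
    have hus : ContMDiffAt (𝓡 3) 𝓘(ℝ, ℝ) ∞ u p := by
      have h1 : ContMDiffAt (𝓡 3) (𝓡 3) ∞ (e.trans φ) p := contMDiffAt_of_mem_maximalAtlas hφ'.1 hp'
      have h2 : ContMDiffAt (𝓡 3) 𝓘(ℝ, ℝ) ∞ (EuclideanSpace.proj (𝕜 := ℝ) (2 : Fin 3))
        ((e.trans φ) p) := (ContinuousLinearMap.contDiff _).contMDiff.contMDiffAt
      exact h2.comp p h1
    -- The flow line through the image point is pulled back to `S`. As the two flows commute, the
    -- pulled-back curve is the flow line of `Ψ` through `p`, displaced along `Θ` by `σ`.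
    set γ : ℝ → M := fun t => (H 1).symm (Ψ t (H 1 p)) with hγ
    have hγs : ContMDiff 𝓘(ℝ, ℝ) (𝓡 3) ∞ γ := (H 1).symm.contMDiff.comp (hΨ.smooth_curve _)
    set σ : ℝ → ℝ := fun t => α p - α (γ t) with hσ
    have hγ0 : γ 0 = p := by simp [hγ, hΨ.zero]
    have hγeq : ∀ t, γ t = Θ (σ t) (Ψ t p) := by
      intro t
      have h1 : Θ (α (γ t)) (γ t) = Ψ t (Θ (α p) p) := by
        rw [← hH1, ← hH1, hγ]; simp
      have h2 : γ t = Θ (-α (γ t)) (Ψ t (Θ (α p) p)) := by rw [← h1, hΘ.neg_cancel]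
      rw [← hcomm, ← hΘ.add] at h2
      rwa [show -α (γ t) + α p = σ t by simp only [hσ]; ring] at h2
    have hσd : DifferentiableAt ℝ σ 0 := by
      have h1 : ContMDiff 𝓘(ℝ, ℝ) 𝓘(ℝ, ℝ) ∞ σ := contMDiff_const.sub (hα.comp hγs)
      exact (contMDiff_iff_contDiff.1 h1).differentiable (by simp) 0
    have hσ0 : σ 0 = 0 := by simp [hσ, hγ0]
    -- Since `σ t = α p - α (Θ (σ t) (Ψ t p))`, differentiation yields a linear equation for `deriv
    -- σ 0`, solvable because `1 + flowDeriv Θ α p` is positive.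
    have hσ' : deriv σ 0 = -(flowDeriv Ψ α p / (1 + flowDeriv Θ α p)) := by
      have h1 := hasDerivAt_comp_two_flows hΘ hΨ hα.contMDiffAt (p := p) hσd.hasDerivAt hσ0
      have h2 : HasDerivAt σ (-(flowDeriv Ψ α p + deriv σ 0 * flowDeriv Θ α p)) 0 := by
        have := h1.const_sub (α p)
        simp_rw [← hγeq] at this
        exact this
      have h3 := h2.deriv
      have h4 : 1 + flowDeriv Θ α p ≠ 0 := by have := hY p; intro h; linarith
      rw [eq_neg_iff_add_eq_zero]; field_simp; linarith
    have e1 : normalSpeed φ (fun t => H 1 (Ψ t p)) =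
        normalSpeed (e.trans φ) (fun t => Ψ t p) := rfl
    have e2 : normalSpeed φ (fun t => Ψ t (H 1 p)) = normalSpeed (e.trans φ) (fun t => Ψ t p) -
        flowDeriv Ψ α p / (1 + flowDeriv Θ α p) * normalSpeed (e.trans φ) (fun t => Θ t p) := by
      have h1 := hasDerivAt_comp_two_flows hΘ hΨ hus hσd.hasDerivAt hσ0
      simp_rw [← hγeq, hσ'] at h1
      have h2 : normalSpeed φ (fun t => Ψ t (H 1 p)) = deriv (fun t => u (γ t)) 0 := by
        simp [normalSpeed, hu, hγ]
      rw [h2, h1.deriv, neg_mul, ← sub_eq_add_neg]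
      rfl
    rw [e1, e2]
    exact hS _ hφ' p hp' hpS
  refine ⟨H 1, hH1, ⟨H, ⟨?_, fun x => ?_⟩, rfl, key⟩, ?_⟩
  · have h1 : ContMDiff (𝓘(ℝ, ℝ).prod (𝓡 3)) 𝓘(ℝ, ℝ) ∞
        (fun q : ℝ × M => Real.smoothTransition q.1 * α q.2) :=
      ((Real.smoothTransition.contDiff (n := ⊤)).contMDiff.comp contMDiff_fst).mul
        (hα.comp contMDiff_snd)
    have h2 := hΘ.smooth.comp (h1.prodMk contMDiff_snd)
    refine h2.congr fun q => ?_
    simp [hH]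
  · simp [hH, Real.smoothTransition.zero, hΘ.zero]
  · rintro φ hφ _ hp ⟨p, hpS, rfl⟩
    exact fun h => by have := key φ hφ p hpS hp; simp [h] at this

end Shear

/-! ### Reflexivity and transitivity of isotopy of sections -/

section Isotopic

variable {M : Type} [TopologicalSpace M] [ChartedSpace E3 M] [IsManifold (𝓡 3) ∞ M]
  {Ψ : ℝ → M → M}

theorem IsotopicSections.refl {S : Set M}
    (hS : ∀ φ, IsSliceChart S φ → ∀ p ∈ φ.source, p ∈ S → normalSpeed φ (fun t => Ψ t p) ≠ 0) :
    IsotopicSections Ψ S S :=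
  ⟨fun _ => Diffeomorph.refl _ _ _, ⟨contMDiff_snd, fun _ => rfl⟩, by simp, fun φ hφ p hp hp' =>
    mul_self_pos.2 (hS φ hφ p hp' hp)⟩

theorem IsotopicSections.trans {S S' S'' : Set M} (h : IsotopicSections Ψ S S')
    (h' : IsotopicSections Ψ S' S'') : IsotopicSections Ψ S S'' := by
  obtain ⟨H, ⟨hs, h0⟩, rfl, ho⟩ := h
  obtain ⟨H', ⟨hs', h0'⟩, rfl, ho'⟩ := h'
  refine ⟨fun s => (H s).trans (H' s), ⟨hs'.comp (contMDiff_fst.prodMk hs), fun x => ?_⟩, ?_, ?_⟩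
  · simp [h0, h0']
  · rw [image_image]; rfl
  · intro φ hφ p hp hp'
    set e := (H' 1).toHomeomorph.toOpenPartialHomeomorph
    have hφ' : IsSliceChart (H 1 '' S) (e.trans φ) :=
      (isPairDiffeo_diffeomorph (H' 1) _).isSliceChart hφ
    -- The speed of `H' 1 (Ψ t (H 1 p))` is a factor in both inequalities, so the signs compose.
    have a := ho (e.trans φ) hφ' p hp (by
      rw [OpenPartialHomeomorph.trans_source]; exact ⟨mem_univ _, hp'⟩)
    have b := ho' φ hφ (H 1 p) (mem_image_of_mem _ hp) hp'
    change 0 < normalSpeed φ (fun t => H' 1 (H 1 (Ψ t p))) *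
      normalSpeed φ (fun t => H' 1 (Ψ t (H 1 p))) at a
    change 0 < normalSpeed φ (fun t => H' 1 (H 1 (Ψ t p))) *
      normalSpeed φ (fun t => Ψ t (H' 1 (H 1 p)))
    rcases mul_pos_iff.1 a with ⟨a1, a2⟩ | ⟨a1, a2⟩ <;>
      rcases mul_pos_iff.1 b with ⟨b1, b2⟩ | ⟨b1, b2⟩
    · exact mul_pos a1 b2
    · exact absurd a2 b1.not_gt
    · exact absurd b1 a2.not_gt
    · exact mul_pos_of_neg_of_neg a1 b2

end Isotopic

end HopfSection

namespace HopfSection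
open scoped Topology
open Set Filter

/-! ### The Hopf flow and unitary coordinates on the sphere -/

/-- The ambient complex plane `ℂ²`. -/
abbrev C2 : Type := EuclideanSpace ℂ (Fin 2)

theorem contMDiff_toSphere {H' M' E' : Type} [NormedAddCommGroup E'] [NormedSpace ℝ E']
    [TopologicalSpace H'] {I : ModelWithCorners ℝ E' H'} [TopologicalSpace M'] [ChartedSpace H' M']
    [IsManifold I ∞ M'] {f : M' → Sphere3}
    (hf : ContMDiff I 𝓘(ℝ, C2) ∞ (fun x => (f x : C2))) : ContMDiff I (𝓡 3) ∞ f :=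
  hf.codRestrict_sphere fun x => (f x).2

theorem contMDiff_coe : ContMDiff (𝓡 3) 𝓘(ℝ, C2) ∞ (fun x : Sphere3 => (x : C2)) :=
  contMDiff_coe_sphere

theorem isSmoothFlow_hopfFlow : IsSmoothFlow hopfFlow where
  smooth := by
    apply contMDiff_toSphere
    have h1 : ContDiff ℝ ∞ (fun q : ℝ × C2 => Complex.exp (q.1 * Complex.I) • q.2) := by
      have : ContDiff ℝ ∞ (fun t : ℝ => Complex.exp (t * Complex.I)) :=
        (Complex.ofRealCLM.contDiff.mul contDiff_const).cexp
      exact (this.comp contDiff_fst).smul contDiff_snd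
    have h2 : ContMDiff (𝓘(ℝ, ℝ).prod (𝓡 3)) 𝓘(ℝ, ℝ × C2) ∞
        (fun q : ℝ × Sphere3 => (q.1, (q.2 : C2))) :=
      contMDiff_fst.prodMk_space (contMDiff_coe.comp contMDiff_snd)
    exact h1.contMDiff.comp h2
  zero x := by simp [hopfFlow]
  add s t x := by simp [hopfFlow, Circle.exp_add, mul_smul]

theorem coe_hopfFlow (t : ℝ) (x : Sphere3) :
    (hopfFlow t x : C2) = Complex.exp (t * Complex.I) • (x : C2) := by
  simp [hopfFlow, coe_circle_smul, Circle.coe_exp]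

theorem hopfFlow_eq_iff {s t : ℝ} {x : Sphere3} :
    hopfFlow s x = hopfFlow t x ↔ ∃ n : ℤ, s = t + n * (2 * Real.pi) := by
  unfold hopfFlow
  rw [← Circle.exp_eq_exp]
  exact ⟨fun h => IsCancelSMul.right_cancel _ _ _ h, fun h => by rw [h]⟩

theorem hopfFlow_two_pi (x : Sphere3) : hopfFlow (2 * Real.pi) x = x := by
  simp [hopfFlow]

theorem hopfFlow_add_two_pi (t : ℝ) (x : Sphere3) :
    hopfFlow (t + 2 * Real.pi) x = hopfFlow t x := by
  simp [hopfFlow]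

theorem mem_hopfOrbit_symm {x y : Sphere3} (h : y ∈ flowOrbit hopfFlow x) :
    x ∈ flowOrbit hopfFlow y := by
  obtain ⟨t, rfl⟩ := h
  exact ⟨-t, isSmoothFlow_hopfFlow.neg_cancel t x⟩

theorem hopfOrbit_eq_of_mem {x y : Sphere3} (h : y ∈ flowOrbit hopfFlow x) :
    flowOrbit hopfFlow y = flowOrbit hopfFlow x := by
  obtain ⟨t, rfl⟩ := h
  ext z
  constructor
  · rintro ⟨s, rfl⟩; exact ⟨s + t, isSmoothFlow_hopfFlow.add s t x⟩
  · rintro ⟨s, rfl⟩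
    refine ⟨s - t, ?_⟩
    simp only
    rw [← isSmoothFlow_hopfFlow.add, sub_add_cancel]

theorem self_mem_hopfOrbit (x : Sphere3) : x ∈ flowOrbit hopfFlow x :=
  ⟨0, isSmoothFlow_hopfFlow.zero x⟩

theorem isPreconnected_hopfOrbit (x : Sphere3) : IsPreconnected (flowOrbit hopfFlow x) :=
  isPreconnected_range (isSmoothFlow_hopfFlow.smooth_curve x).continuous

theorem sphere3_normSq (x : Sphere3) :
    Complex.normSq ((x : C2) 0) + Complex.normSq ((x : C2) 1) = 1 := by
  have h := mem_sphere_zero_iff_norm.1 x.2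
  have h2 := EuclideanSpace.norm_sq_eq (x : C2)
  rw [h, Fin.sum_univ_two] at h2
  simp only [Complex.normSq_eq_norm_sq]
  linarith

theorem mem_sphere3_iff (v : C2) :
    v ∈ Metric.sphere (0 : C2) 1 ↔ Complex.normSq (v 0) + Complex.normSq (v 1) = 1 := by
  rw [mem_sphere_zero_iff_norm]
  have h2 := EuclideanSpace.norm_sq_eq v
  rw [Fin.sum_univ_two] at h2
  simp only [Complex.normSq_eq_norm_sq]
  rw [← h2]
  constructor
  · intro h; rw [h]; norm_num
  · intro h
    exact (pow_eq_one_iff_of_nonneg (norm_nonneg v) two_ne_zero).1 h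

open scoped ComplexConjugate

/-- The coordinate along `k` of a point of the sphere. -/
def zOne (k : Sphere3) (x : C2) : ℂ := conj ((k : C2) 0) * x 0 + conj ((k : C2) 1) * x 1

/-- The coordinate along the orthogonal complement of `k` of a point of the sphere. -/
def zTwo (k : Sphere3) (x : C2) : ℂ := (k : C2) 0 * x 1 - (k : C2) 1 * x 0

/-- The vector with given coordinates relative to `k`. -/
def vecOf (k : Sphere3) (w : ℂ × ℂ) : C2 :=
  !₂[(k : C2) 0 * w.1 - conj ((k : C2) 1) * w.2, (k : C2) 1 * w.1 + conj ((k : C2) 0) * w.2]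

theorem coords_self_mul (k : Sphere3) :
    conj ((k : C2) 0) * (k : C2) 0 + conj ((k : C2) 1) * (k : C2) 1 = 1 := by
  have := sphere3_normSq k
  rw [← Complex.normSq_eq_conj_mul_self, ← Complex.normSq_eq_conj_mul_self, ← Complex.ofReal_add,
    this, Complex.ofReal_one]

theorem zOne_vecOf (k : Sphere3) (w : ℂ × ℂ) : zOne k (vecOf k w) = w.1 := by
  have h := coords_self_mul k
  simp only [zOne, vecOf, PiLp.toLp_apply, Matrix.cons_val_zero, Matrix.cons_val_one]
  linear_combination w.1 * h

theorem zTwo_vecOf (k : Sphere3) (w : ℂ × ℂ) : zTwo k (vecOf k w) = w.2 := by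
  have h := coords_self_mul k
  simp only [zTwo, vecOf, PiLp.toLp_apply, Matrix.cons_val_zero, Matrix.cons_val_one]
  linear_combination w.2 * h

theorem vecOf_coords (k : Sphere3) (x : C2) : vecOf k (zOne k x, zTwo k x) = x := by
  have h := coords_self_mul k
  ext i
  fin_cases i <;>
    simp only [zOne, zTwo, vecOf, PiLp.toLp_apply, Matrix.cons_val_zero, Matrix.cons_val_one,
      Fin.zero_eta, Fin.mk_one]
  · linear_combination x 0 * h
  · linear_combination x 1 * h

theorem normSq_vecOf (k : Sphere3) (w : ℂ × ℂ) :
    Complex.normSq (vecOf k w 0) + Complex.normSq (vecOf k w 1) =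
      Complex.normSq w.1 + Complex.normSq w.2 := by
  have h := sphere3_normSq k
  simp only [vecOf, PiLp.toLp_apply, Matrix.cons_val_zero, Matrix.cons_val_one]
  simp only [Complex.normSq_apply, Complex.sub_re, Complex.sub_im, Complex.add_re, Complex.add_im,
    Complex.mul_re, Complex.mul_im, Complex.conj_re, Complex.conj_im] at *
  linear_combination (w.1.re * w.1.re + w.1.im * w.1.im + w.2.re * w.2.re + w.2.im * w.2.im) * h

theorem normSq_coords (k x : Sphere3) :
    Complex.normSq (zOne k x) + Complex.normSq (zTwo k x) = 1 := by
  have := normSq_vecOf k (zOne k x, zTwo k x)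
  rw [vecOf_coords, sphere3_normSq] at this
  exact this.symm

/-- The point of the sphere with given coordinates relative to `k`. -/
def ptOf (k : Sphere3) (w : ℂ × ℂ) (h : Complex.normSq w.1 + Complex.normSq w.2 = 1) : Sphere3 :=
  ⟨vecOf k w, (mem_sphere3_iff _).2 (by rw [normSq_vecOf, h])⟩

theorem sphere3_ext (k : Sphere3) {x y : Sphere3} (h1 : zOne k x = zOne k y)
    (h2 : zTwo k x = zTwo k y) : x = y := by
  apply Subtype.ext
  rw [← vecOf_coords k x, ← vecOf_coords k y, h1, h2]

theorem contDiff_coord (i : Fin 2) : ContDiff ℝ ∞ (fun x : C2 => x i) :=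
  ((EuclideanSpace.proj (𝕜 := ℂ) i).restrictScalars ℝ).contDiff

theorem contDiff_zOne (k : Sphere3) : ContDiff ℝ ∞ (zOne k) :=
  (contDiff_const.mul (contDiff_coord 0)).add (contDiff_const.mul (contDiff_coord 1))

theorem contDiff_zTwo (k : Sphere3) : ContDiff ℝ ∞ (zTwo k) :=
  (contDiff_const.mul (contDiff_coord 1)).sub (contDiff_const.mul (contDiff_coord 0))

theorem contDiff_vecOf (k : Sphere3) : ContDiff ℝ ∞ (vecOf k) := by
  unfold vecOf
  refine (PiLp.contDiff_toLp (p := 2)).comp (contDiff_pi.2 fun i => ?_)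
  fin_cases i
  · exact (contDiff_const.mul contDiff_fst).sub (contDiff_const.mul contDiff_snd)
  · exact (contDiff_const.mul contDiff_fst).add (contDiff_const.mul contDiff_snd)

theorem contMDiff_zOne (k : Sphere3) :
    ContMDiff (𝓡 3) 𝓘(ℝ, ℂ) ∞ (fun x : Sphere3 => zOne k x) :=
  (contDiff_zOne k).contMDiff.comp contMDiff_coe

theorem contMDiff_zTwo (k : Sphere3) :
    ContMDiff (𝓡 3) 𝓘(ℝ, ℂ) ∞ (fun x : Sphere3 => zTwo k x) :=
  (contDiff_zTwo k).contMDiff.comp contMDiff_coe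

theorem zOne_hopfFlow (k : Sphere3) (t : ℝ) (x : Sphere3) :
    zOne k (hopfFlow t x) = Complex.exp (t * Complex.I) * zOne k x := by
  rw [coe_hopfFlow]; simp only [zOne, PiLp.smul_apply, smul_eq_mul]; ring

theorem zTwo_hopfFlow (k : Sphere3) (t : ℝ) (x : Sphere3) :
    zTwo k (hopfFlow t x) = Complex.exp (t * Complex.I) * zTwo k x := by
  rw [coe_hopfFlow]; simp only [zTwo, PiLp.smul_apply, smul_eq_mul]; ring

theorem zTwo_self (k : Sphere3) : zTwo k k = 0 := by simp only [zTwo]; ring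

theorem zOne_self (k : Sphere3) : zOne k k = 1 := coords_self_mul k

theorem normSq_exp_mul_I (t : ℝ) : Complex.normSq (Complex.exp (t * Complex.I)) = 1 := by
  rw [Complex.normSq_eq_norm_sq, Complex.norm_exp_ofReal_mul_I]; norm_num

/-- The rotation of the sphere around the Hopf orbit of `k`. -/
def rotFlow (k : Sphere3) (t : ℝ) (x : Sphere3) : Sphere3 :=
  ptOf k (zOne k x, Complex.exp (t * Complex.I) * zTwo k x) (by
    simp only [map_mul, normSq_exp_mul_I, one_mul, normSq_coords])

theorem zOne_rotFlow (k : Sphere3) (t : ℝ) (x : Sphere3) : zOne k (rotFlow k t x) = zOne k x :=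
  zOne_vecOf k _

theorem zTwo_rotFlow (k : Sphere3) (t : ℝ) (x : Sphere3) :
    zTwo k (rotFlow k t x) = Complex.exp (t * Complex.I) * zTwo k x :=
  zTwo_vecOf k _

theorem coe_rotFlow (k : Sphere3) (t : ℝ) (x : Sphere3) : (rotFlow k t x : C2) =
    vecOf k (zOne k x, Complex.exp (t * Complex.I) * zTwo k x) := rfl

theorem contDiff_exp_mul_I : ContDiff ℝ ∞ (fun t : ℝ => Complex.exp (t * Complex.I)) :=
  (Complex.ofRealCLM.contDiff.mul contDiff_const).cexp

theorem contDiff_rotFlow_aux (k : Sphere3) : ContDiff ℝ ∞ (fun q : ℝ × C2 =>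
    vecOf k (zOne k q.2, Complex.exp (q.1 * Complex.I) * zTwo k q.2)) :=
  (contDiff_vecOf k).comp (((contDiff_zOne k).comp contDiff_snd).prodMk
    ((contDiff_exp_mul_I.comp contDiff_fst).mul ((contDiff_zTwo k).comp contDiff_snd)))

theorem contMDiff_rotFlow (k : Sphere3) : ContMDiff (𝓘(ℝ, ℝ).prod (𝓡 3)) (𝓡 3) ∞
    (fun q : ℝ × Sphere3 => rotFlow k q.1 q.2) := by
  have h2 : ContMDiff (𝓘(ℝ, ℝ).prod (𝓡 3)) 𝓘(ℝ, ℝ × C2) ∞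
      (fun q : ℝ × Sphere3 => (q.1, (q.2 : C2))) :=
    contMDiff_fst.prodMk_space (contMDiff_coe.comp contMDiff_snd)
  have h3 := (contDiff_rotFlow_aux k).contMDiff.comp h2
  have h4 : ContMDiff (𝓘(ℝ, ℝ).prod (𝓡 3)) 𝓘(ℝ, C2) ∞
      (fun q : ℝ × Sphere3 => (rotFlow k q.1 q.2 : C2)) := by
    refine h3.congr fun q => ?_
    rw [coe_rotFlow]; rfl
  generalize rotFlow k = f at h4 ⊢
  exact contMDiff_toSphere h4

theorem rotFlow_zero (k x : Sphere3) : rotFlow k 0 x = x := by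
  apply sphere3_ext k
  · rw [zOne_rotFlow]
  · rw [zTwo_rotFlow]; simp

theorem rotFlow_add (k : Sphere3) (s t : ℝ) (x : Sphere3) :
    rotFlow k (s + t) x = rotFlow k s (rotFlow k t x) := by
  apply sphere3_ext k
  · rw [zOne_rotFlow, zOne_rotFlow, zOne_rotFlow]
  · rw [zTwo_rotFlow, zTwo_rotFlow, zTwo_rotFlow, ← mul_assoc, ← Complex.exp_add, ← add_mul,
      Complex.ofReal_add]

theorem isSmoothFlow_rotFlow (k : Sphere3) : IsSmoothFlow (rotFlow k) :=
  ⟨contMDiff_rotFlow k, rotFlow_zero k, rotFlow_add k⟩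

theorem rotFlow_hopfFlow (k : Sphere3) (s t : ℝ) (x : Sphere3) :
    rotFlow k s (hopfFlow t x) = hopfFlow t (rotFlow k s x) :=
  sphere3_ext k (by simp only [zOne_rotFlow, zOne_hopfFlow]) (by
    simp only [zTwo_rotFlow, zTwo_hopfFlow]; ring)

/-- When the second coordinate vanishes the first has modulus one, and its argument is the time
needed to come from `k`. -/
theorem mem_hopfOrbit_iff (k x : Sphere3) : x ∈ flowOrbit hopfFlow k ↔ zTwo k x = 0 := by
  constructor
  · rintro ⟨t, rfl⟩
    simp only [zTwo_hopfFlow, zTwo_self, mul_zero]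
  · intro h
    have h1 := normSq_coords k x
    rw [h, map_zero, add_zero, Complex.normSq_eq_norm_sq] at h1
    have h2 : ‖zOne k x‖ = 1 := (pow_eq_one_iff_of_nonneg (norm_nonneg _) two_ne_zero).1 h1
    refine ⟨(zOne k x).arg, sphere3_ext k ?_ ?_⟩
    · simp only [zOne_hopfFlow, zOne_self, mul_one]
      have := Complex.norm_mul_exp_arg_mul_I (zOne k x)
      rwa [h2, Complex.ofReal_one, one_mul] at this
    · simp only [zTwo_hopfFlow, zTwo_self, mul_zero, h]

theorem norm_zTwo_hopfFlow (k : Sphere3) (t : ℝ) (x : Sphere3) :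
    ‖zTwo k (hopfFlow t x)‖ = ‖zTwo k x‖ := by
  rw [zTwo_hopfFlow, norm_mul, Complex.norm_exp_ofReal_mul_I, one_mul]

theorem norm_zTwo_rotFlow (k : Sphere3) (t : ℝ) (x : Sphere3) :
    ‖zTwo k (rotFlow k t x)‖ = ‖zTwo k x‖ := by
  rw [zTwo_rotFlow, norm_mul, Complex.norm_exp_ofReal_mul_I, one_mul]

theorem continuous_zTwo (k : Sphere3) : Continuous (fun x : Sphere3 => zTwo k x) :=
  (contMDiff_zTwo k).continuous

theorem continuous_zOne (k : Sphere3) : Continuous (fun x : Sphere3 => zOne k x) :=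
  (contMDiff_zOne k).continuous

/-- Every neighbourhood of a Hopf orbit contains a tube around it. -/
theorem exists_tube_subset (k : Sphere3) {P : Sphere3 → Prop}
    (hP : ∀ x ∈ flowOrbit hopfFlow k, ∀ᶠ y in 𝓝 x, P y) :
    ∃ ε > 0, ∀ x : Sphere3, ‖zTwo k x‖ < ε → P x := by
  have hC : IsCompact (interior {x | P x})ᶜ := isOpen_interior.isClosed_compl.isCompact
  rcases (interior {x | P x})ᶜ.eq_empty_or_nonempty with h | h
  · refine ⟨1, one_pos, fun x _ => ?_⟩
    have : x ∈ interior {x | P x} := by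
      by_contra hx; exact (h ▸ hx : x ∈ (∅ : Set Sphere3))
    exact interior_subset this
  · obtain ⟨y, hy, hmin⟩ := hC.exists_isMinOn h (continuous_zTwo k).norm.continuousOn
    refine ⟨‖zTwo k y‖, ?_, fun x hx => ?_⟩
    · rw [gt_iff_lt, norm_pos_iff]
      intro h0
      exact hy (mem_interior_iff_mem_nhds.2 (hP y ((mem_hopfOrbit_iff k y).2 h0)))
    · by_contra hx'
      have hx2 : x ∈ (interior {x | P x})ᶜ := fun hi => hx' (interior_subset hi)
      exact absurd (hmin hx2) (not_le.2 hx)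

end HopfSection

namespace HopfSection
open scoped Topology
open Set Filter

/-! ### Local sections and the number of intersections with orbits -/

/-- The interior of `S` is transverse to the flow `Ψ`. -/
def IsTransverse {M : Type} [TopologicalSpace M] [ChartedSpace E3 M] (Ψ : ℝ → M → M)
    (S : Set M) : Prop :=
  ∀ φ, IsSliceChart S φ → ∀ p ∈ φ.source, p ∈ S → normalSpeed φ (fun t => Ψ t p) ≠ 0

/-- Near an interior point, the surface is the graph of a smooth hitting time. -/
theorem IsTransverse.exists_hittingTime {M : Type} [TopologicalSpace M] [ChartedSpace E3 M]
    [IsManifold (𝓡 3) ∞ M] {Ψ : ℝ → M → M} (hΨ : IsSmoothFlow Ψ) {S : Set M}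
    (hT : IsTransverse Ψ S) {t0 : ℝ} {x0 : M} (h : Ψ t0 x0 ∈ surfInterior S) :
    ∃ τ : M → ℝ, ContMDiffAt (𝓡 3) 𝓘(ℝ, ℝ) ∞ τ x0 ∧ τ x0 = t0 ∧
      ∀ᶠ q in 𝓝 (t0, x0), (Ψ q.1 q.2 ∈ S ↔ q.1 = τ q.2) := by
  obtain ⟨hS, φ, hφ, hp⟩ := h
  set u : M → ℝ := fun x => φ x 2 with hu
  have hus : ContMDiffAt (𝓡 3) 𝓘(ℝ, ℝ) ∞ u (Ψ t0 x0) := by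
    have h1 : ContMDiffAt (𝓡 3) (𝓡 3) ∞ φ (Ψ t0 x0) := contMDiffAt_of_mem_maximalAtlas hφ.1 hp
    have h2 : ContMDiffAt (𝓡 3) 𝓘(ℝ, ℝ) ∞ (EuclideanSpace.proj (𝕜 := ℝ) (2 : Fin 3))
      (φ (Ψ t0 x0)) := (ContinuousLinearMap.contDiff _).contMDiff.contMDiffAt
    exact h2.comp _ h1
  have hd : deriv (fun t => u (Ψ t x0)) t0 ≠ 0 := by
    rw [(hΨ.hasDerivAt hus).deriv]
    exact hT φ hφ _ hp hS
  obtain ⟨τ, h1, h2, h3⟩ := exists_implicit_time (F := fun q : ℝ × M => u (Ψ q.1 q.2))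
    (hΨ.contMDiffAt_comp hus) ((hφ.2 _ hp).1 hS) hd
  refine ⟨τ, h1, h2, ?_⟩
  have hc : ContinuousAt (fun q : ℝ × M => Ψ q.1 q.2) (t0, x0) := hΨ.smooth.continuous.continuousAt
  filter_upwards [h3, hc.eventually_mem (φ.open_source.mem_nhds hp)] with q hq hq'
  rw [hφ.2 _ hq', ← hq]

/-- Over a period window whose ends are not hits, the hits near a given orbit are given by finitely
many smooth hitting times. -/
theorem exists_hittingTimes {S : Set Sphere3} (hS : IsCompactSurface S)
    (hT : IsTransverse hopfFlow S) {x0 : Sphere3}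
    (hx0 : ∀ t, hopfFlow t x0 ∉ surfBoundary S) {a b : ℝ} (ha : hopfFlow a x0 ∉ S)
    (hb : hopfFlow b x0 ∉ S) :
    ∃ (T : Finset ℝ) (τ : ℝ → Sphere3 → ℝ),
      (∀ t, t ∈ T ↔ t ∈ Icc a b ∧ hopfFlow t x0 ∈ S) ∧
      (∀ t ∈ T, t ∈ Ioo a b ∧ ContMDiffAt (𝓡 3) 𝓘(ℝ, ℝ) ∞ (τ t) x0 ∧ τ t x0 = t ∧
        ∀ᶠ s in 𝓝 0, τ t (hopfFlow s x0) = t - s) ∧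
      ∀ᶠ x in 𝓝 x0, Set.InjOn (fun t => τ t x) T ∧
        ∀ s ∈ Icc a b, (hopfFlow s x ∈ S ↔ ∃ t ∈ T, τ t x = s) := by
  have hΨ := isSmoothFlow_hopfFlow
  have hcl : IsClosed S := hS.1.isClosed
  have hsec : ∀ t, ∃ τ : Sphere3 → ℝ, hopfFlow t x0 ∈ S →
      (ContMDiffAt (𝓡 3) 𝓘(ℝ, ℝ) ∞ τ x0 ∧ τ x0 = t ∧
        ∀ᶠ q in 𝓝 (t, x0), (hopfFlow q.1 q.2 ∈ S ↔ q.1 = τ q.2)) := by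
    intro t
    by_cases h : hopfFlow t x0 ∈ S
    · obtain ⟨τ, hτ⟩ := hT.exists_hittingTime hΨ (hS.mem_surfInterior_iff.2 ⟨h, hx0 t⟩)
      exact ⟨τ, fun _ => hτ⟩
    · exact ⟨fun _ => 0, fun h' => absurd h' h⟩
  choose τ hτ using hsec
  have hcurve : Continuous (fun t => hopfFlow t x0) := (hΨ.smooth_curve x0).continuous
  have hTc : IsCompact {t | t ∈ Icc a b ∧ hopfFlow t x0 ∈ S} :=
    isCompact_Icc.inter_right (hcl.preimage hcurve)
  -- Hits are isolated by the implicit function theorem, while infinitely many of them in a compact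
  -- window would accumulate at one.
  have hfin : {t | t ∈ Icc a b ∧ hopfFlow t x0 ∈ S}.Finite := by
    by_contra hinf
    obtain ⟨t, ht, hacc⟩ := Set.Infinite.exists_accPt_of_subset_isCompact hinf hTc subset_rfl
    obtain ⟨h1, h2, h3⟩ := hτ t ht.2
    have h4 : ∀ᶠ s in 𝓝 t, hopfFlow s x0 ∈ S ↔ s = t := by
      have hc : ContinuousAt (fun s : ℝ => (s, x0)) t := by fun_prop
      filter_upwards [hc.eventually h3] with s hs
      rw [h2] at hs; exact hs
    rw [accPt_iff_frequently] at hacc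
    obtain ⟨s, ⟨hs1, hs2⟩, hs3⟩ := (hacc.and_eventually h4).exists
    exact hs1 (hs3.1 hs2.2)
  refine ⟨hfin.toFinset, τ, fun t => by simp, fun t ht => ?_, ?_⟩
  · have ht' : t ∈ Icc a b ∧ hopfFlow t x0 ∈ S := by simpa using ht
    obtain ⟨h1, h2, h3⟩ := hτ t ht'.2
    refine ⟨⟨lt_of_le_of_ne ht'.1.1 ?_, lt_of_le_of_ne ht'.1.2 ?_⟩, h1, h2, ?_⟩
    · rintro rfl; exact ha ht'.2
    · rintro rfl; exact hb ht'.2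
    · have hc : Tendsto (fun s : ℝ => (t - s, hopfFlow s x0)) (𝓝 0) (𝓝 (t, x0)) := by
        have : ContinuousAt (fun s : ℝ => (t - s, hopfFlow s x0)) 0 :=
          (by fun_prop : ContinuousAt (fun s : ℝ => t - s) 0).prodMk hcurve.continuousAt
        simpa [ContinuousAt, hΨ.zero] using this
      filter_upwards [hc.eventually h3] with s hs
      refine (hs.1 ?_).symm
      rw [← hΨ.add, sub_add_cancel]; exact ht'.2
  · have hτ' : ∀ t ∈ hfin.toFinset, _ := fun t ht => hτ t (by simpa using ht : _ ∧ _).2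
    have hIoo : ∀ t ∈ hfin.toFinset, t ∈ Ioo a b := by
      intro t ht
      have ht' : t ∈ Icc a b ∧ hopfFlow t x0 ∈ S := by simpa using ht
      refine ⟨lt_of_le_of_ne ht'.1.1 ?_, lt_of_le_of_ne ht'.1.2 ?_⟩
      · rintro rfl; exact ha ht'.2
      · rintro rfl; exact hb ht'.2
    have hinj : ∀ᶠ x in 𝓝 x0, Set.InjOn (fun t => τ t x) hfin.toFinset := by
      have : ∀ᶠ x in 𝓝 x0, ∀ t ∈ hfin.toFinset, ∀ s ∈ hfin.toFinset, t ≠ s → τ t x ≠ τ s x := by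
        rw [Filter.eventually_all_finset]
        intro t ht
        rw [Filter.eventually_all_finset]
        intro s hs
        by_cases hts : t = s
        · simp [hts]
        · obtain ⟨h1, h2, -⟩ := hτ' t ht
          obtain ⟨h1', h2', -⟩ := hτ' s hs
          have hc := h1.continuousAt.sub h1'.continuousAt
          have hne : τ t x0 - τ s x0 ≠ 0 := by rw [h2, h2']; exact sub_ne_zero.2 hts
          filter_upwards [hc.eventually_ne hne]
            with x hx _ using sub_ne_zero.1 hx
      filter_upwards [this] with x hx t ht s hs hts
      by_contra hne
      exact hx t ht s hs hne hts
    have hmem : ∀ᶠ x in 𝓝 x0, ∀ t ∈ hfin.toFinset, hopfFlow (τ t x) x ∈ S := by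
      rw [Filter.eventually_all_finset]
      intro t ht
      obtain ⟨h1, h2, h3⟩ := hτ' t ht
      have hc : ContinuousAt (fun x => (τ t x, x)) x0 := h1.continuousAt.prodMk continuousAt_id
      have h3' : ∀ᶠ q in 𝓝 (τ t x0, x0), (hopfFlow q.1 q.2 ∈ S ↔ q.1 = τ t q.2) := by rwa [h2]
      filter_upwards [hc.eventually h3'] with x hx using hx.2 rfl
    -- No new hits appear: near each `(s, x0)` the hits either lie on the graph of `τ s` or do not
    -- exist, and the window is compact.
    have honly : ∀ᶠ x in 𝓝 x0, ∀ s ∈ Icc a b, (hopfFlow s x ∈ S → ∃ t ∈ hfin.toFinset, τ t x = s) := by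
      refine isCompact_Icc.eventually_forall_of_forall_eventually fun s hs => ?_
      have hsw : Tendsto (Prod.swap : Sphere3 × ℝ → ℝ × Sphere3) (𝓝 (x0, s)) (𝓝 (s, x0)) :=
        continuous_swap.tendsto (x0, s)
      by_cases h : hopfFlow s x0 ∈ S
      · obtain ⟨h1, h2, h3⟩ := hτ s h
        filter_upwards [hsw.eventually h3] with q hq hqS
        exact ⟨s, by simpa using ⟨hs, h⟩, (hq.1 hqS).symm⟩
      · have hc : ContinuousAt (fun q : ℝ × Sphere3 => hopfFlow q.1 q.2) (s, x0) :=
          hΨ.smooth.continuous.continuousAt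
        filter_upwards [hsw.eventually (hc.eventually_mem (hcl.isOpen_compl.mem_nhds h))]
          with q hq hqS
        exact absurd hqS hq
    filter_upwards [hinj, hmem, honly] with x h1 h2 h3
    refine ⟨h1, fun s hs => ⟨h3 s hs, ?_⟩⟩
    rintro ⟨t, ht, rfl⟩
    exact h2 t ht

/-- The period is exactly 2π, so a half-open window of that length runs once through the orbit. Its
start `a` is left free so that it can be placed off the section. -/
theorem encard_orbit_inter (S : Set Sphere3) (x : Sphere3) (a : ℝ) :
    (flowOrbit hopfFlow x ∩ S).encard =
      {t | t ∈ Ioc a (a + 2 * Real.pi) ∧ hopfFlow t x ∈ S}.encard := by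
  have : flowOrbit hopfFlow x ∩ S =
      (fun t => hopfFlow t x) '' {t | t ∈ Ioc a (a + 2 * Real.pi) ∧ hopfFlow t x ∈ S} := by
    ext y
    constructor
    · rintro ⟨⟨t, rfl⟩, hy⟩
      obtain ⟨n, hn, -⟩ := existsUnique_add_zsmul_mem_Ioc Real.two_pi_pos t a
      have e : hopfFlow (t + n • (2 * Real.pi)) x = hopfFlow t x :=
        hopfFlow_eq_iff.2 ⟨n, by simp⟩
      exact ⟨_, ⟨hn, by rwa [e]⟩, e⟩
    · rintro ⟨t, ⟨-, ht⟩, rfl⟩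
      exact ⟨⟨t, rfl⟩, ht⟩
  rw [this]
  refine Set.InjOn.encard_image ?_
  rintro s ⟨hs, -⟩ t ⟨ht, -⟩ hst
  obtain ⟨n, hn⟩ := hopfFlow_eq_iff.1 hst
  have h1 : (-1 : ℝ) < n := by
    by_contra h
    have := Real.two_pi_pos; have := hs.1; have := ht.2; push Not at h
    nlinarith
  have h2 : (n : ℝ) < 1 := by
    by_contra h
    have := Real.two_pi_pos; have := hs.2; have := ht.1; push Not at h
    nlinarith
  have h3 : n = 0 := by
    have h1' : (-1 : ℤ) < n := by exact_mod_cast h1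
    have h2' : n < 1 := by exact_mod_cast h2
    omega
  simpa [h3] using hn

/-- Off a discrete set of times, an orbit avoids a transverse surface. -/
theorem exists_pos_forall_notMem {S : Set Sphere3} (hS : IsCompactSurface S)
    (hT : IsTransverse hopfFlow S) {x0 : Sphere3} (h : x0 ∉ surfBoundary S) :
    ∃ δ > 0, ∀ s, |s| < δ → s ≠ 0 → hopfFlow s x0 ∉ S := by
  have hev : ∀ᶠ s in 𝓝 (0 : ℝ), s ≠ 0 → hopfFlow s x0 ∉ S := by
    by_cases hx : x0 ∈ S
    · have hi : hopfFlow 0 x0 ∈ surfInterior S := by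
        rw [isSmoothFlow_hopfFlow.zero]; exact hS.mem_surfInterior_iff.2 ⟨hx, h⟩
      obtain ⟨τ, -, h2, h3⟩ := hT.exists_hittingTime isSmoothFlow_hopfFlow hi
      have hc : ContinuousAt (fun s : ℝ => (s, x0)) 0 := by fun_prop
      filter_upwards [hc.eventually h3] with s hs hs0 hsS
      rw [h2] at hs; exact hs0 (hs.1 hsS)
    · have hc : ContinuousAt (fun s => hopfFlow s x0) 0 :=
        (isSmoothFlow_hopfFlow.smooth_curve x0).continuous.continuousAt
      filter_upwards [hc.eventually_mem (hS.1.isClosed.isOpen_compl.mem_nhds (by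
        rw [isSmoothFlow_hopfFlow.zero]; exact hx))] with s hs _ using hs
  obtain ⟨δ, hδ, hb⟩ := Metric.eventually_nhds_iff.1 hev
  exact ⟨δ, hδ, fun s hs => hb (by simpa using hs)⟩

/-- The number of intersection points is locally constant off the boundary orbits. -/
theorem eventually_encard_orbit_inter_eq {S : Set Sphere3} (hS : IsCompactSurface S)
    (hT : IsTransverse hopfFlow S) {x0 : Sphere3}
    (hx0 : ∀ t, hopfFlow t x0 ∉ surfBoundary S) :
    ∀ᶠ x in 𝓝 x0, (flowOrbit hopfFlow x ∩ S).encard = (flowOrbit hopfFlow x0 ∩ S).encard := by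
  obtain ⟨δ, hδ, hδ'⟩ := exists_pos_forall_notMem hS hT (x0 := x0) (by
    simpa [isSmoothFlow_hopfFlow.zero] using hx0 0)
  -- The window starts off `S`, so no hit can cross its ends when the point varies.
  set a : ℝ := δ / 2
  have ha : hopfFlow a x0 ∉ S := hδ' a (by
    rw [abs_of_pos (by positivity)]; simp only [a]; linarith) (by positivity)
  obtain ⟨T, τ, hT1, hT2, hev⟩ := exists_hittingTimes hS hT hx0 ha
    (b := a + 2 * Real.pi) (by rwa [hopfFlow_add_two_pi])
  have hmem : ∀ᶠ x in 𝓝 x0, ∀ t ∈ T, τ t x ∈ Ioo a (a + 2 * Real.pi) := by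
    rw [Filter.eventually_all_finset]
    intro t ht
    obtain ⟨h1, h2, h3, -⟩ := hT2 t ht
    exact h2.continuousAt.eventually_mem (isOpen_Ioo.mem_nhds (by rwa [h3]))
  have key : ∀ x, (Set.InjOn (fun t => τ t x) T ∧
        ∀ s ∈ Icc a (a + 2 * Real.pi), (hopfFlow s x ∈ S ↔ ∃ t ∈ T, τ t x = s)) →
      (∀ t ∈ T, τ t x ∈ Ioo a (a + 2 * Real.pi)) →
      (flowOrbit hopfFlow x ∩ S).encard = (T.card : ℕ∞) := by
    rintro x ⟨h1, h2⟩ h3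
    rw [encard_orbit_inter S x a]
    have : {t | t ∈ Ioc a (a + 2 * Real.pi) ∧ hopfFlow t x ∈ S} = (fun t => τ t x) '' T := by
      ext s
      constructor
      · rintro ⟨hs, hsS⟩
        obtain ⟨t, ht, hts⟩ := (h2 s (Ioc_subset_Icc_self hs)).1 hsS
        exact ⟨t, ht, hts⟩
      · rintro ⟨t, ht, rfl⟩
        have := h3 t ht
        exact ⟨Ioo_subset_Ioc_self this, (h2 _ (Ioo_subset_Icc_self this)).2 ⟨t, ht, rfl⟩⟩
    rw [this, h1.encard_image, Set.encard_coe_eq_coe_finsetCard]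
  filter_upwards [hev, hmem] with x h1 h2
  rw [key x h1 h2, key x0 hev.self_of_nhds hmem.self_of_nhds]

end HopfSection

namespace HopfSection
open scoped Topology
open Set Filter

/-! ### Boundary orbits of a section -/

variable {d : ℕ} {S : Set Sphere3}

theorem IsDSection.isTransverse (hS : IsDSection hopfFlow d S) : IsTransverse hopfFlow S :=
  hS.transverse

theorem IsDSection.hopfFlow_mem_surfBoundary (hS : IsDSection hopfFlow d S) {x : Sphere3}
    (hx : x ∈ surfBoundary S) (t : ℝ) : hopfFlow t x ∈ surfBoundary S :=
  hS.boundary_invariant x hx ⟨t, rfl⟩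

theorem IsDSection.hopfFlow_mem_surfBoundary_iff (hS : IsDSection hopfFlow d S) {x : Sphere3}
    (t : ℝ) : hopfFlow t x ∈ surfBoundary S ↔ x ∈ surfBoundary S := by
  refine ⟨fun h => ?_, fun h => hS.hopfFlow_mem_surfBoundary h t⟩
  have := hS.hopfFlow_mem_surfBoundary h (-t)
  rwa [isSmoothFlow_hopfFlow.neg_cancel] at this

/-- The boundary is invariant, so the orbit misses it: it is not a boundary component, and along it
`S` and the interior of `S` have the same points. -/
theorem IsDSection.encard_of_notMem (hS : IsDSection hopfFlow d S) {x : Sphere3}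
    (hx : x ∉ surfBoundary S) : (flowOrbit hopfFlow x ∩ S).encard = d := by
  have h1 : flowOrbit hopfFlow x ∩ S = flowOrbit hopfFlow x ∩ surfInterior S := by
    ext y
    refine ⟨fun ⟨h, hy⟩ => ⟨h, hS.compactSurface.mem_surfInterior_iff.2 ⟨hy, fun hb => ?_⟩⟩,
      fun ⟨h, hy⟩ => ⟨h, hy.1⟩⟩
    obtain ⟨t, rfl⟩ := h
    exact hx ((hS.hopfFlow_mem_surfBoundary_iff t).1 hb)
  rw [h1]
  refine (hS.orbits x).resolve_right ?_
  rintro ⟨q, hq, h⟩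
  exact hx (connectedComponentIn_subset _ q (h ▸ self_mem_hopfOrbit x))

/-- A boundary orbit misses the interior. As `d` is not zero, the count of hits fails and the other
alternative must hold. -/
theorem IsDSection.orbit_eq_connectedComponentIn (hd : 1 ≤ d) (hS : IsDSection hopfFlow d S)
    {x : Sphere3} (hx : x ∈ surfBoundary S) :
    flowOrbit hopfFlow x = connectedComponentIn (surfBoundary S) x := by
  rcases hS.orbits x with h | ⟨q, hq, h⟩
  · exfalso
    have : flowOrbit hopfFlow x ∩ surfInterior S = ∅ := by
      rw [Set.eq_empty_iff_forall_notMem]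
      rintro y ⟨hy, hi⟩
      exact not_mem_surfBoundary_of_mem_surfInterior hi (hS.boundary_invariant x hx hy)
    rw [this, Set.encard_empty] at h
    have : (d : ℕ∞) = 0 := h.symm
    simp at this; omega
  · rw [h]
    exact connectedComponentIn_eq (h ▸ self_mem_hopfOrbit x)

/-- Boundary points near a boundary orbit lie on that orbit. -/
theorem IsDSection.eventually_mem_orbit (hd : 1 ≤ d) (hS : IsDSection hopfFlow d S)
    {k : Sphere3} (hk : k ∈ surfBoundary S) :
    ∀ᶠ x in 𝓝 k, x ∈ surfBoundary S → x ∈ flowOrbit hopfFlow k := by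
  obtain ⟨hkS, φ, hφ, hp, h0⟩ := id hk
  obtain ⟨r, hr, hball⟩ := Metric.isOpen_iff.1 φ.open_target (φ k) (φ.map_source hp)
  have h2 : φ k 2 = 0 := ((hφ.2 k hp).1 hkS).1
  -- In a half-slice chart the boundary is a line. Its part in a ball is convex, so it corresponds
  -- to a connected set of boundary points, which lies in the component of `k`, that is, in its
  -- orbit.
  set A : Set E3 := Metric.ball (φ k) r ∩ {v | v 0 = 0 ∧ v 2 = 0} with hA
  have hAc : Convex ℝ A := by
    refine (convex_ball _ _).inter fun v hv w hw a b ha hb hab => ?_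
    simp only [mem_ofPred_eq] at hv hw
    simp [hv.1, hv.2, hw.1, hw.2]
  have hL : IsPreconnected (φ.symm '' A) :=
    hAc.isPreconnected.image _ (φ.continuousOn_symm.mono fun v hv => hball hv.1)
  have hLsub : φ.symm '' A ⊆ surfBoundary S := by
    rintro _ ⟨v, hv, rfl⟩
    rw [hφ.mem_surfBoundary_iff (φ.map_target (hball hv.1)), φ.right_inv (hball hv.1)]
    exact ⟨hv.2.2, hv.2.1⟩
  have hkL : k ∈ φ.symm '' A :=
    ⟨φ k, ⟨Metric.mem_ball_self hr, h0, h2⟩, φ.left_inv hp⟩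
  have hsub := hL.subset_connectedComponentIn hkL hLsub
  rw [← hS.orbit_eq_connectedComponentIn hd hk] at hsub
  filter_upwards [φ.open_source.mem_nhds hp,
    (φ.continuousAt hp).eventually_mem (Metric.ball_mem_nhds _ hr)] with x hx hx' hxb
  have := (hφ.mem_surfBoundary_iff hx).1 hxb
  exact hsub ⟨φ x, ⟨hx', this.2, this.1⟩, φ.left_inv hx⟩

/-- Boundary orbits are isolated from each other at every point; compactness turns this into a tube
of uniform radius. -/
theorem IsDSection.exists_tube (hd : 1 ≤ d) (hS : IsDSection hopfFlow d S)
    {k : Sphere3} (hk : k ∈ surfBoundary S) :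
    ∃ ε > 0, ∀ x : Sphere3, ‖zTwo k x‖ < ε → x ∈ surfBoundary S → zTwo k x = 0 := by
  refine exists_tube_subset k (P := fun x => x ∈ surfBoundary S → zTwo k x = 0) fun x hx => ?_
  have hxb := hS.boundary_invariant k hk hx
  filter_upwards [hS.eventually_mem_orbit hd hxb] with y hy hyb
  rw [← mem_hopfOrbit_iff, ← hopfOrbit_eq_of_mem hx]
  exact hy hyb

/-- The boundary of a section consists of finitely many orbits. -/
theorem IsDSection.exists_finset_orbits (hd : 1 ≤ d) (hS : IsDSection hopfFlow d S) :
    ∃ F : Finset Sphere3, (∀ k ∈ F, k ∈ surfBoundary S) ∧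
      ∀ x ∈ surfBoundary S, ∃ k ∈ F, zTwo k x = 0 := by
  choose! ε hε hε' using fun k (hk : k ∈ surfBoundary S) => hS.exists_tube hd hk
  obtain ⟨F, hF, hcov⟩ := hS.compactSurface.isCompact_surfBoundary.elim_nhds_subcover
    (fun k => {x | ‖zTwo k x‖ < ε k}) (fun k hk =>
      (isOpen_lt (continuous_zTwo k).norm continuous_const).mem_nhds (by
        simpa [zTwo_self] using hε k hk))
  refine ⟨F, hF, fun x hx => ?_⟩
  obtain ⟨k, hk, hxk⟩ := mem_iUnion₂.1 (hcov hx)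
  exact ⟨k, hk, hε' k (hF k hk) x hxk hx⟩

/-- A diffeomorphism moving every point along its orbit preserves orbits. -/
theorem symm_mem_orbit {D : Sphere3 ≃ₘ^∞⟮𝓡 3, 𝓡 3⟯ Sphere3} {α : Sphere3 → ℝ}
    (hD : ∀ x, D x = hopfFlow (α x) x) (x : Sphere3) : D.symm x ∈ flowOrbit hopfFlow x := by
  refine mem_hopfOrbit_symm ⟨α (D.symm x), ?_⟩
  simp only
  rw [← hD]; simp

theorem image_eq_of_orbit_invariant {D : Sphere3 ≃ₘ^∞⟮𝓡 3, 𝓡 3⟯ Sphere3} {α : Sphere3 → ℝ}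
    (hD : ∀ x, D x = hopfFlow (α x) x) {B : Set Sphere3}
    (hB : ∀ x ∈ B, flowOrbit hopfFlow x ⊆ B) : D '' B = B := by
  ext x
  constructor
  · rintro ⟨y, hy, rfl⟩; rw [hD]; exact hB y hy ⟨α y, rfl⟩
  · intro hx
    exact ⟨D.symm x, hB x hx (symm_mem_orbit hD x), by simp⟩

theorem image_surfBoundary (D : Sphere3 ≃ₘ^∞⟮𝓡 3, 𝓡 3⟯ Sphere3) (S : Set Sphere3) :
    surfBoundary (D '' S) = D '' surfBoundary S := by
  ext x
  obtain ⟨y, rfl⟩ : ∃ y, D y = x := D.surjective x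
  rw [diffeomorph_mem_surfBoundary_iff]
  exact (D.injective.mem_set_image (s := surfBoundary S)).symm

/-- A criterion for the image of a section under a diffeomorphism to be a section. -/
theorem IsDSection.image (hd : 1 ≤ d) (hS : IsDSection hopfFlow d S)
    (D : Sphere3 ≃ₘ^∞⟮𝓡 3, 𝓡 3⟯ Sphere3) (hB : D '' surfBoundary S = surfBoundary S)
    (hT : IsTransverse hopfFlow (D '' S))
    (hn : ∀ x ∉ surfBoundary S, (flowOrbit hopfFlow x ∩ D '' S).encard = d) :
    IsDSection hopfFlow d (D '' S) := by
  have hB' : surfBoundary (D '' S) = surfBoundary S := by rw [image_surfBoundary, hB]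
  have hcs := hS.compactSurface.image D
  refine ⟨hcs, ?_, hT, fun x => ?_⟩
  · rw [hB']; exact hS.boundary_invariant
  · by_cases hx : x ∈ surfBoundary S
    · right
      rw [hB']
      exact ⟨x, hx, hS.orbit_eq_connectedComponentIn hd hx⟩
    · left
      rw [← hn x hx]
      congr 1
      ext y
      refine ⟨fun ⟨h, hy⟩ => ⟨h, hy.1⟩, fun ⟨h, hy⟩ => ⟨h, hcs.mem_surfInterior_iff.2 ⟨hy, fun hb => ?_⟩⟩⟩
      rw [hB'] at hb
      obtain ⟨t, rfl⟩ := h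
      exact hx ((hS.hopfFlow_mem_surfBoundary_iff t).1 hb)

end HopfSection

namespace HopfSection
open scoped Topology
open Set Filter

/-! ### The drift equalising the hitting times -/

variable {d : ℕ} {S : Set Sphere3}

/-- The times in one period at which the orbit of `x` meets `S`. -/
def hits (S : Set Sphere3) (x : Sphere3) : Set ℝ :=
  {t | t ∈ Ioc 0 (2 * Real.pi) ∧ hopfFlow t x ∈ S}

/-- The cotangent of half the angle. -/
def halfCot (t : ℝ) : ℝ := Real.cos (t / 2) / Real.sin (t / 2)

open scoped Classical in
/-- A function increasing along the flow from `0` to `2π` between consecutive hits. -/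
def hitPhase (S : Set Sphere3) (x : Sphere3) : ℝ :=
  if x ∈ S then 0 else Real.pi + 2 * Real.arctan (∑ᶠ t ∈ hits S x, halfCot t)

/-- Moving every point for the time `drift d S` makes the hits of `S` equidistributed. -/
def drift (d : ℕ) (S : Set Sphere3) (x : Sphere3) : ℝ :=
  (hitPhase S x + ∑ᶠ t ∈ hits S x, t) / d

theorem contMDiffAt_comp_pair {K : ℝ × ℝ → ℝ} {f g : Sphere3 → ℝ} {x0 : Sphere3}
    (hK : ContDiffAt ℝ ∞ K (f x0, g x0)) (hf : ContMDiffAt (𝓡 3) 𝓘(ℝ, ℝ) ∞ f x0)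
    (hg : ContMDiffAt (𝓡 3) 𝓘(ℝ, ℝ) ∞ g x0) :
    ContMDiffAt (𝓡 3) 𝓘(ℝ, ℝ) ∞ (fun x => K (f x, g x)) x0 :=
  ContMDiffAt.comp x0 (g := K) (f := fun x => (f x, g x)) hK.contMDiffAt (hf.prodMk_space hg)

theorem contDiffAt_halfCot {t : ℝ} (ht : t ∈ Ioo 0 (2 * Real.pi)) : ContDiffAt ℝ ∞ halfCot t := by
  have h : Real.sin (t / 2) ≠ 0 :=
    (Real.sin_pos_of_pos_of_lt_pi (by linarith [ht.1]) (by linarith [ht.2])).ne'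
  exact ContDiffAt.div (by fun_prop) (by fun_prop) h

theorem hasDerivAt_halfCot {t : ℝ} (ht : t ∈ Ioo 0 (2 * Real.pi)) :
    HasDerivAt halfCot (-(1 / (2 * Real.sin (t / 2) ^ 2))) t := by
  have h : Real.sin (t / 2) ≠ 0 :=
    (Real.sin_pos_of_pos_of_lt_pi (by linarith [ht.1]) (by linarith [ht.2])).ne'
  have h1 : HasDerivAt (fun t : ℝ => t / 2) (1 / 2) t := (hasDerivAt_id t).div_const 2
  have h2 := h1.cos.div h1.sin h
  refine h2.congr_deriv ?_
  have := Real.sin_sq_add_cos_sq (t / 2)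
  field_simp
  linarith

theorem halfCot_add_two_pi (t : ℝ) : halfCot (t + 2 * Real.pi) = halfCot t := by
  unfold halfCot
  rw [show (t + 2 * Real.pi) / 2 = t / 2 + Real.pi by ring, Real.cos_add_pi, Real.sin_add_pi,
    neg_div_neg_eq]

theorem flowDeriv_eq_of_eventuallyEq {f F : Sphere3 → ℝ} {x0 : Sphere3} (h : f =ᶠ[𝓝 x0] F)
    {G : ℝ → ℝ} (hG : ∀ᶠ s in 𝓝 0, F (hopfFlow s x0) = G s) :
    flowDeriv hopfFlow f x0 = deriv G 0 := by
  unfold flowDeriv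
  apply Filter.EventuallyEq.deriv_eq
  have hc : Tendsto (fun s => hopfFlow s x0) (𝓝 0) (𝓝 x0) := by
    have := (isSmoothFlow_hopfFlow.smooth_curve x0).continuous.continuousAt (x := 0)
    simpa [ContinuousAt, isSmoothFlow_hopfFlow.zero] using this
  filter_upwards [hc.eventually h, hG] with s h1 h2
  rw [h1, h2]

/-- Off `S` the `d` hitting times in (0, 2π) are smooth functions of the point, hence so is the
drift. Along the flow each of them falls at rate 1, which contributes -1 after division by `d`. As
they fall, the decreasing function `halfCot` grows at each of them, so the phase has positive
derivative and the total rate exceeds -1. -/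
theorem IsDSection.drift_of_notMem (hd : 1 ≤ d) (hS : IsDSection hopfFlow d S) {x0 : Sphere3}
    (hx0 : x0 ∉ S) :
    ContMDiffAt (𝓡 3) 𝓘(ℝ, ℝ) ∞ (drift d S) x0 ∧ -1 < flowDeriv hopfFlow (drift d S) x0 := by
  have hcs := hS.compactSurface
  have hb : ∀ t, hopfFlow t x0 ∉ surfBoundary S := fun t ht =>
    hx0 ((hS.hopfFlow_mem_surfBoundary_iff t).1 ht).1
  have h0 : hopfFlow 0 x0 ∉ S := by rwa [isSmoothFlow_hopfFlow.zero]
  have h2π : hopfFlow (2 * Real.pi) x0 ∉ S := by rwa [hopfFlow_two_pi]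
  obtain ⟨T, τ, hT1, hT2, hev⟩ := exists_hittingTimes hcs hS.isTransverse hb h0 h2π
  have hmem : ∀ᶠ x in 𝓝 x0, ∀ t ∈ T, τ t x ∈ Ioo 0 (2 * Real.pi) := by
    rw [Filter.eventually_all_finset]
    intro t ht
    obtain ⟨h1, h2, h3, -⟩ := hT2 t ht
    exact h2.continuousAt.eventually_mem (isOpen_Ioo.mem_nhds (by rwa [h3]))
  have hnS : ∀ᶠ x in 𝓝 x0, x ∉ S := hcs.1.isClosed.isOpen_compl.mem_nhds hx0
  have hhits : ∀ᶠ x in 𝓝 x0, Set.InjOn (fun t => τ t x) T ∧ hits S x = (fun t => τ t x) '' T := by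
    filter_upwards [hev, hmem] with x h1 h2
    refine ⟨h1.1, ?_⟩
    ext s
    constructor
    · rintro ⟨hs, hsS⟩
      obtain ⟨t, ht, hts⟩ := (h1.2 s (Ioc_subset_Icc_self hs)).1 hsS
      exact ⟨t, ht, hts⟩
    · rintro ⟨t, ht, rfl⟩
      have := h2 t ht
      exact ⟨Ioo_subset_Ioc_self this, (h1.2 _ (Ioo_subset_Icc_self this)).2 ⟨t, ht, rfl⟩⟩
  have hcard : T.card = d := by
    have h1 := encard_orbit_inter S x0 0
    rw [zero_add, hS.encard_of_notMem (fun h => hx0 h.1)] at h1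
    obtain ⟨h2, h3⟩ := hhits.self_of_nhds
    rw [show {t | t ∈ Ioc 0 (2 * Real.pi) ∧ hopfFlow t x0 ∈ S} = hits S x0 from rfl, h3,
      h2.encard_image, Set.encard_coe_eq_coe_finsetCard] at h1
    exact_mod_cast h1.symm
  set F : Sphere3 → ℝ := fun x =>
    (Real.pi + 2 * Real.arctan (∑ t ∈ T, halfCot (τ t x)) + ∑ t ∈ T, τ t x) / d with hF
  have hfF : drift d S =ᶠ[𝓝 x0] F := by
    filter_upwards [hnS, hhits] with x h1 h2
    simp only [drift, hitPhase, if_neg h1, h2.2, finsum_mem_image h2.1, finsum_mem_coe_finset, hF]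
  refine ⟨ContMDiffAt.congr_of_eventuallyEq ?_ hfF, ?_⟩
  · have h1 : ContMDiffAt (𝓡 3) 𝓘(ℝ, ℝ) ∞ (fun x => ∑ t ∈ T, halfCot (τ t x)) x0 := by
      refine ContMDiffAt.sum fun t ht => ?_
      obtain ⟨h1, h2, h3, -⟩ := hT2 t ht
      exact ContMDiffAt.comp x0 (g := halfCot)
        (contMDiffAt_iff_contDiffAt.2 (contDiffAt_halfCot (by rwa [h3]))) h2
    have h2 : ContMDiffAt (𝓡 3) 𝓘(ℝ, ℝ) ∞ (fun x => ∑ t ∈ T, τ t x) x0 :=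
      ContMDiffAt.sum fun t ht => (hT2 t ht).2.1
    have h3 : ContDiff ℝ ∞ (fun p : ℝ × ℝ => (Real.pi + 2 * Real.arctan p.1 + p.2) / d) :=
      ((contDiff_const.add (contDiff_const.mul (Real.contDiff_arctan.comp contDiff_fst))).add
        contDiff_snd).div_const _
    exact contMDiffAt_comp_pair h3.contDiffAt h1 h2
  · have hG : ∀ᶠ s in 𝓝 (0 : ℝ), F (hopfFlow s x0) =
        (Real.pi + 2 * Real.arctan (∑ t ∈ T, halfCot (t - s)) + ∑ t ∈ T, (t - s)) / d := by
      have : ∀ᶠ s in 𝓝 (0 : ℝ), ∀ t ∈ T, τ t (hopfFlow s x0) = t - s := by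
        rw [Filter.eventually_all_finset]
        exact fun t ht => (hT2 t ht).2.2.2
      filter_upwards [this] with s hs
      simp only [hF]
      rw [Finset.sum_congr rfl fun t ht => by rw [hs t ht], Finset.sum_congr rfl hs]
    rw [flowDeriv_eq_of_eventuallyEq hfF hG]
    have h1 : ∀ t ∈ T, HasDerivAt (fun s : ℝ => halfCot (t - s))
        (1 / (2 * Real.sin (t / 2) ^ 2)) 0 := by
      intro t ht
      have h1 := hasDerivAt_halfCot (t := t - 0) (by rw [sub_zero]; exact (hT2 t ht).1)
      have h2 : HasDerivAt (fun s : ℝ => halfCot (t - s)) _ 0 :=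
        h1.comp (0 : ℝ) ((hasDerivAt_id (0 : ℝ)).const_sub t)
      exact h2.congr_deriv (by simp)
    have h2 := HasDerivAt.fun_sum h1
    have h3 : HasDerivAt (fun s : ℝ => ∑ t ∈ T, (t - s)) (∑ t ∈ T, (-1 : ℝ)) 0 :=
      HasDerivAt.fun_sum fun t _ => (hasDerivAt_id (0 : ℝ)).const_sub t
    have h4 : HasDerivAt (fun s : ℝ => (Real.pi + 2 * Real.arctan (∑ t ∈ T, halfCot (t - s)) +
        ∑ t ∈ T, (t - s)) / d) _ 0 :=
      (((h2.arctan.const_mul 2).const_add Real.pi).add h3).div_const (d : ℝ)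
    rw [h4.deriv]
    have hpos : 0 < ∑ t ∈ T, 1 / (2 * Real.sin (t / 2) ^ 2) := by
      refine Finset.sum_pos (fun t ht => ?_) (Finset.card_pos.1 (by omega))
      have := (hT2 t ht).1
      have : 0 < Real.sin (t / 2) :=
        Real.sin_pos_of_pos_of_lt_pi (by linarith [this.1]) (by linarith [this.2])
      positivity
    have hd' : (0 : ℝ) < d := by exact_mod_cast hd
    rw [Finset.sum_const, hcard, lt_div_iff₀ hd']
    have : 0 < 2 * (1 / (1 + (∑ t ∈ T, halfCot (t - 0)) ^ 2) *
        ∑ t ∈ T, 1 / (2 * Real.sin (t / 2) ^ 2)) := by positivity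
    simp only [nsmul_eq_mul]
    linarith

/-- When the flow crosses `S`, the phase drops by 2π and the sum of the hits gains 2π. To see that
the total is smooth, let `R` be the sum of `halfCot` over the hits other than the one at time `τ 0
x` near 0. Then `halfCot (τ 0 x) + R x` is the reciprocal of `C (τ 0 x, R x)`, which is smooth
through `τ 0 x = 0`. The arctangent of a reciprocal is ±π/2 minus the arctangent, and the change of
sign is compensated by the jump of the sum. -/
theorem IsDSection.drift_of_mem (hd : 1 ≤ d) (hS : IsDSection hopfFlow d S) {x0 : Sphere3}
    (hx0 : x0 ∈ S) (hxb : x0 ∉ surfBoundary S) :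
    ContMDiffAt (𝓡 3) 𝓘(ℝ, ℝ) ∞ (drift d S) x0 ∧ -1 < flowDeriv hopfFlow (drift d S) x0 := by
  have hcs := hS.compactSurface
  have hpi := Real.pi_gt_three
  have hb : ∀ t, hopfFlow t x0 ∉ surfBoundary S := fun t ht =>
    hxb ((hS.hopfFlow_mem_surfBoundary_iff t).1 ht)
  obtain ⟨δ, hδ, hδ'⟩ := exists_pos_forall_notMem hcs hS.isTransverse hxb
  -- The window starts shortly before `x0`, so that the hit at time 0 lies in its interior; the
  -- bound by 1 keeps `-a` well below a period.
  set a : ℝ := -(min δ 1 / 2) with ha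
  have hmin : 0 < min δ 1 := lt_min hδ one_pos
  have ha0 : a < 0 := by linarith
  have ha1 : -a < δ := by have := min_le_left δ 1; linarith
  have ha2 : -a < 1 := by have := min_le_right δ 1; linarith
  have haS : hopfFlow a x0 ∉ S := hδ' a (by rw [abs_of_neg ha0]; exact ha1) ha0.ne
  obtain ⟨T, τ, hT1, hT2, hev⟩ := exists_hittingTimes hcs hS.isTransverse hb haS
    (b := a + 2 * Real.pi) (by rwa [hopfFlow_add_two_pi])
  have h0T : (0 : ℝ) ∈ T := by
    rw [hT1, isSmoothFlow_hopfFlow.zero]; exact ⟨⟨ha0.le, by linarith⟩, hx0⟩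
  set T' := T.erase 0 with hT'
  have hposT : ∀ t ∈ T', t ∈ Ioo 0 (a + 2 * Real.pi) := by
    intro t ht
    obtain ⟨ht0, ht⟩ := Finset.mem_erase.1 ht
    have h1 := (hT2 t ht).1
    refine ⟨not_le.1 fun hle => ?_, h1.2⟩
    exact hδ' t (by rw [abs_lt]; constructor <;> linarith [h1.1]) ht0 ((hT1 t).1 ht).2
  have hmem : ∀ᶠ x in 𝓝 x0, ∀ t ∈ T', τ t x ∈ Ioo 0 (a + 2 * Real.pi) := by
    rw [Filter.eventually_all_finset]
    intro t ht
    obtain ⟨h1, h2, h3, -⟩ := hT2 t (Finset.mem_of_mem_erase ht)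
    exact h2.continuousAt.eventually_mem (isOpen_Ioo.mem_nhds (by rw [h3]; exact hposT t ht))
  obtain ⟨-, hτ0s, hτ00, hτ0f⟩ := hT2 0 h0T
  have hmem0 : ∀ᶠ x in 𝓝 x0, τ 0 x ∈ Ioo a (-a) :=
    hτ0s.continuousAt.eventually_mem (isOpen_Ioo.mem_nhds (by rw [hτ00]; exact ⟨ha0, by linarith⟩))
  set R : Sphere3 → ℝ := fun x => ∑ t ∈ T', halfCot (τ t x) with hR
  have hRs : ContMDiffAt (𝓡 3) 𝓘(ℝ, ℝ) ∞ R x0 := by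
    refine ContMDiffAt.sum fun t ht => ?_
    obtain ⟨h1, h2, h3, -⟩ := hT2 t (Finset.mem_of_mem_erase ht)
    have h4 := hposT t ht
    exact ContMDiffAt.comp x0 (g := halfCot) (contMDiffAt_iff_contDiffAt.2
      (contDiffAt_halfCot (by rw [h3]; exact ⟨h4.1, by linarith [h4.2]⟩))) h2
  set C : ℝ × ℝ → ℝ := fun p =>
    Real.sin (p.1 / 2) / (Real.cos (p.1 / 2) + p.2 * Real.sin (p.1 / 2)) with hC
  have hden : ∀ᶠ x in 𝓝 x0, 0 < Real.cos (τ 0 x / 2) + R x * Real.sin (τ 0 x / 2) := by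
    have hc : ContinuousAt (fun x => Real.cos (τ 0 x / 2) + R x * Real.sin (τ 0 x / 2)) x0 := by
      have h1 := hτ0s.continuousAt.div_const 2
      exact (Real.continuous_cos.continuousAt.comp h1).add
        (hRs.continuousAt.mul (Real.continuous_sin.continuousAt.comp h1))
    exact hc.eventually_mem (isOpen_Ioi.mem_nhds (by simp [hτ00]))
  -- the hits of a point near `x0`
  set g : Sphere3 → ℝ → ℝ := fun x t =>
    if t = 0 then (if 0 < τ 0 x then τ 0 x else τ 0 x + 2 * Real.pi) else τ t x with hg
  have hhits : ∀ᶠ x in 𝓝 x0, Set.InjOn (g x) T ∧ hits S x = g x '' T ∧ (x ∈ S ↔ τ 0 x = 0) := by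
    filter_upwards [hev, hmem, hmem0] with x h1 h2 h3
    have h2' : ∀ t ∈ T, t ≠ 0 → τ t x ∈ Ioo 0 (a + 2 * Real.pi) := fun t ht h0 =>
      h2 t (Finset.mem_erase.2 ⟨h0, ht⟩)
    have hwin : ∀ t ∈ T, hopfFlow (τ t x) x ∈ S := by
      intro t ht
      refine (h1.2 _ ?_).2 ⟨t, ht, rfl⟩
      by_cases h0 : t = 0
      · rw [h0]; exact ⟨h3.1.le, by linarith [h3.2]⟩
      · have := h2' t ht h0; exact ⟨by linarith [this.1], this.2.le⟩
    have g0 : ∀ t, t ≠ 0 → g x t = τ t x := fun t h0 => if_neg h0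
    have g0' : g x 0 = if 0 < τ 0 x then τ 0 x else τ 0 x + 2 * Real.pi := if_pos rfl
    have hne : ∀ t ∈ T, t ≠ 0 → g x 0 ≠ τ t x := by
      intro t ht h0 he
      rw [g0'] at he
      split_ifs at he with hp
      · exact h0 (h1.1 ht h0T he.symm)
      · have := (h2' t ht h0).2; linarith [h3.1]
    refine ⟨?_, ?_, ?_⟩
    · intro t ht s hs hts
      by_cases ht0 : t = 0 <;> by_cases hs0 : s = 0
      · rw [ht0, hs0]
      · subst ht0; rw [g0 s hs0] at hts; exact absurd hts (hne s hs hs0)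
      · subst hs0; rw [g0 t ht0] at hts; exact absurd hts.symm (hne t ht ht0)
      · rw [g0 t ht0, g0 s hs0] at hts; exact h1.1 ht hs hts
    · ext s
      constructor
      · rintro ⟨hs, hsS⟩
        rcases le_or_gt s (a + 2 * Real.pi) with hle | hlt
        · obtain ⟨t, ht, hts⟩ := (h1.2 s ⟨by linarith [hs.1], hle⟩).1 hsS
          refine ⟨t, ht, ?_⟩
          by_cases h0 : t = 0
          · subst h0; rw [g0', if_pos (by rw [hts]; exact hs.1), hts]
          · rw [g0 t h0, hts]
        · have e : hopfFlow (s - 2 * Real.pi) x = hopfFlow s x := by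
            rw [← hopfFlow_add_two_pi, sub_add_cancel]
          obtain ⟨t, ht, hts⟩ := (h1.2 (s - 2 * Real.pi)
            ⟨by linarith, by linarith [hs.2]⟩).1 (by rwa [e])
          refine ⟨t, ht, ?_⟩
          by_cases h0 : t = 0
          · subst h0; rw [g0', if_neg (by rw [hts]; linarith [hs.2]), hts]; ring
          · have := (h2' t ht h0).1; linarith [hs.2]
      · rintro ⟨t, ht, rfl⟩
        by_cases h0 : t = 0
        · subst h0
          rw [g0']
          split_ifs with hp
          · exact ⟨⟨hp, by linarith [h3.2]⟩, hwin 0 ht⟩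
          · refine ⟨⟨by linarith [h3.1], by linarith⟩, ?_⟩
            rw [hopfFlow_add_two_pi]; exact hwin 0 ht
        · rw [g0 t h0]
          have := h2' t ht h0
          exact ⟨⟨this.1, by linarith [this.2]⟩, hwin t ht⟩
    · constructor
      · intro hxS
        obtain ⟨t, ht, hts⟩ := (h1.2 0 ⟨ha0.le, by linarith⟩).1 (by
          rwa [isSmoothFlow_hopfFlow.zero])
        by_cases h0 : t = 0
        · rwa [h0] at hts
        · have := (h2' t ht h0).1; linarith
      · intro h0
        have := hwin 0 h0T
        rwa [h0, isSmoothFlow_hopfFlow.zero] at this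
  have hcard : T.card = d := by
    have h1 := encard_orbit_inter S x0 0
    rw [zero_add, hS.encard_of_notMem hxb] at h1
    obtain ⟨h2, h3, -⟩ := hhits.self_of_nhds
    rw [show {t | t ∈ Ioc 0 (2 * Real.pi) ∧ hopfFlow t x0 ∈ S} = hits S x0 from rfl, h3,
      h2.encard_image, Set.encard_coe_eq_coe_finsetCard] at h1
    exact_mod_cast h1.symm
  set F : Sphere3 → ℝ := fun x =>
    (2 * Real.pi - 2 * Real.arctan (C (τ 0 x, R x)) + ∑ t ∈ T, τ t x) / d with hF
  have hfF : drift d S =ᶠ[𝓝 x0] F := by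
    filter_upwards [hhits, hden, hmem0] with x h1 h2 h3
    obtain ⟨hi, hh, hxS⟩ := h1
    have hsum : ∀ f : ℝ → ℝ, ∑ᶠ t ∈ hits S x, f t = f (g x 0) + ∑ t ∈ T', f (τ t x) := by
      intro f
      rw [hh, finsum_mem_image hi, finsum_mem_coe_finset, ← Finset.add_sum_erase T _ h0T]
      congr 1
      refine Finset.sum_congr rfl fun t ht => ?_
      simp only [hg, if_neg (Finset.mem_erase.1 ht).1]
    have hτsum : ∑ t ∈ T, τ t x = τ 0 x + ∑ t ∈ T', τ t x := (Finset.add_sum_erase T _ h0T).symm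
    have hg0 : g x 0 = if 0 < τ 0 x then τ 0 x else τ 0 x + 2 * Real.pi := if_pos rfl
    have hcot : halfCot (g x 0) = halfCot (τ 0 x) := by
      rw [hg0]; split_ifs
      · rfl
      · rw [halfCot_add_two_pi]
    simp only [drift, hitPhase, hsum, hcot, hF]
    congr 1
    rw [show ∑ t ∈ T', halfCot (τ t x) = R x from rfl, hτsum]
    rcases lt_trichotomy (τ 0 x) 0 with hneg | hzero | hpos
    · have hs : Real.sin (τ 0 x / 2) < 0 :=
        Real.sin_neg_of_neg_of_neg_pi_lt (by linarith) (by linarith [h3.1])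
      have hCn : C (τ 0 x, R x) < 0 := div_neg_of_neg_of_pos hs h2
      have hCi : halfCot (τ 0 x) + R x = (C (τ 0 x, R x))⁻¹ := by
        simp only [hC, halfCot, inv_div]; field_simp [hs.ne]
      rw [if_neg (by rw [hxS]; exact hneg.ne), hCi, Real.arctan_inv_of_neg hCn, hg0,
        if_neg (not_lt.2 hneg.le)]
      ring
    · rw [if_pos (hxS.2 hzero), hg0, if_neg (by rw [hzero]; exact lt_irrefl 0)]
      simp only [hC, hzero]; simp
    · have hs : 0 < Real.sin (τ 0 x / 2) :=
        Real.sin_pos_of_pos_of_lt_pi (by linarith) (by linarith [h3.2])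
      have hCn : 0 < C (τ 0 x, R x) := div_pos hs h2
      have hCi : halfCot (τ 0 x) + R x = (C (τ 0 x, R x))⁻¹ := by
        simp only [hC, halfCot, inv_div]; field_simp [hs.ne']
      rw [if_neg (by rw [hxS]; exact hpos.ne'), hCi, Real.arctan_inv_of_pos hCn, hg0, if_pos hpos]
      ring
  refine ⟨ContMDiffAt.congr_of_eventuallyEq ?_ hfF, ?_⟩
  · have h1 : ContMDiffAt (𝓡 3) 𝓘(ℝ, ℝ) ∞ (fun x => C (τ 0 x, R x)) x0 := by
      have hCs : ContDiffAt ℝ ∞ C (τ 0 x0, R x0) :=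
        ContDiffAt.div (by fun_prop) (by fun_prop) hden.self_of_nhds.ne'
      exact contMDiffAt_comp_pair hCs hτ0s hRs
    have h2 : ContMDiffAt (𝓡 3) 𝓘(ℝ, ℝ) ∞ (fun x => ∑ t ∈ T, τ t x) x0 :=
      ContMDiffAt.sum fun t ht => (hT2 t ht).2.1
    have h3 : ContDiff ℝ ∞ (fun p : ℝ × ℝ => (2 * Real.pi - 2 * Real.arctan p.1 + p.2) / d) :=
      ((contDiff_const.sub (contDiff_const.mul (Real.contDiff_arctan.comp contDiff_fst))).add
        contDiff_snd).div_const _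
    exact contMDiffAt_comp_pair h3.contDiffAt h1 h2
  · set Q : ℝ → ℝ := fun s => ∑ t ∈ T', halfCot (t - s) with hQ
    have hG : ∀ᶠ s in 𝓝 (0 : ℝ), F (hopfFlow s x0) =
        (2 * Real.pi - 2 * Real.arctan (C (0 - s, Q s)) + ∑ t ∈ T, (t - s)) / d := by
      have : ∀ᶠ s in 𝓝 (0 : ℝ), ∀ t ∈ T, τ t (hopfFlow s x0) = t - s := by
        rw [Filter.eventually_all_finset]
        exact fun t ht => (hT2 t ht).2.2.2
      filter_upwards [this] with s hs
      simp only [hF, hR]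
      rw [Finset.sum_congr rfl fun t ht => by rw [hs t (Finset.mem_of_mem_erase ht)],
        Finset.sum_congr rfl hs, hs 0 h0T]
    rw [flowDeriv_eq_of_eventuallyEq hfF hG]
    have hQd : DifferentiableAt ℝ Q 0 := by
      refine DifferentiableAt.fun_sum fun t ht => ?_
      have h4 := hposT t ht
      have h1 := hasDerivAt_halfCot (t := t - 0) (by
        rw [sub_zero]; exact ⟨h4.1, by linarith [h4.2]⟩)
      exact (h1.comp (0 : ℝ) ((hasDerivAt_id (0 : ℝ)).const_sub t)).differentiableAt
    have e1 : HasDerivAt (fun s : ℝ => Real.sin ((0 - s) / 2)) (-1 / 2) 0 := by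
      have h1 : HasDerivAt (fun s : ℝ => (0 - s) / 2) (-1 / 2) 0 :=
        ((hasDerivAt_id (0 : ℝ)).const_sub 0).div_const 2
      simpa using h1.sin
    have e2 : HasDerivAt (fun s : ℝ => Real.cos ((0 - s) / 2)) 0 0 := by
      have h1 : HasDerivAt (fun s : ℝ => (0 - s) / 2) (-1 / 2) 0 :=
        ((hasDerivAt_id (0 : ℝ)).const_sub 0).div_const 2
      simpa using h1.cos
    have e3 := e2.add (hQd.hasDerivAt.mul e1)
    -- Hence the phase grows at rate 1 at a hit, and the drift has derivative (1 - d)/d there, which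
    -- is above -1.
    have e4 : HasDerivAt (fun s : ℝ => C (0 - s, Q s)) (-1 / 2) 0 := by
      have : HasDerivAt (fun s : ℝ => C (0 - s, Q s)) _ 0 := e1.div e3 (by simp)
      exact this.congr_deriv (by simp)
    have h3 : HasDerivAt (fun s : ℝ => ∑ t ∈ T, (t - s)) (∑ t ∈ T, (-1 : ℝ)) 0 :=
      HasDerivAt.fun_sum fun t _ => (hasDerivAt_id (0 : ℝ)).const_sub t
    have h4 : HasDerivAt (fun s : ℝ => (2 * Real.pi - 2 * Real.arctan (C (0 - s, Q s)) +
        ∑ t ∈ T, (t - s)) / d) _ 0 :=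
      (((e4.arctan.const_mul 2).const_sub (2 * Real.pi)).add h3).div_const (d : ℝ)
    rw [h4.deriv]
    have hd' : (0 : ℝ) < d := by exact_mod_cast hd
    rw [Finset.sum_const, hcard, lt_div_iff₀ hd']
    simp [hC]
    norm_num

theorem IsDSection.drift_spec (hd : 1 ≤ d) (hS : IsDSection hopfFlow d S) {x : Sphere3}
    (hx : x ∉ surfBoundary S) :
    ContMDiffAt (𝓡 3) 𝓘(ℝ, ℝ) ∞ (drift d S) x ∧ -1 < flowDeriv hopfFlow (drift d S) x := by
  by_cases h : x ∈ S
  · exact hS.drift_of_mem hd h hx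
  · exact hS.drift_of_notMem hd h

/-- The hit following `x` on its orbit is carried by the drift to distance `2π/d`. -/
theorem IsDSection.exists_next_hit (hd : 1 ≤ d) (hS : IsDSection hopfFlow d S) {x : Sphere3}
    (hxS : x ∈ S) (hx : x ∉ surfBoundary S) :
    ∃ t, hopfFlow t x ∈ S ∧ drift d S (hopfFlow t x) + t = drift d S x + 2 * Real.pi / d := by
  have hd' : (0 : ℝ) < d := by exact_mod_cast hd
  have hcard : (hits S x).encard = d := by
    have h1 := encard_orbit_inter S x 0
    rw [zero_add, hS.encard_of_notMem hx] at h1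
    exact h1.symm
  have hfin : (hits S x).Finite := Set.finite_of_encard_eq_coe hcard
  set T := hfin.toFinset with hT
  have hTm : ∀ t, t ∈ T ↔ t ∈ hits S x := fun t => by simp [hT]
  have hTc : T.card = d := by
    rw [hfin.encard_eq_coe_toFinset_card] at hcard
    exact_mod_cast hcard
  have h2π : 2 * Real.pi ∈ hits S x :=
    ⟨⟨Real.two_pi_pos, le_rfl⟩, by rwa [hopfFlow_two_pi]⟩
  have hne : T.Nonempty := ⟨_, (hTm _).2 h2π⟩
  set τ := T.min' hne with hτ
  have hτm : τ ∈ hits S x := (hTm _).1 (T.min'_mem hne)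
  have hmin : ∀ t ∈ hits S x, τ ≤ t := fun t ht => T.min'_le t ((hTm t).2 ht)
  set y := hopfFlow τ x with hy
  have hyS : y ∈ S := hτm.2
  -- Seen from the next hit all times drop by `τ`, and the hit `τ` itself moves to the end of the
  -- period. So the sum of the `d` times changes by `2π - dτ`.
  set g : ℝ → ℝ := fun t => t - τ + if t = τ then 2 * Real.pi else 0 with hg
  have hgτ : g τ = 2 * Real.pi := by simp [hg]
  have hgne : ∀ t, t ≠ τ → g t = t - τ := fun t h => by simp [hg, h]
  have hflow : ∀ t, hopfFlow (t - τ) y = hopfFlow t x := fun t => by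
    rw [hy, ← isSmoothFlow_hopfFlow.add, sub_add_cancel]
  have hglt : ∀ t ∈ T, t ≠ τ → g t < 2 * Real.pi := by
    intro t ht h
    rw [hgne t h]
    have := ((hTm t).1 ht).1.2; have := hτm.1.1; linarith
  have hhits : hits S y = g '' T := by
    ext s
    constructor
    · rintro ⟨hs, hsS⟩
      rcases eq_or_lt_of_le hs.2 with h | h
      · exact ⟨τ, (hTm τ).2 hτm, by rw [hgτ, h]⟩
      · rcases le_or_gt (s + τ) (2 * Real.pi) with h1 | h1
        · refine ⟨s + τ, (hTm _).2 ⟨⟨by linarith [hs.1, hτm.1.1], h1⟩, ?_⟩, ?_⟩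
          · rw [← hflow, add_sub_cancel_right]; exact hsS
          · rw [hgne _ (by linarith [hs.1]), add_sub_cancel_right]
        · have : s + τ - 2 * Real.pi ∈ hits S x := by
            refine ⟨⟨by linarith, by linarith [hτm.1.2]⟩, ?_⟩
            rw [← hopfFlow_add_two_pi, sub_add_cancel, ← hflow, add_sub_cancel_right]; exact hsS
          have := hmin _ this
          linarith
    · rintro ⟨t, ht, rfl⟩
      have htm := (hTm t).1 ht
      by_cases h : t = τ
      · rw [h, hgτ]; exact ⟨⟨Real.two_pi_pos, le_rfl⟩, by rwa [hopfFlow_two_pi]⟩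
      · rw [hgne t h]
        refine ⟨⟨sub_pos.2 (lt_of_le_of_ne (hmin t htm) (Ne.symm h)), by
          linarith [htm.1.2, hτm.1.1]⟩, ?_⟩
        rw [hflow]; exact htm.2
  have hginj : Set.InjOn g T := by
    intro s hs t ht hst
    by_cases h1 : s = τ <;> by_cases h2 : t = τ
    · rw [h1, h2]
    · rw [h1, hgτ] at hst; exact absurd hst (hglt t ht h2).ne'
    · rw [h2, hgτ] at hst; exact absurd hst (hglt s hs h1).ne
    · rw [hgne s h1, hgne t h2] at hst; linarith
  refine ⟨τ, hyS, ?_⟩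
  have e1 : ∑ᶠ t ∈ hits S y, t = ∑ t ∈ T, t - d * τ + 2 * Real.pi := by
    rw [hhits, finsum_mem_image hginj, finsum_mem_coe_finset]
    simp only [hg]
    rw [Finset.sum_add_distrib, Finset.sum_sub_distrib, Finset.sum_const, hTc, Finset.sum_ite_eq',
      if_pos ((hTm τ).2 hτm), nsmul_eq_mul]
  have e2 : ∑ᶠ t ∈ hits S x, t = ∑ t ∈ T, t := by
    rw [show hits S x = (T : Set ℝ) by ext t; simp [hTm], finsum_mem_coe_finset]
  rw [← hy]
  simp only [drift, hitPhase, if_pos hyS, if_pos hxS, e1, e2]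
  field_simp
  ring

/-- If `S` is invariant under `Ψ_c` along the orbit of `x`, so is the drift. -/
theorem drift_eq_of_invariant {c : ℝ} {x : Sphere3}
    (h : ∀ t, hopfFlow c (hopfFlow t x) ∈ S ↔ hopfFlow t x ∈ S) :
    drift d S (hopfFlow c x) = drift d S x := by
  have hcomm : ∀ t, hopfFlow t (hopfFlow c x) = hopfFlow c (hopfFlow t x) := fun t => by
    rw [← isSmoothFlow_hopfFlow.add, ← isSmoothFlow_hopfFlow.add, add_comm]
  have h1 : hits S (hopfFlow c x) = hits S x := by
    ext t; simp only [hits, mem_ofPred_eq, hcomm, h]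
  have h2 : hopfFlow c x ∈ S ↔ x ∈ S := by simpa [isSmoothFlow_hopfFlow.zero] using h 0
  by_cases hx : x ∈ S
  · simp only [drift, hitPhase, h1, if_pos hx, if_pos (h2.2 hx)]
  · simp only [drift, hitPhase, h1, if_neg hx, if_neg (mt h2.1 hx)]

end HopfSection

namespace HopfSection
open scoped Topology
open Set Filter

/-! ### Making a section invariant -/

variable {d : ℕ} {S : Set Sphere3}

/-- A smooth function vanishing near the orbit of `k` and equal to `1` off its tube of
radius `ε`. -/
def tubeCutoff (k : Sphere3) (ε : ℝ) (x : Sphere3) : ℝ :=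
  Real.smoothTransition (4 * Complex.normSq (zTwo k x) / ε ^ 2 - 1)

theorem contDiff_normSq : ContDiff ℝ ∞ (fun z : ℂ => Complex.normSq z) := by
  simp only [Complex.normSq_apply]
  exact (Complex.reCLM.contDiff.mul Complex.reCLM.contDiff).add
    (Complex.imCLM.contDiff.mul Complex.imCLM.contDiff)

theorem contMDiff_tubeCutoff (k : Sphere3) (ε : ℝ) :
    ContMDiff (𝓡 3) 𝓘(ℝ, ℝ) ∞ (tubeCutoff k ε) := by
  have h : ContDiff ℝ ∞ (fun z : ℂ =>
      Real.smoothTransition (4 * Complex.normSq z / ε ^ 2 - 1)) :=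
    Real.smoothTransition.contDiff.comp
      (((contDiff_const.mul contDiff_normSq).div_const _).sub contDiff_const)
  exact h.contMDiff.comp (contMDiff_zTwo k)

theorem tubeCutoff_hopfFlow (k : Sphere3) (ε t : ℝ) (x : Sphere3) :
    tubeCutoff k ε (hopfFlow t x) = tubeCutoff k ε x := by
  simp only [tubeCutoff, Complex.normSq_eq_norm_sq, norm_zTwo_hopfFlow]

theorem eventually_tubeCutoff_eq_zero {k : Sphere3} {ε : ℝ} (hε : 0 < ε) {x : Sphere3}
    (hx : zTwo k x = 0) : ∀ᶠ y in 𝓝 x, tubeCutoff k ε y = 0 := by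
  have h1 : Tendsto (fun y : Sphere3 => ‖zTwo k y‖) (𝓝 x) (𝓝 0) := by
    have h := ((continuous_zTwo k).norm.tendsto x)
    rwa [hx, norm_zero] at h
  filter_upwards [h1.eventually (gt_mem_nhds (show (0 : ℝ) < ε / 2 by positivity))] with y hy
  apply Real.smoothTransition.zero_of_nonpos
  rw [Complex.normSq_eq_norm_sq, sub_nonpos, div_le_one (by positivity)]
  nlinarith [norm_nonneg (zTwo k (y : C2))]

theorem norm_lt_of_tubeCutoff_ne_one {k : Sphere3} {ε : ℝ} (hε : 0 < ε) {x : Sphere3}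
    (hx : tubeCutoff k ε x ≠ 1) : ‖zTwo k x‖ < ε := by
  by_contra! h
  apply hx
  apply Real.smoothTransition.one_of_one_le
  rw [Complex.normSq_eq_norm_sq, le_sub_iff_add_le, le_div_iff₀ (by positivity)]
  nlinarith

/-- The `d`-th iterate of the map is the identity, so the preimage of a point of `S` is its image
under `d - 1` further steps and lies in `S` too. -/
theorem hopfFlow_image_eq (hd : 1 ≤ d)
    (h : ∀ x ∈ S, hopfFlow (2 * Real.pi / d) x ∈ S) : hopfFlow (2 * Real.pi / d) '' S = S := by
  set c := 2 * Real.pi / d with hc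
  have hd' : (d : ℝ) ≠ 0 := by exact_mod_cast (by omega : d ≠ 0)
  have hn : ∀ n : ℕ, ∀ x ∈ S, hopfFlow (n * c) x ∈ S := by
    intro n
    induction n with
    | zero => intro x hx; simpa [isSmoothFlow_hopfFlow.zero] using hx
    | succ n ih =>
      intro x hx
      rw [show ((n + 1 : ℕ) : ℝ) * c = c + n * c by push_cast; ring, isSmoothFlow_hopfFlow.add]
      exact h _ (ih x hx)
  refine Subset.antisymm (image_subset_iff.2 h) fun x hx => ?_
  refine ⟨hopfFlow ((d - 1 : ℕ) * c) x, hn _ x hx, ?_⟩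
  rw [← isSmoothFlow_hopfFlow.add, Nat.cast_sub hd, Nat.cast_one,
    show c + (d - 1) * c = 2 * Real.pi by rw [hc]; field_simp; ring, hopfFlow_two_pi]

/-- A section which is invariant near its boundary is isotopic to an invariant section. -/
theorem IsDSection.exists_invariant (hd : 1 ≤ d) (hS : IsDSection hopfFlow d S)
    (hinv : ∀ k ∈ surfBoundary S, ∃ ε > 0, ∀ x : Sphere3, ‖zTwo k x‖ < ε →
      (hopfFlow (2 * Real.pi / d) x ∈ S ↔ x ∈ S)) :
    ∃ S', IsDSection hopfFlow d S' ∧ IsotopicSections hopfFlow S S' ∧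
      hopfFlow (2 * Real.pi / d) '' S' = S' := by
  obtain ⟨F, hF, hF'⟩ := hS.exists_finset_orbits hd
  choose! ε hε hε' using hinv
  -- The cutoff is constant on orbits. It therefore only scales the rate of the drift, and where it
  -- equals 1 the spacing of the hits is not disturbed.
  set κ : Sphere3 → ℝ := fun x => ∏ k ∈ F, tubeCutoff k (ε k) x with hκ
  have hκs : ContMDiff (𝓡 3) 𝓘(ℝ, ℝ) ∞ κ :=
    contMDiff_finsetProd fun k _ => contMDiff_tubeCutoff k (ε k)
  have hκf : ∀ t x, κ (hopfFlow t x) = κ x := fun t x => by simp only [hκ, tubeCutoff_hopfFlow]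
  have hκ0 : ∀ x, 0 ≤ κ x := fun x => Finset.prod_nonneg fun k _ => Real.smoothTransition.nonneg _
  have hκ1 : ∀ x, κ x ≤ 1 := fun x => Finset.prod_le_one
    (fun k _ => Real.smoothTransition.nonneg _) fun k _ => Real.smoothTransition.le_one _
  have hκB : ∀ x ∈ surfBoundary S, ∀ᶠ y in 𝓝 x, κ y = 0 := by
    intro x hx
    obtain ⟨k, hk, hkx⟩ := hF' x hx
    filter_upwards [eventually_tubeCutoff_eq_zero (hε k (hF k hk)) hkx] with y hy
    exact Finset.prod_eq_zero hk hy
  set α : Sphere3 → ℝ := fun x => κ x * drift d S x with hα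
  have hαs : ContMDiff (𝓡 3) 𝓘(ℝ, ℝ) ∞ α := by
    intro x
    by_cases hx : x ∈ surfBoundary S
    · refine (contMDiffAt_const (c := (0 : ℝ))).congr_of_eventuallyEq ?_
      filter_upwards [hκB x hx] with y hy
      simp only [hα, hy, zero_mul]
    · exact (hκs x).mul (hS.drift_spec hd hx).1
  have hαd : ∀ x, flowDeriv hopfFlow α x = κ x * flowDeriv hopfFlow (drift d S) x := by
    intro x
    simp only [flowDeriv, hα, hκf]
    exact deriv_const_mul_field _
  have hY : ∀ x, -1 < flowDeriv hopfFlow α x := by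
    intro x
    rw [hαd]
    by_cases hx : x ∈ surfBoundary S
    · rw [(hκB x hx).self_of_nhds]; norm_num
    · have := (hS.drift_spec hd hx).2
      rcases le_or_gt 0 (flowDeriv hopfFlow (drift d S) x) with h | h
      · have := mul_nonneg (hκ0 x) h; linarith
      · nlinarith [hκ1 x]
  have hcomm : ∀ s t x, hopfFlow s (hopfFlow t x) = hopfFlow t (hopfFlow s x) := fun s t x => by
    rw [← isSmoothFlow_hopfFlow.add, ← isSmoothFlow_hopfFlow.add, add_comm]
  obtain ⟨D, hD, hiso, hT⟩ := exists_isotopicSections_of_shear (S := S) isSmoothFlow_hopfFlow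
    isSmoothFlow_hopfFlow hcomm hαs hY (fun φ hφ p hp hpS => by
      have h1 := hS.transverse φ hφ p hp hpS
      have h2 : 0 < 1 + flowDeriv hopfFlow α p := by linarith [hY p]
      have h3 : ∀ n a : ℝ, 0 < 1 + a → n * (n - a / (1 + a) * n) = n ^ 2 / (1 + a) := by
        intro n a h; field_simp; ring
      rw [h3 _ _ h2]
      positivity)
  have hB : D '' surfBoundary S = surfBoundary S :=
    image_eq_of_orbit_invariant hD hS.boundary_invariant
  refine ⟨D '' S, hS.image hd D hB hT fun x hx => ?_, hiso, hopfFlow_image_eq hd ?_⟩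
  -- `D` moves points along their orbits, so it permutes each orbit and keeps the number of hits.
  · have : flowOrbit hopfFlow x ∩ D '' S = D '' (flowOrbit hopfFlow x ∩ S) := by
      have h1 : D '' flowOrbit hopfFlow x = flowOrbit hopfFlow x :=
        image_eq_of_orbit_invariant hD fun y hy => (hopfOrbit_eq_of_mem hy).subset
      rw [image_inter (f := D) D.injective, h1]
    rw [this, Function.Injective.encard_image (f := D) D.injective, hS.encard_of_notMem hx]
  · rintro _ ⟨x, hxS, rfl⟩
    by_cases hx : x ∈ surfBoundary S
    · have h1 : D x ∈ surfBoundary S := by rw [← hB]; exact ⟨x, hx, rfl⟩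
      have h2 := hS.hopfFlow_mem_surfBoundary h1 (2 * Real.pi / d)
      rw [← hB] at h2
      exact image_mono (surfBoundary_subset S) h2
    -- Where the cutoff is 1, the translate of an image point is the image of the next hit.
    -- Elsewhere the orbit lies in a tube in which `S` is invariant; there the drift is invariant as
    -- well, and the translate of an image point is the image of the translate.
    by_cases hκx : κ x = 1
    · obtain ⟨t, ht, hdt⟩ := hS.exists_next_hit hd hxS hx
      refine ⟨_, ht, ?_⟩
      rw [hD, hD, ← isSmoothFlow_hopfFlow.add, ← isSmoothFlow_hopfFlow.add]
      simp only [hα, hκf, hκx, one_mul]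
      rw [hdt, add_comm]
    · have : ∃ k ∈ F, tubeCutoff k (ε k) x ≠ 1 := by
        by_contra! h
        exact hκx (Finset.prod_eq_one h)
      obtain ⟨k, hk, hkx⟩ := this
      have hlt := norm_lt_of_tubeCutoff_ne_one (hε k (hF k hk)) hkx
      have h1 : ∀ t, hopfFlow (2 * Real.pi / d) (hopfFlow t x) ∈ S ↔ hopfFlow t x ∈ S := fun t =>
        hε' k (hF k hk) _ (by rwa [norm_zTwo_hopfFlow])
      refine ⟨hopfFlow (2 * Real.pi / d) x, (hε' k (hF k hk) x hlt).2 hxS, ?_⟩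
      rw [hD, hD]
      simp only [hα, hκf, drift_eq_of_invariant h1]
      rw [hcomm]

end HopfSection

namespace HopfSection
open scoped Topology
open Set Filter

/-! ### Division by a coordinate -/

open MeasureTheory in
/-- **Hadamard's lemma**: a smooth function vanishing on the kernel of a linear form `ℓ` is
smoothly divisible by `ℓ`. -/
theorem exists_smooth_quotient {E F : Type} [NormedAddCommGroup E] [NormedSpace ℝ E]
    [NormedAddCommGroup F] [NormedSpace ℝ F] [CompleteSpace F] {f : E → F} (hf : ContDiff ℝ ∞ f)
    (ℓ : E →L[ℝ] ℝ) {e : E} (he : ℓ e = 1) (hf0 : ∀ u, ℓ u = 0 → f u = 0) :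
    ∃ G : E → F, ContDiff ℝ ∞ G ∧ (∀ u, f u = ℓ u • G u) ∧
      ∀ u, ℓ u = 0 → G u = fderiv ℝ f u e := by
  have hfd : ContDiff ℝ ∞ (fun u => fderiv ℝ f u e) :=
    (hf.fderiv_right (m := ∞) (by simp)).clm_apply contDiff_const
  -- The quotient is the integral of the derivative of `f` in the direction `e` over the segment
  -- from `u - ℓ u • e` to `u`. Its smoothness follows from that of convolutions with parameters: it
  -- is the value at 0 of the convolution of the indicator of [0, 1] with `g u`. The bump equals 1
  -- on [-1, 1], so it does not change this value, and it makes the support of `g u` compact.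
  let η : ContDiffBump (0 : ℝ) := ⟨1, 2, one_pos, one_lt_two⟩
  set g : E → ℝ → F := fun u y => η y • fderiv ℝ f (u - ℓ u • e - (y * ℓ u) • e) e with hg
  have hgs : ContDiff ℝ ∞ (fun q : E × ℝ => g q.1 q.2) := by
    have h1 : ContDiff ℝ ∞ (fun q : E × ℝ => q.1 - ℓ q.1 • e - (q.2 * ℓ q.1) • e) := by fun_prop
    exact (η.contDiff.comp contDiff_snd).smul (hfd.comp h1)
  have hloc : LocallyIntegrable (indicator (Icc (0 : ℝ) 1) (fun _ => (1 : ℝ))) volume :=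
    (locallyIntegrable_const (1 : ℝ)).indicator measurableSet_Icc
  have hconv := contDiffOn_convolution_right_with_param (n := ⊤) (μ := volume)
    (ContinuousLinearMap.lsmul ℝ ℝ : ℝ →L[ℝ] F →L[ℝ] F) (g := g) (s := univ)
    (k := Metric.closedBall 0 2) isOpen_univ (isCompact_closedBall _ _) (by
      intro p x _ hx
      have : η x = 0 := η.zero_of_le_dist (by
        rw [Metric.mem_closedBall, not_le] at hx; exact hx.le)
      simp only [hg, this, zero_smul]) hloc hgs.contDiffOn
  rw [univ_prod_univ, contDiffOn_univ] at hconv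
  have hG : ContDiff ℝ ∞ (fun u : E => ∫ s in (0 : ℝ)..1,
      fderiv ℝ f (u - ℓ u • e + (s * ℓ u) • e) e) := by
    convert hconv.comp (contDiff_id.prodMk (contDiff_const (c := (0 : ℝ)))) using 1
    ext u
    symm
    simp only [Function.comp_apply, id, convolution]
    rw [intervalIntegral.integral_of_le zero_le_one, ← integral_Icc_eq_integral_Ioc,
      ← integral_indicator measurableSet_Icc]
    refine integral_congr_ae (Eventually.of_forall fun t => ?_)
    by_cases ht : t ∈ Icc (0 : ℝ) 1
    · have : η (0 - t) = 1 := η.one_of_mem_closedBall (by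
        rw [mem_closedBall_zero_iff, Real.norm_eq_abs, abs_le]
        simp only [η]
        constructor <;> linarith [ht.1, ht.2])
      simp only [indicator_of_mem ht, hg, this, ContinuousLinearMap.lsmul_apply, one_smul]
      congr 2
      rw [zero_sub, neg_mul, neg_smul, sub_neg_eq_add]
    · simp only [indicator_of_notMem ht, ContinuousLinearMap.lsmul_apply, zero_smul]
  refine ⟨_, hG, fun u => ?_, fun u hu => ?_⟩
  · have hd : ∀ s : ℝ, HasDerivAt (fun s : ℝ => f (u - ℓ u • e + (s * ℓ u) • e))
        (ℓ u • fderiv ℝ f (u - ℓ u • e + (s * ℓ u) • e) e) s := by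
      intro s
      have h1 : HasDerivAt (fun s : ℝ => u - ℓ u • e + (s * ℓ u) • e) (ℓ u • e) s := by
        have := (((hasDerivAt_id s).mul_const (ℓ u)).smul_const e).const_add (u - ℓ u • e)
        simpa using this
      have h2 := ((hf.differentiable (by simp)) (u - ℓ u • e + (s * ℓ u) • e)).hasFDerivAt
      have h3 := h2.comp_hasDerivAt s h1
      rwa [map_smul] at h3
    have hc : Continuous (fun s : ℝ => ℓ u • fderiv ℝ f (u - ℓ u • e + (s * ℓ u) • e) e) := by
      have h1 : Continuous (fun s : ℝ => u - ℓ u • e + (s * ℓ u) • e) := by fun_prop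
      exact (hfd.continuous.comp h1).const_smul _
    have h := intervalIntegral.integral_eq_sub_of_hasDerivAt (fun s _ => hd s)
      (hc.intervalIntegrable 0 1)
    rw [intervalIntegral.integral_smul] at h
    rw [h, zero_mul, zero_smul, add_zero, one_mul, sub_add_cancel,
      hf0 (u - ℓ u • e) (by simp [he]), sub_zero]
  · simp [hu]

/-! ### The phase of the second coordinate along a section -/

variable {d : ℕ} {S : Set Sphere3}

/-- Moving along the first axis into the half-plane meets interior points. By continuity, conditions
known on the interior then pass to the boundary. -/
theorem IsHalfSliceChart.frequently_mem {φ : OpenPartialHomeomorph Sphere3 E3}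
    (hφ : IsHalfSliceChart S φ) {p : Sphere3} (hp : p ∈ φ.source) (h2 : φ p 2 = 0)
    (h0 : φ p 0 = 0) : ∃ᶠ x in 𝓝 p, x ∈ surfInterior S := by
  set v : E3 := EuclideanSpace.single 0 1 with hv
  have hc : Tendsto (fun t : ℝ => φ p + t • v) (𝓝[>] 0) (𝓝 (φ p)) := by
    have : Continuous (fun t : ℝ => φ p + t • v) := by fun_prop
    have := this.tendsto 0
    rw [zero_smul, add_zero] at this
    exact this.mono_left nhdsWithin_le_nhds
  have hc2 : Tendsto (fun t : ℝ => φ.symm (φ p + t • v)) (𝓝[>] 0) (𝓝 p) := by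
    have := (φ.symm.continuousAt (φ.map_source hp)).tendsto.comp hc
    rwa [φ.left_inv hp] at this
  have hev : ∀ᶠ t : ℝ in 𝓝[>] 0, φ.symm (φ p + t • v) ∈ surfInterior S := by
    filter_upwards [hc.eventually_mem (φ.open_target.mem_nhds (φ.map_source hp)),
      self_mem_nhdsWithin] with t ht ht0
    have e := φ.right_inv ht
    have e0 : φ (φ.symm (φ p + t • v)) 0 = t := by rw [e]; simp [hv, h0]
    have e2 : φ (φ.symm (φ p + t • v)) 2 = 0 := by rw [e]; simp [hv, h2]
    refine hφ.mem_surfInterior (φ.map_target ht) ((hφ.2 _ (φ.map_target ht)).2 ⟨e2, ?_⟩) ?_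
    · rw [e0]; exact le_of_lt ht0
    · rw [e0]; exact ht0
  exact hc2.frequently hev.frequently

theorem frequently_mem_surfInterior {p : Sphere3} (hp : p ∈ surfBoundary S) :
    ∃ᶠ x in 𝓝 p, x ∈ surfInterior S := by
  obtain ⟨hpS, φ, hφ, hp, h0⟩ := hp
  exact hφ.frequently_mem hp ((hφ.2 p hp).1 hpS).1 h0

/-- `zOne k` as a continuous linear map. -/
def zOneL (k : Sphere3) : C2 →L[ℝ] ℂ :=
  (((starRingEnd ℂ) ((k : C2) 0)) • (EuclideanSpace.proj (𝕜 := ℂ) (0 : Fin 2)) +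
    ((starRingEnd ℂ) ((k : C2) 1)) • (EuclideanSpace.proj (𝕜 := ℂ) (1 : Fin 2)) :
      C2 →L[ℂ] ℂ).restrictScalars ℝ

/-- `zTwo k` as a continuous linear map. -/
def zTwoL (k : Sphere3) : C2 →L[ℝ] ℂ :=
  (((k : C2) 0) • (EuclideanSpace.proj (𝕜 := ℂ) (1 : Fin 2)) -
    ((k : C2) 1) • (EuclideanSpace.proj (𝕜 := ℂ) (0 : Fin 2)) : C2 →L[ℂ] ℂ).restrictScalars ℝ

/-- Near a boundary orbit the second coordinate vanishes to first order only, along directions of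
the surface transverse to the boundary. -/
theorem fderiv_zTwo_ne_zero {φ : OpenPartialHomeomorph Sphere3 E3}
    (hφ : φ ∈ IsManifold.maximalAtlas (𝓡 3) ∞ Sphere3) {k p : Sphere3} (hp : p ∈ φ.source)
    (hz : zTwo k p = 0) (hK : ∀ᶠ t in 𝓝 (0 : ℝ), φ (hopfFlow t p) 0 = 0) :
    fderiv ℝ (fun u => zTwo k (φ.symm u)) (φ p) (EuclideanSpace.single 0 1) ≠ 0 := by
  intro h0
  set e : E3 := EuclideanSpace.single 0 1 with he
  have hsm : ContMDiffAt (𝓡 3) (𝓡 3) ∞ φ.symm (φ p) :=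
    contMDiffAt_symm_of_mem_maximalAtlas hφ (φ.map_source hp)
  have hφs : ContMDiffAt (𝓡 3) (𝓡 3) ∞ φ p := contMDiffAt_of_mem_maximalAtlas hφ hp
  set ι : E3 → C2 := fun u => (φ.symm u : C2) with hι
  have hιs : ContMDiffAt (𝓡 3) 𝓘(ℝ, C2) ∞ ι (φ p) :=
    ContMDiffAt.comp (φ p) (contMDiff_coe _) hsm
  have hιd : DifferentiableAt ℝ ι (φ p) :=
    (contMDiffAt_iff_contDiffAt.1 hιs).differentiableAt (by simp)
  set L := fderiv ℝ ι (φ p) with hL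
  have hinj : Function.Injective L := by
    have h1 : L = (mfderiv (𝓡 3) 𝓘(ℝ, C2) ((↑) : Sphere3 → C2) (φ.symm (φ p))).comp
        (mfderiv (𝓡 3) (𝓡 3) φ.symm (φ p)) := by
      rw [hL, ← mfderiv_eq_fderiv]
      exact mfderiv_comp (φ p) ((contMDiff_coe _).mdifferentiableAt (by simp))
        (hsm.mdifferentiableAt (by simp))
    have h2 : (mfderiv (𝓡 3) (𝓡 3) φ (φ.symm (φ p))).comp (mfderiv (𝓡 3) (𝓡 3) φ.symm (φ p)) =
        ContinuousLinearMap.id ℝ E3 := by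
      rw [← mfderiv_comp (φ p) (by rw [φ.left_inv hp]; exact hφs.mdifferentiableAt (by simp))
        (hsm.mdifferentiableAt (by simp))]
      have : φ ∘ φ.symm =ᶠ[𝓝 (φ p)] id := by
        filter_upwards [φ.open_target.mem_nhds (φ.map_source hp)] with u hu using φ.right_inv hu
      rw [this.mfderiv_eq, mfderiv_id]
      rfl
    have h3 : Function.Injective (mfderiv (𝓡 3) (𝓡 3) φ.symm (φ p)) := by
      intro v w hvw
      have := congrArg (mfderiv (𝓡 3) (𝓡 3) φ (φ.symm (φ p))) hvw
      have e1 := DFunLike.congr_fun h2 v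
      have e2 := DFunLike.congr_fun h2 w
      exact e1.symm.trans (this.trans e2)
    rw [h1]
    exact (mfderiv_coe_sphere_injective (φ.symm (φ p))).comp h3
  have hLd : HasFDerivAt ι L (φ p) := hιd.hasFDerivAt
  have hιp : ι (φ p) = p := by simp only [hι, φ.left_inv hp]
  -- the direction of the orbit
  set γ : ℝ → E3 := fun t => φ (hopfFlow t p) with hγ
  have hγ0 : γ 0 = φ p := by simp only [hγ, isSmoothFlow_hopfFlow.zero]
  have hγd : HasDerivAt γ (deriv γ 0) 0 := by
    have : ContMDiffAt 𝓘(ℝ, ℝ) (𝓡 3) ∞ γ 0 :=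
      ContMDiffAt.comp 0 (by rw [isSmoothFlow_hopfFlow.zero]; exact hφs)
        (isSmoothFlow_hopfFlow.smooth_curve p).contMDiffAt
    exact ((contMDiffAt_iff_contDiffAt.1 this).differentiableAt (by simp)).hasDerivAt
  set w := deriv γ 0 with hw
  have hw0 : w 0 = 0 := by
    have h1 := (EuclideanSpace.proj (𝕜 := ℝ) (0 : Fin 3)).hasFDerivAt.comp_hasDerivAt
      (0 : ℝ) hγd
    have h2 : HasDerivAt (fun t => γ t 0) 0 0 :=
      (hasDerivAt_const (0 : ℝ) (0 : ℝ)).congr_of_eventuallyEq hK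
    exact h1.unique h2
  have hLw : L w = Complex.I • (p : C2) := by
    have h1 : HasDerivAt (fun t => ι (γ t)) (L w) 0 := by
      have h0 : HasFDerivAt ι L (γ 0) := by rw [hγ0]; exact hLd
      exact h0.comp_hasDerivAt (0 : ℝ) hγd
    have h2 : HasDerivAt (fun t : ℝ => Complex.exp (t * Complex.I) • (p : C2))
        (Complex.I • (p : C2)) 0 := by
      have h3 : HasDerivAt (fun t : ℝ => (t : ℂ) * Complex.I) Complex.I 0 := by
        simpa using (Complex.ofRealCLM.hasDerivAt (x := (0 : ℝ))).mul_const Complex.I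
      have h4 := h3.cexp.smul_const (p : C2)
      simpa using h4
    refine h1.unique (h2.congr_of_eventuallyEq ?_)
    have hc := (isSmoothFlow_hopfFlow.smooth_curve p).continuous.tendsto 0
    rw [isSmoothFlow_hopfFlow.zero] at hc
    filter_upwards [hc.eventually_mem (φ.open_source.mem_nhds hp)] with t ht
    simp only [hι, hγ, φ.left_inv ht, coe_hopfFlow]
  -- the coordinates of the transverse direction
  have hB : zTwo k (L e) = 0 := by
    have h1 : HasFDerivAt (fun u => zTwo k (ι u)) ((zTwoL k).comp L) (φ p) :=
      (zTwoL k).hasFDerivAt.comp (φ p) hLd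
    rw [h1.fderiv] at h0
    exact h0
  -- `L e` is tangent to the sphere: differentiate |z₁|² + |z₂|² = 1 at a point where z₂ = 0.
  have hA : (starRingEnd ℂ (zOne k p) * zOne k (L e)).re = 0 := by
    have hl : HasDerivAt (fun t : ℝ => φ p + t • e) e 0 := by
      simpa using ((hasDerivAt_id (0 : ℝ)).smul_const e).const_add (φ p)
    have hl2 : HasDerivAt (fun t : ℝ => ι (φ p + t • e)) (L e) 0 := by
      have h0 : HasFDerivAt ι L (φ p + (0 : ℝ) • e) := by simpa using hLd
      exact h0.comp_hasDerivAt (0 : ℝ) hl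
    have h1 : HasDerivAt (fun t : ℝ => zOne k (ι (φ p + t • e))) (zOne k (L e)) 0 :=
      (zOneL k).hasFDerivAt.comp_hasDerivAt (0 : ℝ) hl2
    have h2 : HasDerivAt (fun t : ℝ => zTwo k (ι (φ p + t • e))) (zTwo k (L e)) 0 :=
      (zTwoL k).hasFDerivAt.comp_hasDerivAt (0 : ℝ) hl2
    have a1 := Complex.reCLM.hasFDerivAt.comp_hasDerivAt (0 : ℝ) h1
    have a2 := Complex.imCLM.hasFDerivAt.comp_hasDerivAt (0 : ℝ) h1
    have b1 := Complex.reCLM.hasFDerivAt.comp_hasDerivAt (0 : ℝ) h2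
    have b2 := Complex.imCLM.hasFDerivAt.comp_hasDerivAt (0 : ℝ) h2
    have hs := ((a1.mul a1).add (a2.mul a2)).add ((b1.mul b1).add (b2.mul b2))
    have hconst : HasDerivAt (fun _ : ℝ => (1 : ℝ)) 0 0 := hasDerivAt_const _ _
    have := hs.unique (hconst.congr_of_eventuallyEq (Eventually.of_forall fun t => by
      have := normSq_coords k (φ.symm (φ p + t • e))
      simpa [Complex.normSq_apply] using this))
    simp only [Function.comp_apply, zero_smul, add_zero, hιp, hz, hB, map_zero] at this
    simp only [Complex.reCLM_apply, Complex.imCLM_apply] at this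
    simp only [Complex.mul_re, Complex.conj_re, Complex.conj_im]
    linarith
  set μ : ℝ := (starRingEnd ℂ (zOne k p) * zOne k (L e)).im with hμ
  have hn : zOne k p * starRingEnd ℂ (zOne k p) = 1 := by
    have := normSq_coords k p
    rw [hz, map_zero, add_zero] at this
    rw [Complex.mul_conj, this, Complex.ofReal_one]
  have hA' : zOne k (L e) = μ * Complex.I * zOne k p := by
    have : starRingEnd ℂ (zOne k p) * zOne k (L e) = μ * Complex.I := by
      apply Complex.ext <;> simp [hA, hμ]
    calc zOne k (L e) = zOne k p * starRingEnd ℂ (zOne k p) * zOne k (L e) := by rw [hn, one_mul]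
      _ = zOne k p * (starRingEnd ℂ (zOne k p) * zOne k (L e)) := by ring
      _ = _ := by rw [this]; ring
  -- A tangent vector without z₂-component points along the orbit. So `e` would be a multiple of the
  -- orbit direction `w`, but `w` has no first coordinate because the orbit stays in `φ x 0 = 0`.
  have hLe : L e = L (μ • w) := by
    rw [← vecOf_coords k (L e), ← vecOf_coords k (L (μ • w)), map_smul, hLw, hA', hB]
    congr 2
    · simp only [zOne, PiLp.smul_apply, smul_eq_mul, Complex.real_smul]; ring
    · have : zTwo k (μ • Complex.I • (p : C2)) = μ * Complex.I * zTwo k p := by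
        simp only [zTwo, PiLp.smul_apply, smul_eq_mul, Complex.real_smul]; ring
      rw [this, hz, mul_zero]
  have := congrArg (fun v : E3 => v 0) (hinj hLe)
  simp [he, hw0] at this

end HopfSection

namespace HopfSection
open scoped Topology
open Set Filter

/-! ### A smooth extension of the phase of the second coordinate -/

variable {d : ℕ} {S : Set Sphere3}

theorem contDiffAt_div_norm {z : ℂ} (hz : z ≠ 0) :
    ContDiffAt ℝ ∞ (fun z : ℂ => z / (‖z‖ : ℂ)) z := by
  have h1 : ContDiffAt ℝ ∞ (fun z : ℂ => (‖z‖ : ℂ)) z :=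
    Complex.ofRealCLM.contDiff.contDiffAt.comp z (contDiffAt_norm ℝ hz)
  have h2 : (‖z‖ : ℂ) ≠ 0 := by simpa using hz
  simp only [div_eq_mul_inv]
  exact contDiffAt_id.mul (h1.inv h2)

theorem norm_div_norm {z : ℂ} (hz : z ≠ 0) : ‖z / (‖z‖ : ℂ)‖ = 1 := by
  rw [norm_div, Complex.norm_real, norm_norm, div_self (norm_ne_zero_iff.2 hz)]

/-- In a half-slice chart z₂ vanishes on the boundary `φ x 0 = 0`, so on `S` it is `φ x 0` times a
smooth `G`, nonzero at `p` because z₂ vanishes there to first order only. Off the boundary `φ x 0`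
is positive on `S`, so z₂ and `G` have the same phase, and that of `G` is smooth across the
boundary. -/
theorem IsDSection.exists_local_phase (hd : 1 ≤ d) (hS : IsDSection hopfFlow d S)
    {k p : Sphere3} (hk : k ∈ surfBoundary S) (hp : p ∈ flowOrbit hopfFlow k) :
    ∃ U ∈ 𝓝 p, ∃ g : Sphere3 → ℂ, ContMDiffOn (𝓡 3) 𝓘(ℝ, ℂ) ∞ g U ∧
      ∀ y ∈ U, y ∈ S → zTwo k y ≠ 0 → g y = zTwo k y / (‖zTwo k y‖ : ℂ) := by
  obtain ⟨ε, hε, htube⟩ := hS.exists_tube hd hk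
  have hpb := hS.boundary_invariant k hk hp
  have hpz : zTwo k p = 0 := (mem_hopfOrbit_iff k p).1 hp
  obtain ⟨hpS, φ, hφ, hps, hp0⟩ := id hpb
  have hp2 : φ p 2 = 0 := ((hφ.2 p hps).1 hpS).1
  set e2 : E3 := EuclideanSpace.single 2 1 with he2
  -- Composing with the projection to the coordinate plane of `S` gives a function that agrees with
  -- `zTwo` on `S` and vanishes wherever `u 0 = 0`, not only on the boundary line. This is what
  -- Hadamard's lemma requires; the bump below makes the function global.
  set P : E3 →L[ℝ] E3 := ContinuousLinearMap.id ℝ E3 -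
    (EuclideanSpace.proj (𝕜 := ℝ) (2 : Fin 3)).smulRight e2 with hP
  have hPa : ∀ u, P u = u - u 2 • e2 := fun u => rfl
  have hP2 : ∀ u, P u 2 = 0 := fun u => by simp [hPa, he2]
  have hP0 : ∀ u, P u 0 = u 0 := fun u => by simp [hPa, he2]
  have hPid : ∀ u : E3, u 2 = 0 → P u = u := fun u hu => by simp [hPa, hu]
  set W : Set E3 := φ.target ∩ φ.symm ⁻¹' {x | ‖zTwo k x‖ < ε} with hW
  have hWo : IsOpen W := φ.isOpen_inter_preimage_symm
    (isOpen_lt (continuous_zTwo k).norm continuous_const)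
  have hWp : P (φ p) ∈ W := by
    rw [hPid _ hp2]
    refine ⟨φ.map_source hps, ?_⟩
    simp only [mem_preimage, mem_ofPred_eq, φ.left_inv hps, hpz, norm_zero, hε]
  have hUo : IsOpen (P ⁻¹' W) := hWo.preimage P.continuous
  obtain ⟨r, hr, hball⟩ := Metric.isOpen_iff.1 hUo (φ p) hWp
  let χ : ContDiffBump (φ p) := ⟨r / 3, r / 2, by positivity, by linarith⟩
  set f : E3 → ℂ := fun u => zTwo k (φ.symm (P u)) with hf
  have hfs : ∀ u, P u ∈ W → ContDiffAt ℝ ∞ f u := by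
    intro u hu
    have h1 : ContMDiffAt (𝓡 3) (𝓡 3) ∞ φ.symm (P u) :=
      contMDiffAt_symm_of_mem_maximalAtlas hφ.1 hu.1
    have h2 : ContMDiffAt (𝓡 3) 𝓘(ℝ, ℂ) ∞ (fun v => zTwo k (φ.symm v)) (P u) :=
      ContMDiffAt.comp (P u) (g := fun x : Sphere3 => zTwo k x) (contMDiff_zTwo k _) h1
    exact (contMDiffAt_iff_contDiffAt.1 h2).comp u P.contDiff.contDiffAt
  set F : E3 → ℂ := fun u => χ u • f u with hF
  have hFs : ContDiff ℝ ∞ F := by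
    rw [contDiff_iff_contDiffAt]
    intro u
    by_cases hu : dist u (φ p) < r
    · exact χ.contDiffAt.smul (hfs u (hball hu))
    · have : F =ᶠ[𝓝 u] fun _ => 0 := by
        have : ∀ᶠ v in 𝓝 u, r / 2 < dist v (φ p) :=
          (continuous_id.dist continuous_const).continuousAt.eventually (lt_mem_nhds (by
            simp only [id]; linarith))
        filter_upwards [this] with v hv
        simp only [hF, χ.zero_of_le_dist hv.le, zero_smul]
      exact contDiffAt_const.congr_of_eventuallyEq this
  obtain ⟨G, hGs, hGF, hG0⟩ := exists_smooth_quotient hFs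
    (EuclideanSpace.proj (𝕜 := ℝ) (0 : Fin 3)) (e := EuclideanSpace.single 0 1) (by simp) (by
      intro u hu
      by_cases hu' : dist u (φ p) < r
      · have hm := hball hu'
        have h1 : φ.symm (P u) ∈ surfBoundary S := by
          rw [hφ.mem_surfBoundary_iff (φ.map_target hm.1), φ.right_inv hm.1]
          exact ⟨hP2 u, by rw [hP0]; exact hu⟩
        simp only [hF, hf, htube _ hm.2 h1, smul_zero]
      · have : χ u = 0 := χ.zero_of_le_dist (by
          rw [not_lt] at hu'; exact le_trans (by simp only [χ]; linarith) hu')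
        simp only [hF, this, zero_smul])
  have hχ1 : F =ᶠ[𝓝 (φ p)] f := by
    filter_upwards [χ.eventuallyEq_one] with u hu
    simp only [hF, hu, Pi.one_apply, one_smul]
  have hGp : G (φ p) ≠ 0 := by
    rw [hG0 _ hp0, hχ1.fderiv_eq]
    have h1 : HasFDerivAt (fun v => zTwo k (φ.symm v))
        (fderiv ℝ (fun v => zTwo k (φ.symm v)) (φ p)) (P (φ p)) := by
      have hsm : ContMDiffAt (𝓡 3) (𝓡 3) ∞ φ.symm (φ p) :=
        contMDiffAt_symm_of_mem_maximalAtlas hφ.1 (φ.map_source hps)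
      have h2 : ContMDiffAt (𝓡 3) 𝓘(ℝ, ℂ) ∞ (fun v => zTwo k (φ.symm v)) (φ p) :=
        ContMDiffAt.comp (φ p) (g := fun x : Sphere3 => zTwo k x) (contMDiff_zTwo k _) hsm
      rw [hPid _ hp2]
      exact ((contMDiffAt_iff_contDiffAt.1 h2).differentiableAt (by simp)).hasFDerivAt
    have h2 := h1.comp (φ p) P.hasFDerivAt
    have h3 : fderiv ℝ f (φ p) = _ := h2.fderiv
    rw [h3, ContinuousLinearMap.comp_apply, hPid _ (by simp)]
    refine fderiv_zTwo_ne_zero hφ.1 hps hpz ?_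
    have hc := (isSmoothFlow_hopfFlow.smooth_curve p).continuous.tendsto 0
    rw [isSmoothFlow_hopfFlow.zero] at hc
    filter_upwards [hc.eventually_mem (φ.open_source.mem_nhds hps)] with t ht
    exact ((hφ.mem_surfBoundary_iff ht).1 (hS.hopfFlow_mem_surfBoundary hpb t)).2
  have hφc : ContinuousAt φ p := φ.continuousAt hps
  refine ⟨{x | x ∈ φ.source ∧ φ x ∈ Metric.ball (φ p) (r / 3) ∧ G (φ x) ≠ 0}, ?_,
    fun x => G (φ x) / (‖G (φ x)‖ : ℂ), ?_, ?_⟩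
  · have e1 : ∀ᶠ x in 𝓝 p, G (φ x) ≠ 0 :=
      (hGs.continuous.continuousAt.comp hφc).eventually_ne hGp
    filter_upwards [φ.open_source.mem_nhds hps,
      hφc.eventually_mem (Metric.ball_mem_nhds (φ p) (by positivity : 0 < r / 3)), e1]
      with x h1 h2 h3 using ⟨h1, h2, h3⟩
  · rintro x ⟨hx1, hx2, hx3⟩
    have h1 : ContMDiffAt (𝓡 3) (𝓡 3) ∞ φ x := contMDiffAt_of_mem_maximalAtlas hφ.1 hx1
    have h2 : ContDiffAt ℝ ∞ (fun u => G u / (‖G u‖ : ℂ)) (φ x) :=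
      (contDiffAt_div_norm hx3).comp (φ x) hGs.contDiffAt
    exact (ContMDiffAt.comp x (g := fun u => G u / (‖G u‖ : ℂ)) h2.contMDiffAt
      h1).contMDiffWithinAt
  · rintro x ⟨hx1, hx2, hx3⟩ hxS hxz
    obtain ⟨hx0, hxp⟩ := (hφ.2 x hx1).1 hxS
    have h1 : χ (φ x) = 1 := χ.one_of_mem_closedBall (Metric.ball_subset_closedBall hx2)
    have h2 : zTwo k x = (φ x 0 : ℝ) • G (φ x) := by
      rw [← show F (φ x) = φ x 0 • G (φ x) from hGF (φ x)]
      simp only [hF, hf, h1, one_smul, hPid _ hx0, φ.left_inv hx1]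
    have h3 : 0 < φ x 0 := lt_of_le_of_ne hxp fun h => hxz (by rw [h2, ← h, zero_smul])
    rw [h2, norm_smul, Real.norm_of_nonneg h3.le, Complex.real_smul, Complex.ofReal_mul]
    rw [mul_div_mul_left _ _ (by exact_mod_cast h3.ne')]

/-- A smooth function extending the phase of the second coordinate of the points of a section. -/
theorem IsDSection.exists_phase (hd : 1 ≤ d) (hS : IsDSection hopfFlow d S)
    {k : Sphere3} (hk : k ∈ surfBoundary S) :
    ∃ E : Sphere3 → ℂ, ContMDiff (𝓡 3) 𝓘(ℝ, ℂ) ∞ E ∧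
      (∀ y ∈ S, zTwo k y ≠ 0 → E y = zTwo k y / (‖zTwo k y‖ : ℂ)) ∧
      ∀ y : Sphere3, zTwo k y = 0 → ‖E y‖ = 1 := by
  -- At each point the condition is either void or prescribes a single value. It is thus convex, and
  -- local extensions are glued by a partition of unity.
  obtain ⟨g, hg⟩ := exists_contMDiffMap_forall_mem_convex_of_local (n := ⊤) (𝓡 3)
    (t := fun y : Sphere3 => {e : ℂ | y ∈ S → zTwo k y ≠ 0 → e = zTwo k y / (‖zTwo k y‖ : ℂ)})
    (fun y => by
      intro a ha b hb s t hs ht hst h1 h2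
      rw [ha h1 h2, hb h1 h2, ← add_smul, hst, one_smul]) (fun x => by
      by_cases hx : zTwo k x = 0
      · obtain ⟨U, hU, g, hg, h⟩ := hS.exists_local_phase hd hk ((mem_hopfOrbit_iff k x).2 hx)
        exact ⟨U, hU, g, hg, fun y hy h1 h2 => h y hy h1 h2⟩
      · refine ⟨{y | zTwo k y ≠ 0}, (continuous_zTwo k).continuousAt.eventually_ne hx,
          fun y => zTwo k y / (‖zTwo k y‖ : ℂ), fun y hy => ?_, fun y _ _ _ => rfl⟩
        exact (ContMDiffAt.comp y (contDiffAt_div_norm hy).contMDiffAt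
          (contMDiff_zTwo k y)).contMDiffWithinAt)
  have hg' : ∀ y ∈ S, zTwo k y ≠ 0 → g y = zTwo k y / (‖zTwo k y‖ : ℂ) := fun y => hg y
  refine ⟨g, g.contMDiff, hg', fun y hy => ?_⟩
  have hyb := hS.boundary_invariant k hk ((mem_hopfOrbit_iff k y).2 hy)
  -- On the boundary orbit the modulus is 1 by continuity, since each of its points is a limit of
  -- interior points of `S`.
  by_contra hne
  have hc : ContinuousAt (fun x => ‖g x‖) y := g.contMDiff.continuous.norm.continuousAt
  obtain ⟨ε, hε, htube⟩ := hS.exists_tube hd hk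
  obtain ⟨x, hx1, hx2⟩ := ((frequently_mem_surfInterior hyb).and_eventually
    (hc.eventually_ne hne)).exists
  have hxz : zTwo k x ≠ 0 := fun h => not_mem_surfBoundary_of_mem_surfInterior hx1
    (hS.boundary_invariant k hk ((mem_hopfOrbit_iff k x).2 h))
  exact hx2 (by rw [hg' x hx1.1 hxz, norm_div_norm hxz])

end HopfSection

namespace HopfSection
open scoped Topology
open Set Filter

/-! ### Angle functions near a Hopf orbit -/

theorem isSimplyConnected_univ_real : IsSimplyConnected (univ : Set ℝ) := by
  have : ContractibleSpace (univ : Set ℝ) :=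
    (Homeomorph.Set.univ ℝ).contractibleSpace_iff.2 inferInstance
  exact (inferInstance : SimplyConnectedSpace (univ : Set ℝ))

/-- A continuous periodic function of the argument is continuous off `0`. -/
theorem continuousAt_comp_arg {X : Type} [TopologicalSpace X] {g : ℝ → X} (hg : Continuous g)
    (hp : Function.Periodic g (2 * Real.pi)) {z : ℂ} (hz : z ≠ 0) :
    ContinuousAt (fun w : ℂ => g w.arg) z := by
  have h1 : Continuous (hp.lift : Real.Angle → X) := continuous_coinduced_dom.2 hg
  exact h1.continuousAt.comp (Complex.continuousAt_arg_coe_angle hz)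

theorem exists_int_of_continuous {f : ℝ → ℝ} (hf : Continuous f) (h : ∀ t, ∃ n : ℤ, f t = n) :
    ∃ n : ℤ, ∀ t, f t = n := by
  choose n hn using h
  have hnc : Continuous n := by
    rw [Int.isClosedEmbedding_coe_real.isInducing.continuous_iff]
    exact hf.congr hn
  refine ⟨n 0, fun t => ?_⟩
  rw [hn t, PreconnectedSpace.constant inferInstance hnc (x := t) (y := 0)]

theorem exp_arg_mul_I {z : ℂ} (hz : z ≠ 0) :
    Complex.exp (z.arg * Complex.I) = z / (‖z‖ : ℂ) := by
  have h : (‖z‖ : ℂ) ≠ 0 := by simpa using hz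
  rw [eq_div_iff h, mul_comm]
  exact Complex.norm_mul_exp_arg_mul_I z

/-- A loop in the circle has a degree. -/
theorem exists_degree {e : ℝ → ℂ} (he : Continuous e) (hp : Function.Periodic e (2 * Real.pi))
    (h1 : ∀ t, ‖e t‖ = 1) :
    ∃ (n : ℤ) (h : ℝ → ℝ), Continuous h ∧ Function.Periodic h (2 * Real.pi) ∧
      ∀ t : ℝ, Complex.exp (h t * Complex.I) * Complex.exp (t * Complex.I) ^ n = e t := by
  have hπ := Real.pi_pos
  -- A continuous logarithm on the line grows over each period by one and the same multiple of 2π;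
  -- subtracting the corresponding linear term leaves a periodic angle.
  obtain ⟨F, hFc, hF⟩ := Complex.exists_continuousOn_eqOn_exp_comp isSimplyConnected_univ_real
    isOpen_univ he.continuousOn (by
      rintro ⟨t, -, ht⟩
      have := h1 t
      rw [ht, norm_zero] at this
      exact zero_ne_one this)
  rw [continuousOn_univ] at hFc
  have hFe : ∀ t, Complex.exp (F t) = e t := fun t => hF (mem_univ t)
  have hre : ∀ t, F t = (F t).im * Complex.I := by
    intro t
    have : Real.exp (F t).re = 1 := by rw [← Complex.norm_exp, hFe, h1]
    have := (Real.exp_eq_one_iff _).1 this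
    apply Complex.ext <;> simp [this]
  have hexp : ∀ t, Complex.exp ((F t).im * Complex.I) = e t := fun t => by rw [← hre, hFe]
  obtain ⟨n, hn⟩ := exists_int_of_continuous
    (f := fun t => ((F (t + 2 * Real.pi)).im - (F t).im) / (2 * Real.pi)) (by fun_prop) (by
      intro t
      have h2 : Complex.exp ((F (t + 2 * Real.pi)).im * Complex.I) =
          Complex.exp ((F t).im * Complex.I) := by rw [hexp, hexp, hp]
      obtain ⟨n, hn⟩ := Complex.exp_eq_exp_iff_exists_int.1 h2
      refine ⟨n, ?_⟩
      have := congrArg Complex.im hn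
      simp at this
      rw [this]
      field_simp
      ring)
  have hn' : ∀ t, (F (t + 2 * Real.pi)).im = (F t).im + n * (2 * Real.pi) := by
    intro t
    have := hn t
    rw [div_eq_iff (by positivity)] at this
    linarith
  refine ⟨n, fun t => (F t).im - n * t, by fun_prop, fun t => ?_, fun t => ?_⟩
  · simp only [hn']; ring
  · rw [← hexp, ← Complex.exp_int_mul, ← Complex.exp_add]
    congr 1
    push_cast
    ring

theorem contDiffAt_zpow (n : ℤ) {z : ℂ} (hz : z ≠ 0) :
    ContDiffAt ℝ ∞ (fun w : ℂ => w ^ n) z := by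
  cases n with
  | ofNat n =>
    simp only [Int.ofNat_eq_natCast, zpow_natCast]
    fun_prop
  | negSucc n =>
    simp only [zpow_negSucc]
    exact ContDiffAt.inv (by fun_prop) (pow_ne_zero _ hz)

/-- A continuous function with smooth exponential is smooth. -/
theorem contMDiffAt_of_exp {β : Sphere3 → ℝ} {x0 : Sphere3} (hβ : ContinuousAt β x0)
    {w : Sphere3 → ℂ} (hw : ContMDiffAt (𝓡 3) 𝓘(ℝ, ℂ) ∞ w x0)
    (h : ∀ᶠ x in 𝓝 x0, Complex.exp (β x * Complex.I) = w x) :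
    ContMDiffAt (𝓡 3) 𝓘(ℝ, ℝ) ∞ β x0 := by
  -- The branch of the angle centred at `β x0`. It recovers `β x` from its exponential while `β x`
  -- is within 1, hence within π, of `β x0`.
  set K : ℂ → ℝ := fun z =>
    β x0 + (Complex.log (Complex.exp (-(β x0 * Complex.I)) * z)).im with hK
  have hK1 : Complex.exp (-(β x0 * Complex.I)) * w x0 = 1 := by
    rw [← h.self_of_nhds, ← Complex.exp_add, neg_add_cancel, Complex.exp_zero]
  have hKs : ContDiffAt ℝ ∞ K (w x0) := by
    have h1 : ContDiffAt ℝ ∞ Complex.log (Complex.exp (-(β x0 * Complex.I)) * w x0) := by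
      rw [hK1]
      exact (Complex.contDiffAt_log (by simp)).restrict_scalars ℝ
    exact contDiffAt_const.add (Complex.imCLM.contDiff.contDiffAt.comp _
      (h1.comp (w x0) (contDiffAt_const.mul contDiffAt_id)))
  refine (ContMDiffAt.comp x0 hKs.contMDiffAt hw).congr_of_eventuallyEq ?_
  have hπ := Real.pi_gt_three
  have hd : ∀ᶠ x in 𝓝 x0, dist (β x) (β x0) < 1 :=
    hβ.eventually (Metric.ball_mem_nhds _ one_pos)
  filter_upwards [h, hd] with x hx hdx
  rw [Real.dist_eq, abs_lt] at hdx
  simp only [Function.comp_apply, hK, ← hx]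
  rw [← Complex.exp_add, ← neg_mul, ← add_mul, Complex.log_exp]
  · simp
  · simp; linarith
  · simp; linarith

/-- A smooth function of modulus one on a Hopf orbit has a smooth angle near this orbit. -/
theorem exists_angle (k : Sphere3) {E : Sphere3 → ℂ} (hE : ContMDiff (𝓡 3) 𝓘(ℝ, ℂ) ∞ E)
    (h1 : ∀ y : Sphere3, zTwo k y = 0 → ‖E y‖ = 1) :
    ∃ (n : ℤ) (β : Sphere3 → ℝ), ∃ ε > 0, ∀ x : Sphere3, ‖zTwo k x‖ < ε →
      zOne k x ≠ 0 ∧ ContMDiffAt (𝓡 3) 𝓘(ℝ, ℝ) ∞ β x ∧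
      Complex.exp (β x * Complex.I) * (zOne k x / (‖zOne k x‖ : ℂ)) ^ n = E x / (‖E x‖ : ℂ) := by
  have hEc := hE.continuous
  set e : ℝ → ℂ := fun t => E (hopfFlow t k) with he
  have hec : Continuous e := hEc.comp (isSmoothFlow_hopfFlow.smooth_curve k).continuous
  have hep : Function.Periodic e (2 * Real.pi) := fun t => by
    simp only [he, hopfFlow_add_two_pi]
  have he1 : ∀ t, ‖e t‖ = 1 := fun t => h1 _ (by rw [zTwo_hopfFlow, zTwo_self, mul_zero])
  have he0 : ∀ t, e t ≠ 0 := fun t h => by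
    have := he1 t
    rw [h, norm_zero] at this
    exact zero_ne_one this
  obtain ⟨n, h, hc, hp, hh⟩ := exists_degree hec hep he1
  -- The first term is the angle on the orbit of `k`, carried over from the orbit point with the
  -- same direction of `zOne`. The second corrects it by the argument of the ratio of the values of
  -- `E` at `x` and at that point, a ratio equal to 1 on the orbit and in the slit plane nearby.
  set β : Sphere3 → ℝ := fun x =>
    h (zOne k x).arg + (E x / e (zOne k x).arg).arg with hβ
  have hcomp : ∀ {X : Type} [TopologicalSpace X] {g : ℝ → X}, Continuous g →
      Function.Periodic g (2 * Real.pi) → ∀ {x : Sphere3}, zOne k x ≠ 0 →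
      ContinuousAt (fun y : Sphere3 => g (zOne k y).arg) x := fun {_ _ g} hg hp {x} hx =>
    ContinuousAt.comp (g := fun w : ℂ => g w.arg) (f := fun y : Sphere3 => zOne k y)
      (continuousAt_comp_arg hg hp hx) (continuous_zOne k).continuousAt
  have hratio : ∀ x : Sphere3, zOne k x ≠ 0 →
      ContinuousAt (fun y => E y / e (zOne k y).arg) x := fun x hx =>
    hEc.continuousAt.div (hcomp hec hep hx) (he0 _)
  obtain ⟨ε, hε, hP⟩ := exists_tube_subset k
    (P := fun x => zOne k x ≠ 0 ∧ E x / e (zOne k x).arg ∈ Complex.slitPlane) (by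
      rintro _ ⟨t, rfl⟩
      have hz : zOne k (hopfFlow t k) = Complex.exp (t * Complex.I) := by
        rw [zOne_hopfFlow, zOne_self, mul_one]
      have hz0 : zOne k (hopfFlow t k) ≠ 0 := by rw [hz]; exact Complex.exp_ne_zero _
      have hcore : hopfFlow (zOne k (hopfFlow t k)).arg k = hopfFlow t k := by
        apply sphere3_ext k
        · rw [zOne_hopfFlow, zOne_self, mul_one, exp_arg_mul_I hz0, hz,
            Complex.norm_exp_ofReal_mul_I, Complex.ofReal_one, div_one]
        · simp only [zTwo_hopfFlow, zTwo_self, mul_zero]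
      have hval : E (hopfFlow t k) / e (zOne k (hopfFlow t k)).arg = 1 := by
        simp only [he, hcore]
        exact div_self (he0 t)
      have e1 := (continuous_zOne k).continuousAt.eventually_ne hz0
      have e2 := (hratio _ hz0).eventually_mem (Complex.isOpen_slitPlane.mem_nhds (by
        rw [hval]; simp))
      exact e1.and e2)
  have hexp : ∀ x : Sphere3, ‖zTwo k x‖ < ε →
      Complex.exp (β x * Complex.I) * (zOne k x / (‖zOne k x‖ : ℂ)) ^ n =
        E x / (‖E x‖ : ℂ) := by
    intro x hx
    obtain ⟨hz, hr⟩ := hP x hx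
    rw [← exp_arg_mul_I hz]
    simp only [hβ]
    rw [Complex.ofReal_add, add_mul, Complex.exp_add, mul_right_comm, hh,
      exp_arg_mul_I (Complex.slitPlane_ne_zero hr), norm_div, he1, div_one]
    field_simp [he0 (zOne k (x : C2)).arg]
  refine ⟨n, β, ε, hε, fun x hx => ⟨(hP x hx).1, ?_, hexp x hx⟩⟩
  obtain ⟨hz, hr⟩ := hP x hx
  have hE0 : E x ≠ 0 := fun h0 => by
    apply Complex.slitPlane_ne_zero hr
    rw [h0, zero_div]
  have hβc : ContinuousAt β x :=
    (hcomp hc hp hz).add (ContinuousAt.comp (g := Complex.arg)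
      (f := fun y : Sphere3 => E y / e (zOne k y).arg) (Complex.continuousAt_arg hr) (hratio x hz))
  have hK : ContDiffAt ℝ ∞ (fun q : ℂ × ℂ => q.2 / (‖q.2‖ : ℂ) * ((q.1 / (‖q.1‖ : ℂ)) ^ n)⁻¹)
      (zOne k x, E x) := by
    have h1 : (zOne k x / (‖zOne k x‖ : ℂ)) ≠ 0 := by
      rw [← norm_ne_zero_iff, norm_div_norm hz]; exact one_ne_zero
    have h2 : ContDiffAt ℝ ∞ (fun z : ℂ => (z / (‖z‖ : ℂ)) ^ n) (zOne k x) :=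
      ContDiffAt.comp (g := fun w : ℂ => w ^ n) (f := fun z : ℂ => z / (‖z‖ : ℂ))
        (zOne k (x : C2)) (contDiffAt_zpow n h1) (contDiffAt_div_norm hz)
    have h3 : ContDiffAt ℝ ∞ (fun z : ℂ => ((z / (‖z‖ : ℂ)) ^ n)⁻¹) (zOne k x) :=
      h2.inv (zpow_ne_zero _ h1)
    exact ((contDiffAt_div_norm hE0).comp (zOne k (x : C2), E x) contDiffAt_snd).mul
      (h3.comp (zOne k (x : C2), E x) contDiffAt_fst)
  have hw : ContMDiffAt (𝓡 3) 𝓘(ℝ, ℂ) ∞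
      (fun x : Sphere3 => E x / (‖E x‖ : ℂ) * ((zOne k x / (‖zOne k x‖ : ℂ)) ^ n)⁻¹) x :=
    ContMDiffAt.comp x hK.contMDiffAt ((contMDiff_zOne k x).prodMk_space (hE x))
  refine contMDiffAt_of_exp hβc hw ?_
  have hev : ∀ᶠ y : Sphere3 in 𝓝 x, ‖zTwo k y‖ < ε :=
    (continuous_zTwo k).norm.continuousAt.eventually (gt_mem_nhds hx)
  filter_upwards [hev] with y hy
  have h1 : (zOne k y / (‖zOne k y‖ : ℂ)) ^ n ≠ 0 := by
    apply zpow_ne_zero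
    rw [← norm_ne_zero_iff, norm_div_norm (hP y hy).1]; exact one_ne_zero
  rw [← hexp y hy, mul_assoc, mul_inv_cancel₀ h1, mul_one]

end HopfSection

namespace HopfSection
open scoped Topology
open Set Filter

/-! ### Sections near their boundary in angular coordinates -/

variable {d : ℕ} {S : Set Sphere3} {k : Sphere3} {n : ℤ} {β : Sphere3 → ℝ} {ε : ℝ}

/-- The direction of the first coordinate relative to `k`. -/
def dirOne (k : Sphere3) (x : C2) : ℂ := zOne k x / (‖zOne k x‖ : ℂ)

/-- The direction of the second coordinate relative to `k`. -/
def dirTwo (k : Sphere3) (x : C2) : ℂ := zTwo k x / (‖zTwo k x‖ : ℂ)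

theorem norm_zOne_hopfFlow (k : Sphere3) (t : ℝ) (x : Sphere3) :
    ‖zOne k (hopfFlow t x)‖ = ‖zOne k x‖ := by
  rw [zOne_hopfFlow, norm_mul, Complex.norm_exp_ofReal_mul_I, one_mul]

theorem dirOne_hopfFlow (k : Sphere3) (t : ℝ) (x : Sphere3) :
    dirOne k (hopfFlow t x) = Complex.exp (t * Complex.I) * dirOne k x := by
  simp only [dirOne, norm_zOne_hopfFlow]
  rw [zOne_hopfFlow, mul_div_assoc]

theorem dirTwo_hopfFlow (k : Sphere3) (t : ℝ) (x : Sphere3) :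
    dirTwo k (hopfFlow t x) = Complex.exp (t * Complex.I) * dirTwo k x := by
  simp only [dirTwo, norm_zTwo_hopfFlow]
  rw [zTwo_hopfFlow, mul_div_assoc]

theorem dirOne_rotFlow (k : Sphere3) (t : ℝ) (x : Sphere3) :
    dirOne k (rotFlow k t x) = dirOne k x := by
  simp only [dirOne, zOne_rotFlow]

theorem dirTwo_rotFlow (k : Sphere3) (t : ℝ) (x : Sphere3) :
    dirTwo k (rotFlow k t x) = Complex.exp (t * Complex.I) * dirTwo k x := by
  simp only [dirTwo, norm_zTwo_rotFlow]
  rw [zTwo_rotFlow, mul_div_assoc]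

theorem norm_dirOne {x : C2} (h : zOne k x ≠ 0) : ‖dirOne k x‖ = 1 := norm_div_norm h

theorem norm_dirTwo {x : C2} (h : zTwo k x ≠ 0) : ‖dirTwo k x‖ = 1 := norm_div_norm h

theorem dirOne_ne_zero {x : C2} (h : zOne k x ≠ 0) : dirOne k x ≠ 0 := by
  rw [← norm_ne_zero_iff, norm_dirOne h]; exact one_ne_zero

theorem dirTwo_ne_zero {x : C2} (h : zTwo k x ≠ 0) : dirTwo k x ≠ 0 := by
  rw [← norm_ne_zero_iff, norm_dirTwo h]; exact one_ne_zero

/-- In the tube of radius `ε` around its boundary orbit through `k`, the section `S` is given by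
`dirTwo = exp (iβ) dirOne ^ n`. -/
structure IsAngle (S : Set Sphere3) (k : Sphere3) (n : ℤ) (β : Sphere3 → ℝ) (ε : ℝ) : Prop where
  pos : 0 < ε
  zOne_ne_zero : ∀ x : Sphere3, ‖zTwo k x‖ < ε → zOne k x ≠ 0
  smooth : ∀ x : Sphere3, ‖zTwo k x‖ < ε → ContMDiffAt (𝓡 3) 𝓘(ℝ, ℝ) ∞ β x
  lt_one : ∀ x : Sphere3, ‖zTwo k x‖ < ε → |flowDeriv (rotFlow k) β x| < 1
  mem_iff : ∀ x : Sphere3, ‖zTwo k x‖ < ε → (x ∈ surfBoundary S ↔ zTwo k x = 0)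
  dirTwo_eq : ∀ x : Sphere3, ‖zTwo k x‖ < ε → x ∈ S → zTwo k x ≠ 0 →
    Complex.exp (β x * Complex.I) * dirOne k x ^ n = dirTwo k x

theorem IsAngle.mono (h : IsAngle S k n β ε) {ε' : ℝ} (h0 : 0 < ε') (hle : ε' ≤ ε) :
    IsAngle S k n β ε' where
  pos := h0
  zOne_ne_zero x hx := h.zOne_ne_zero x (hx.trans_le hle)
  smooth x hx := h.smooth x (hx.trans_le hle)
  lt_one x hx := h.lt_one x (hx.trans_le hle)
  mem_iff x hx := h.mem_iff x (hx.trans_le hle)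
  dirTwo_eq x hx := h.dirTwo_eq x (hx.trans_le hle)

theorem rotFlow_eq_self {x : Sphere3} (h : zTwo k x = 0) (t : ℝ) : rotFlow k t x = x := by
  apply sphere3_ext k
  · rw [zOne_rotFlow]
  · rw [zTwo_rotFlow, h, mul_zero]

/-- The rotation fixes the orbit of `k` pointwise, so the derivative of `β` along it vanishes there
and is small in a thin tube; on `S` the extended function `E` is already the phase of z₂. -/
theorem IsDSection.exists_isAngle (hd : 1 ≤ d) (hS : IsDSection hopfFlow d S)
    (hk : k ∈ surfBoundary S) : ∃ n β ε, IsAngle S k n β ε := by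
  obtain ⟨E, hE, hES, hE1⟩ := hS.exists_phase hd hk
  obtain ⟨n, β, ε, hε, h⟩ := exists_angle k hE hE1
  obtain ⟨ε', hε', h'⟩ := hS.exists_tube hd hk
  obtain ⟨δ, hδ, hP⟩ := exists_tube_subset k
    (P := fun x => |flowDeriv (rotFlow k) β x| < 1) (by
      intro x hx
      have hx0 := (mem_hopfOrbit_iff k x).1 hx
      have h0 : flowDeriv (rotFlow k) β x = 0 := by
        simp only [flowDeriv, rotFlow_eq_self hx0, deriv_const]
      have hc := ((isSmoothFlow_rotFlow k).continuousAt_flowDeriv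
        (h x (by rw [hx0, norm_zero]; exact hε)).2.1).abs
      refine hc.eventually (gt_mem_nhds ?_)
      simp only [h0, abs_zero, one_pos])
  refine ⟨n, β, min ε (min ε' δ), lt_min hε (lt_min hε' hδ), fun x hx => ?_, fun x hx => ?_,
    fun x hx => ?_, fun x hx => ⟨fun hb => ?_, fun h0 => ?_⟩, fun x hx hxS hx0 => ?_⟩
  · exact (h x (lt_min_iff.1 hx).1).1
  · exact (h x (lt_min_iff.1 hx).1).2.1
  · exact hP x (lt_min_iff.1 (lt_min_iff.1 hx).2).2
  · exact h' x (lt_min_iff.1 (lt_min_iff.1 hx).2).1 hb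
  · exact hS.boundary_invariant k hk ((mem_hopfOrbit_iff k x).2 h0)
  · have h1 := (h x (lt_min_iff.1 hx).1).2.2
    rw [hES x hxS hx0, norm_div_norm hx0, Complex.ofReal_one, div_one] at h1
    exact h1

/-- The defining function of a section in angular coordinates. -/
def angleFun (k : Sphere3) (n : ℤ) (β : Sphere3 → ℝ) (x : Sphere3) : ℝ :=
  (Complex.exp (β x * Complex.I) * dirOne k x ^ n * starRingEnd ℂ (dirTwo k x)).im

theorem contMDiffAt_angleFun {x : Sphere3} (hβ : ContMDiffAt (𝓡 3) 𝓘(ℝ, ℝ) ∞ β x)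
    (h1 : zOne k x ≠ 0) (h2 : zTwo k x ≠ 0) :
    ContMDiffAt (𝓡 3) 𝓘(ℝ, ℝ) ∞ (angleFun k n β) x := by
  set K : ℝ × ℂ × ℂ → ℝ := fun q => (Complex.exp (q.1 * Complex.I) *
    (q.2.1 / (‖q.2.1‖ : ℂ)) ^ n * starRingEnd ℂ (q.2.2 / (‖q.2.2‖ : ℂ))).im with hK
  have hKs : ContDiffAt ℝ ∞ K (β x, zOne k x, zTwo k x) := by
    have e1 : ContDiffAt ℝ ∞ (fun q : ℝ × ℂ × ℂ => Complex.exp (q.1 * Complex.I))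
        (β x, zOne k x, zTwo k x) := (contDiff_exp_mul_I.comp contDiff_fst).contDiffAt
    have e2 : ContDiffAt ℝ ∞ (fun q : ℝ × ℂ × ℂ => (q.2.1 / (‖q.2.1‖ : ℂ)) ^ n)
        (β x, zOne k x, zTwo k x) := by
      have a1 : ContDiffAt ℝ ∞ (fun z : ℂ => (z / (‖z‖ : ℂ)) ^ n) (zOne k x) :=
        ContDiffAt.comp (g := fun w : ℂ => w ^ n) (f := fun z : ℂ => z / (‖z‖ : ℂ))
          (zOne k (x : C2)) (contDiffAt_zpow n (dirOne_ne_zero h1)) (contDiffAt_div_norm h1)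
      exact ContDiffAt.comp (g := fun z : ℂ => (z / (‖z‖ : ℂ)) ^ n)
        (f := fun q : ℝ × ℂ × ℂ => q.2.1) _ a1 (contDiff_fst.comp contDiff_snd).contDiffAt
    have e3 : ContDiffAt ℝ ∞ (fun q : ℝ × ℂ × ℂ => starRingEnd ℂ (q.2.2 / (‖q.2.2‖ : ℂ)))
        (β x, zOne k x, zTwo k x) := by
      have a1 : ContDiffAt ℝ ∞ (fun z : ℂ => starRingEnd ℂ (z / (‖z‖ : ℂ))) (zTwo k x) :=
        Complex.conjCLE.contDiff.contDiffAt.comp _ (contDiffAt_div_norm h2)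
      exact ContDiffAt.comp (g := fun z : ℂ => starRingEnd ℂ (z / (‖z‖ : ℂ)))
        (f := fun q : ℝ × ℂ × ℂ => q.2.2) _ a1 (contDiff_snd.comp contDiff_snd).contDiffAt
    exact Complex.imCLM.contDiff.contDiffAt.comp _ ((e1.mul e2).mul e3)
  exact ContMDiffAt.comp x (g := K) (f := fun y : Sphere3 => (β y, zOne k y, zTwo k y))
    hKs.contMDiffAt (hβ.prodMk_space ((contMDiff_zOne k x).prodMk_space (contMDiff_zTwo k x)))

/-- Since `p` lies on `S`, `angleFun` along `Θ` is the sine of `β (Θ t p) - β p + (a * n - 1) * t`.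
The rate `a` of the first direction is 1 for the Hopf flow and 0 for the rotation. -/
theorem IsAngle.deriv_angleFun (h : IsAngle S k n β ε) {p : Sphere3} (hp : ‖zTwo k p‖ < ε)
    (hpS : p ∈ S) (hp0 : zTwo k p ≠ 0) {Θ : ℝ → Sphere3 → Sphere3} (hΘ : IsSmoothFlow Θ) (a : ℝ)
    (h1 : ∀ t, dirOne k (Θ t p) = Complex.exp ((a * t : ℝ) * Complex.I) * dirOne k p)
    (h2 : ∀ t, dirTwo k (Θ t p) = Complex.exp (t * Complex.I) * dirTwo k p) :
    deriv (fun t => angleFun k n β (Θ t p)) 0 = flowDeriv Θ β p + a * n - 1 := by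
  have e : ∀ t, angleFun k n β (Θ t p) = Real.sin (β (Θ t p) - β p + (a * n - 1) * t) := by
    intro t
    have hv := h.dirTwo_eq p hp hpS hp0
    have hvv : dirTwo k p * starRingEnd ℂ (dirTwo k p) = 1 := by
      rw [Complex.mul_conj, Complex.normSq_eq_norm_sq, norm_dirTwo hp0]; simp
    have hu : dirOne k p ^ n = Complex.exp (-(β p * Complex.I)) * dirTwo k p := by
      rw [← hv, ← mul_assoc, ← Complex.exp_add, neg_add_cancel, Complex.exp_zero, one_mul]
    have : Complex.exp (β (Θ t p) * Complex.I) * dirOne k (Θ t p) ^ n *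
        starRingEnd ℂ (dirTwo k (Θ t p)) =
        Complex.exp ((β (Θ t p) - β p + (a * n - 1) * t : ℝ) * Complex.I) := by
      rw [h1, h2, mul_zpow, hu, map_mul, ← Complex.exp_conj, map_mul, Complex.conj_I,
        Complex.conj_ofReal, ← Complex.exp_int_mul]
      calc _ = Complex.exp (β (Θ t p) * Complex.I) *
            Complex.exp (n * ((a * t : ℝ) * Complex.I)) * Complex.exp (-(β p * Complex.I)) *
            Complex.exp (t * -Complex.I) * (dirTwo k p * starRingEnd ℂ (dirTwo k p)) := by ring
        _ = _ := by
          rw [hvv, mul_one, ← Complex.exp_add, ← Complex.exp_add, ← Complex.exp_add]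
          congr 1
          push_cast
          ring
    rw [angleFun, this, Complex.exp_ofReal_mul_I_im]
  have hd : HasDerivAt (fun t => β (Θ t p)) (flowDeriv Θ β p) 0 := by
    have := hΘ.hasDerivAt (f := β) (t0 := 0) (x0 := p) (by rw [hΘ.zero]; exact h.smooth p hp)
    rwa [hΘ.zero] at this
  have h3 : HasDerivAt (fun t : ℝ => (a * n - 1) * t) (a * n - 1) 0 := by
    simpa using (hasDerivAt_id (0 : ℝ)).const_mul (a * n - 1)
  have h4 := ((hd.sub_const (β p)).add h3).sin
  have h5 : HasDerivAt (fun t => angleFun k n β (Θ t p)) (flowDeriv Θ β p + (a * n - 1)) 0 := by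
    refine (h4.congr_deriv ?_).congr_of_eventuallyEq (Eventually.of_forall e)
    simp [hΘ.zero]
  rw [h5.deriv]
  ring

/-- The normal speeds of the Hopf flow and of the rotation in angular coordinates. -/
theorem IsAngle.exists_mul_normalSpeed (h : IsAngle S k n β ε)
    {φ : OpenPartialHomeomorph Sphere3 E3} (hφ : IsSliceChart S φ) {p : Sphere3}
    (hp : p ∈ φ.source) (hpS : p ∈ S) (hpε : ‖zTwo k p‖ < ε) :
    ∃ l : ℝ, l * normalSpeed φ (fun t => hopfFlow t p) = flowDeriv hopfFlow β p + (n - 1) ∧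
      l * normalSpeed φ (fun t => rotFlow k t p) = flowDeriv (rotFlow k) β p - 1 := by
  have hp0 : ∀ x ∈ S, (∃ φ, IsSliceChart S φ ∧ x ∈ φ.source) → ‖zTwo k x‖ < ε →
      zTwo k x ≠ 0 := fun x hxS hx hxε h0 =>
    not_mem_surfBoundary_of_mem_surfInterior ⟨hxS, hx⟩ ((h.mem_iff x hxε).2 h0)
  have hz := hp0 p hpS ⟨φ, hφ, hp⟩ hpε
  -- `angleFun` vanishes on `S`, so its derivatives along both flows are the normal speeds times one
  -- common factor.
  obtain ⟨l, hl⟩ := hφ.exists_deriv_eq_mul_normalSpeed hp hpS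
    (contMDiffAt_angleFun (n := n) (h.smooth p hpε) (h.zOne_ne_zero p hpε) hz) (by
      have : ∀ᶠ x : Sphere3 in 𝓝 p, ‖zTwo k x‖ < ε :=
        (continuous_zTwo k).norm.continuousAt.eventually (gt_mem_nhds hpε)
      filter_upwards [this, φ.open_source.mem_nhds hp] with x hx hxφ hxS
      have hx0 := hp0 x hxS ⟨φ, hφ, hxφ⟩ hx
      rw [angleFun, h.dirTwo_eq x hx hxS hx0, Complex.mul_conj]
      exact Complex.ofReal_im _)
  refine ⟨l, ?_, ?_⟩
  · rw [← hl _ (isSmoothFlow_hopfFlow.zero p)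
      ((isSmoothFlow_hopfFlow.smooth_curve p).mdifferentiableAt (by simp)),
      h.deriv_angleFun hpε hpS hz isSmoothFlow_hopfFlow 1 (fun t => by
        rw [one_mul, dirOne_hopfFlow]) (fun t => dirTwo_hopfFlow k t p)]
    ring
  · rw [← hl _ ((isSmoothFlow_rotFlow k).zero p)
      (((isSmoothFlow_rotFlow k).smooth_curve p).mdifferentiableAt (by simp)),
      h.deriv_angleFun hpε hpS hz (isSmoothFlow_rotFlow k) 0 (fun t => by
        simp [dirOne_rotFlow]) (fun t => dirTwo_rotFlow k t p)]
    ring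

/-- The derivative along the flow of the function defining a section in angular coordinates. -/
def angleSpeed (n : ℤ) (β : Sphere3 → ℝ) (x : Sphere3) : ℝ := flowDeriv hopfFlow β x + (n - 1)

/-- The common factor is nonzero because the derivative along the rotation, `flowDeriv (rotFlow k) β
p - 1`, is negative. So transversality to the Hopf flow is exactly what excludes a zero. -/
theorem IsAngle.angleSpeed_ne_zero (hS : IsDSection hopfFlow d S) (h : IsAngle S k n β ε)
    {p : Sphere3} (hp : p ∈ surfInterior S) (hpε : ‖zTwo k p‖ < ε) : angleSpeed n β p ≠ 0 := by
  obtain ⟨hpS, φ, hφ, hpφ⟩ := hp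
  obtain ⟨l, h1, h2⟩ := h.exists_mul_normalSpeed hφ hpφ hpS hpε
  rw [angleSpeed, ← h1]
  refine mul_ne_zero (fun h0 => ?_) (hS.transverse φ hφ p hpφ hpS)
  rw [h0, zero_mul] at h2
  have := (abs_lt.1 (h.lt_one p hpε)).2
  linarith

theorem IsAngle.continuousAt_angleSpeed (h : IsAngle S k n β ε) {p : Sphere3}
    (hpε : ‖zTwo k p‖ < ε) : ContinuousAt (angleSpeed n β) p :=
  (isSmoothFlow_hopfFlow.continuousAt_flowDeriv (h.smooth p hpε)).add continuousAt_const

/-- In a half-slice chart the interior points near `p` fill a half-disc. It is convex, hence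
connected, and a continuous function without zeros has one sign on it. -/
theorem IsAngle.exists_local_sign (hS : IsDSection hopfFlow d S) (h : IsAngle S k n β ε)
    {p : Sphere3} (hp : zTwo k p = 0) :
    (∀ᶠ x in 𝓝 p, x ∈ S → zTwo k x ≠ 0 → 0 < angleSpeed n β x) ∨
      ∀ᶠ x in 𝓝 p, x ∈ S → zTwo k x ≠ 0 → angleSpeed n β x < 0 := by
  have hpε : ‖zTwo k p‖ < ε := by rw [hp, norm_zero]; exact h.pos
  obtain ⟨hpS, φ, hφ, hps, hp0⟩ := (h.mem_iff p hpε).2 hp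
  set W : Set E3 := φ.target ∩ φ.symm ⁻¹' {x | ‖zTwo k x‖ < ε} with hW
  have hWo : IsOpen W := φ.isOpen_inter_preimage_symm
    (isOpen_lt (continuous_zTwo k).norm continuous_const)
  have hWp : φ p ∈ W := by
    refine ⟨φ.map_source hps, ?_⟩
    simp only [mem_preimage, mem_ofPred_eq, φ.left_inv hps, hpε]
  obtain ⟨r, hr, hball⟩ := Metric.isOpen_iff.1 hWo (φ p) hWp
  set A : Set E3 := Metric.ball (φ p) r ∩ {v | 0 < v 0 ∧ v 2 = 0} with hA
  have hAc : Convex ℝ A := by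
    refine (convex_ball _ _).inter fun v hv w hw a b ha hb hab => ?_
    refine ⟨?_, ?_⟩
    · have : (a • v + b • w) 0 = a * v 0 + b * w 0 := rfl
      rw [this]
      rcases ha.eq_or_lt with h0 | h0
      · have hb1 : b = 1 := by linarith
        rw [← h0, hb1]; linarith [hw.1]
      · have := mul_pos h0 hv.1
        have := mul_nonneg hb hw.1.le
        linarith
    · have : (a • v + b • w) 2 = a * v 2 + b * w 2 := rfl
      rw [this, hv.2, hw.2]; simp
  have hAi : ∀ u ∈ A, φ.symm u ∈ surfInterior S ∧ ‖zTwo k (φ.symm u)‖ < ε := by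
    rintro u ⟨hu, hu0, hu2⟩
    have huW := hball hu
    refine ⟨hφ.mem_surfInterior (φ.map_target huW.1) ((hφ.2 _ (φ.map_target huW.1)).2 ?_) ?_,
      huW.2⟩
    · rw [φ.right_inv huW.1]; exact ⟨hu2, hu0.le⟩
    · rw [φ.right_inv huW.1]; exact hu0
  have hcont : ContinuousOn (fun u => angleSpeed n β (φ.symm u)) A := by
    intro u hu
    have h1 : ContinuousAt φ.symm u := φ.symm.continuousAt (hball hu.1).1
    exact (ContinuousAt.comp (g := angleSpeed n β)
      (h.continuousAt_angleSpeed (hAi u hu).2) h1).continuousWithinAt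
  have hne : ∀ u ∈ A, angleSpeed n β (φ.symm u) ≠ 0 := fun u hu =>
    h.angleSpeed_ne_zero hS (hAi u hu).1 (hAi u hu).2
  have hev : ∀ᶠ x in 𝓝 p, x ∈ S → zTwo k x ≠ 0 → φ x ∈ A ∧ φ.symm (φ x) = x := by
    have e1 : ∀ᶠ x : Sphere3 in 𝓝 p, ‖zTwo k x‖ < ε :=
      (continuous_zTwo k).norm.continuousAt.eventually (gt_mem_nhds hpε)
    filter_upwards [φ.open_source.mem_nhds hps, e1,
      (φ.continuousAt hps).eventually_mem (Metric.ball_mem_nhds (φ p) hr)] with x h1 h2 h3 hxS hx0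
    obtain ⟨h4, h5⟩ := (hφ.2 x h1).1 hxS
    refine ⟨⟨h3, lt_of_le_of_ne h5 fun h6 => hx0 ?_, h4⟩, φ.left_inv h1⟩
    exact (h.mem_iff x h2).1 ((hφ.mem_surfBoundary_iff h1).2 ⟨h4, h6.symm⟩)
  by_cases hex : ∃ u ∈ A, angleSpeed n β (φ.symm u) < 0
  · obtain ⟨u, hu, hu0⟩ := hex
    right
    filter_upwards [hev] with x hx hxS hx0
    obtain ⟨h1, h2⟩ := hx hxS hx0
    by_contra hlt
    obtain ⟨v, hv, hv0⟩ := hAc.isPreconnected.intermediate_value hu h1 hcont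
      (show (0 : ℝ) ∈ Icc _ _ from ⟨hu0.le, by rw [h2]; exact not_lt.1 hlt⟩)
    exact hne v hv hv0
  · left
    push Not at hex
    filter_upwards [hev] with x hx hxS hx0
    obtain ⟨h1, h2⟩ := hx hxS hx0
    have h3 := hex _ h1
    have h4 := hne _ h1
    rw [h2] at h3 h4
    exact lt_of_le_of_ne h3 h4.symm

/-- Near the boundary orbit, the Hopf flow turns around it in a constant sense. -/
theorem IsAngle.exists_sign (hS : IsDSection hopfFlow d S) (h : IsAngle S k n β ε) :
    ∃ s : ℝ, (s = 1 ∨ s = -1) ∧ ∃ δ > 0, ∀ x : Sphere3, ‖zTwo k x‖ < δ → x ∈ S →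
      zTwo k x ≠ 0 → 0 < s * angleSpeed n β x := by
  -- The times of positive and of negative local sign form two open sets covering the line. They are
  -- disjoint because interior points of `S` accumulate at every point of the orbit, so one of them
  -- is everything.
  set P : Set ℝ := {t | ∀ᶠ x in 𝓝 (hopfFlow t k), x ∈ S → zTwo k x ≠ 0 →
    0 < angleSpeed n β x} with hP
  set N : Set ℝ := {t | ∀ᶠ x in 𝓝 (hopfFlow t k), x ∈ S → zTwo k x ≠ 0 →
    angleSpeed n β x < 0} with hN
  have hc : Continuous fun t => hopfFlow t k := (isSmoothFlow_hopfFlow.smooth_curve k).continuous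
  have hPo : IsOpen P := isOpen_setOfPred_eventually_nhds.preimage hc
  have hNo : IsOpen N := isOpen_setOfPred_eventually_nhds.preimage hc
  have hz : ∀ t, zTwo k (hopfFlow t k) = 0 := fun t => by rw [zTwo_hopfFlow, zTwo_self, mul_zero]
  have hcov : ∀ t, t ∈ P ∨ t ∈ N := fun t => h.exists_local_sign hS (hz t)
  have hdisj : ∀ t, t ∈ P → t ∈ N → False := by
    intro t h1 h2
    have hb := (h.mem_iff (hopfFlow t k) (by rw [hz, norm_zero]; exact h.pos)).2 (hz t)
    have e1 : ∀ᶠ x : Sphere3 in 𝓝 (hopfFlow t k), ‖zTwo k x‖ < ε :=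
      (continuous_zTwo k).norm.continuousAt.eventually (gt_mem_nhds (by
        simp only [hz, norm_zero, h.pos]))
    obtain ⟨x, hx, ⟨h1, h2⟩, h3⟩ :=
      ((frequently_mem_surfInterior hb).and_eventually ((h1.and h2).and e1)).exists
    have hx0 : zTwo k x ≠ 0 := fun h0 =>
      not_mem_surfBoundary_of_mem_surfInterior hx ((h.mem_iff x h3).2 h0)
    exact lt_asymm (h1 hx.1 hx0) (h2 hx.1 hx0)
  have hPc : IsClopen P := by
    refine ⟨⟨?_⟩, hPo⟩
    have : Pᶜ = N := by
      ext t
      exact ⟨fun ht => (hcov t).resolve_left ht, fun ht hp => hdisj t hp ht⟩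
    rw [this]; exact hNo
  rcases isClopen_iff.1 hPc with he | he
  · obtain ⟨δ, hδ, hδ'⟩ := exists_tube_subset k
      (P := fun x => x ∈ S → zTwo k x ≠ 0 → angleSpeed n β x < 0) (by
        rintro _ ⟨t, rfl⟩
        exact (hcov t).resolve_left (by rw [he]; exact id))
    exact ⟨-1, Or.inr rfl, δ, hδ, fun x hx hxS hx0 => by linarith [hδ' x hx hxS hx0]⟩
  · obtain ⟨δ, hδ, hδ'⟩ := exists_tube_subset k
      (P := fun x => x ∈ S → zTwo k x ≠ 0 → 0 < angleSpeed n β x) (by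
        rintro _ ⟨t, rfl⟩
        exact (he ▸ mem_univ t : t ∈ P))
    exact ⟨1, Or.inl rfl, δ, hδ, fun x hx hxS hx0 => by linarith [hδ' x hx hxS hx0]⟩

theorem exists_sphere3 (k : Sphere3) {r : ℝ} (hr : 0 < r) (hr1 : r < 1) {u v : ℂ} (hu : ‖u‖ = 1)
    (hv : ‖v‖ = 1) : ∃ x : Sphere3, ‖zTwo k x‖ = r ∧ dirOne k x = u ∧ dirTwo k x = v := by
  have h0 : 0 < 1 - r ^ 2 := by nlinarith
  have hs : 0 < Real.sqrt (1 - r ^ 2) := Real.sqrt_pos.2 h0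
  refine ⟨ptOf k ((Real.sqrt (1 - r ^ 2) : ℂ) * u, (r : ℂ) * v) ?_, ?_, ?_, ?_⟩
  · simp only [Complex.normSq_eq_norm_sq, norm_mul, hu, hv, Complex.norm_real,
      Real.norm_of_nonneg hs.le, Real.norm_of_nonneg hr.le, mul_one, Real.sq_sqrt h0.le]
    ring
  · change ‖zTwo k (vecOf k _)‖ = r
    rw [zTwo_vecOf, norm_mul, hv, Complex.norm_real, Real.norm_of_nonneg hr.le, mul_one]
  · change zOne k (vecOf k _) / (‖zOne k (vecOf k _)‖ : ℂ) = u
    rw [zOne_vecOf, norm_mul, hu, Complex.norm_real, Real.norm_of_nonneg hs.le, mul_one,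
      mul_div_cancel_left₀ _ (by exact_mod_cast hs.ne')]
  · change zTwo k (vecOf k _) / (‖zTwo k (vecOf k _)‖ : ℂ) = v
    rw [zTwo_vecOf, norm_mul, hv, Complex.norm_real, Real.norm_of_nonneg hr.le, mul_one,
      mul_div_cancel_left₀ _ (by exact_mod_cast hr.ne')]

/-- The winding number of the section around its boundary orbit has the sign of the flow. -/
theorem IsAngle.sign_mul_pos (hd : 1 ≤ d) (hS : IsDSection hopfFlow d S) (h : IsAngle S k n β ε)
    {s : ℝ} (hs : s = 1 ∨ s = -1) (hsQ : ∀ x : Sphere3, ‖zTwo k x‖ < ε → x ∈ S →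
      zTwo k x ≠ 0 → 0 < s * angleSpeed n β x) : 0 < s * (n - 1) := by
  have hπ := Real.pi_pos
  have hz : ∀ t, zTwo k (hopfFlow t k) = 0 := fun t => by rw [zTwo_hopfFlow, zTwo_self, mul_zero]
  have hzε : ∀ t, ‖zTwo k (hopfFlow t k)‖ < ε := fun t => by rw [hz, norm_zero]; exact h.pos
  have hK : ∀ t, 0 ≤ s * angleSpeed n β (hopfFlow t k) := by
    intro t
    by_contra! hlt
    have hb := (h.mem_iff _ (hzε t)).2 (hz t)
    have e1 : ∀ᶠ x : Sphere3 in 𝓝 (hopfFlow t k), ‖zTwo k x‖ < ε :=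
      (continuous_zTwo k).norm.continuousAt.eventually (gt_mem_nhds (hzε t))
    have e2 : ∀ᶠ x in 𝓝 (hopfFlow t k), s * angleSpeed n β x < 0 :=
      (continuousAt_const.mul (h.continuousAt_angleSpeed (hzε t))).eventually (gt_mem_nhds hlt)
    obtain ⟨x, hx, h2, h3⟩ :=
      ((frequently_mem_surfInterior hb).and_eventually (e2.and e1)).exists
    have hx0 : zTwo k x ≠ 0 := fun h0 =>
      not_mem_surfBoundary_of_mem_surfInterior hx ((h.mem_iff x h3).2 h0)
    exact lt_asymm h2 (hsQ x h3 hx.1 hx0)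
  -- This function is monotone, and `β` takes its old value again after a period; hence `s * (n -
  -- 1)` is not negative.
  set g : ℝ → ℝ := fun t => s * (β (hopfFlow t k) + (n - 1) * t) with hg
  have hgd : ∀ t, HasDerivAt g (s * angleSpeed n β (hopfFlow t k)) t := by
    intro t
    have h1 := isSmoothFlow_hopfFlow.hasDerivAt (h.smooth _ (hzε t))
    have h2 : HasDerivAt (fun t : ℝ => ((n : ℝ) - 1) * t) (n - 1) t := by
      simpa using (hasDerivAt_id t).const_mul ((n : ℝ) - 1)
    exact (h1.add h2).const_mul s
  have hmono : Monotone g := monotone_of_hasDerivAt_nonneg hgd hK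
  have hle : 0 ≤ s * (n - 1) := by
    have h1 := hmono (show (0 : ℝ) ≤ 2 * Real.pi by positivity)
    simp only [hg, hopfFlow_two_pi, isSmoothFlow_hopfFlow.zero] at h1
    have h2 : 0 ≤ s * (n - 1) * (2 * Real.pi) := by linarith
    exact nonneg_of_mul_nonneg_left h2 (by positivity)
  refine lt_of_le_of_ne hle fun h0 => ?_
  have hn1 : (n : ℝ) - 1 = 0 := by
    rcases mul_eq_zero.1 h0.symm with h1 | h1
    · rcases hs with rfl | rfl <;> norm_num at h1
    · exact h1
  -- For `n = 1`, `β` is monotone up to sign and periodic along the orbit of `k`, so it is constant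
  -- there. The ratio of `dirTwo` to `dirOne` is constant on each Hopf orbit, and on `S` near `k` it
  -- is close to the exponential of `β k`. An orbit on which it is the opposite number cannot meet
  -- `S`, although `d` is at least 1.
  have hn : n = 1 := by exact_mod_cast sub_eq_zero.1 hn1
  have hβc : ∀ t, β (hopfFlow t k) = β k := by
    intro t
    obtain ⟨j, ⟨hj1, hj2⟩, -⟩ := existsUnique_add_zsmul_mem_Ioc Real.two_pi_pos t 0
    have e : hopfFlow (t + j • (2 * Real.pi)) k = hopfFlow t k := hopfFlow_eq_iff.2 ⟨j, by simp⟩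
    have h1 := hmono hj1.le
    have h2 := hmono hj2
    rw [zero_add] at h2
    simp only [hg, hn1, zero_mul, add_zero, e, hopfFlow_two_pi, isSmoothFlow_hopfFlow.zero] at h1 h2
    have h3 := le_antisymm h2 h1
    rcases hs with rfl | rfl <;> linarith
  obtain ⟨δ, hδ, hδ'⟩ := exists_tube_subset k (P := fun x => |β x - β k| < 1) (by
    rintro _ ⟨t, rfl⟩
    have hc : ContinuousAt (fun x => |β x - β k|) (hopfFlow t k) :=
      ((h.smooth _ (hzε t)).continuousAt.sub continuousAt_const).abs
    exact hc.eventually (gt_mem_nhds (by simp only [hβc, sub_self, abs_zero, one_pos])))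
  set r := min (1 / 2) (min (ε / 2) (δ / 2)) with hr
  have hε := h.pos
  have hr0 : 0 < r := by rw [hr]; positivity
  have hr1 : r < 1 := (min_le_left _ _).trans_lt (by norm_num)
  have hrε : r < ε := ((min_le_right _ _).trans (min_le_left _ _)).trans_lt (by linarith)
  have hrδ : r < δ := ((min_le_right _ _).trans (min_le_right _ _)).trans_lt (by linarith)
  obtain ⟨x, hx, hx1, hx2⟩ := exists_sphere3 k hr0 hr1 (u := 1)
    (v := -Complex.exp (β k * Complex.I)) (by simp) (by
      rw [norm_neg, Complex.norm_exp_ofReal_mul_I])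
  have hx0 : zTwo k x ≠ 0 := by rw [← norm_ne_zero_iff, hx]; exact hr0.ne'
  have hcard := hS.encard_of_notMem (x := x) fun hb =>
    hx0 ((h.mem_iff x (by rw [hx]; exact hrε)).1 hb)
  have hne : (flowOrbit hopfFlow x ∩ S).Nonempty := by
    rw [← Set.encard_ne_zero, hcard]
    exact_mod_cast (by omega : d ≠ 0)
  obtain ⟨_, ⟨t, rfl⟩, hyS⟩ := hne
  have hy : ‖zTwo k (hopfFlow t x)‖ = r := by rw [norm_zTwo_hopfFlow, hx]
  have h1 := h.dirTwo_eq _ (by rw [hy]; exact hrε) hyS (by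
    rw [← norm_ne_zero_iff, hy]; exact hr0.ne')
  have h2 := hδ' (hopfFlow t x) (by rw [hy]; exact hrδ)
  simp only [dirOne_hopfFlow, dirTwo_hopfFlow, hx1, hx2, hn, zpow_one, mul_one] at h1
  have h3 : Complex.exp (β (hopfFlow t x) * Complex.I) = -Complex.exp (β k * Complex.I) := by
    rw [mul_comm] at h1
    exact mul_left_cancel₀ (Complex.exp_ne_zero _) h1
  have h4 : Complex.exp ((β (hopfFlow t x) - β k : ℝ) * Complex.I) = -1 := by
    rw [Complex.ofReal_sub, sub_mul, Complex.exp_sub, h3, neg_div, div_self (Complex.exp_ne_zero _)]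
  have h5 := congrArg Complex.re h4
  rw [Complex.exp_ofReal_mul_I_re] at h5
  have h6 : 0 < Real.cos (β (hopfFlow t x) - β k) := by
    have := Real.pi_gt_three
    rw [abs_lt] at h2
    exact Real.cos_pos_of_mem_Ioo ⟨by linarith, by linarith⟩
  rw [h5] at h6
  norm_num at h6

end HopfSection

namespace HopfSection
open scoped Topology
open Set Filter

/-! ### Sections which are straight near a boundary orbit -/

variable {d : ℕ} {S : Set Sphere3} {k : Sphere3} {n : ℤ}

theorem continuous_ptOf {X : Type} [TopologicalSpace X] (k : Sphere3) {w : X → ℂ × ℂ}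
    (hw : Continuous w) (h : ∀ x, Complex.normSq (w x).1 + Complex.normSq (w x).2 = 1) :
    Continuous fun x => ptOf k (w x) (h x) :=
  Continuous.subtype_mk ((contDiff_vecOf k).continuous.comp hw) _

theorem normSq_cos_add_sin {u v : ℂ} (hu : ‖u‖ = 1) (hv : ‖v‖ = 1) (θ : ℝ) :
    Complex.normSq ((Real.cos θ : ℂ) * u) + Complex.normSq ((Real.sin θ : ℂ) * v) = 1 := by
  simp only [Complex.normSq_eq_norm_sq, norm_mul, hu, hv, Complex.norm_real, Real.norm_eq_abs,
    mul_one, sq_abs]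
  exact Real.cos_sq_add_sin_sq θ

theorem zOne_ptOf (k : Sphere3) {w : ℂ × ℂ} (h) : zOne k (ptOf k w h) = w.1 := zOne_vecOf k w

theorem zTwo_ptOf (k : Sphere3) {w : ℂ × ℂ} (h) : zTwo k (ptOf k w h) = w.2 := zTwo_vecOf k w

theorem dirOne_ptOf (k : Sphere3) {u v : ℂ} (hu : ‖u‖ = 1) {θ : ℝ} (hθ : 0 < Real.cos θ) (h) :
    dirOne k (ptOf k ((Real.cos θ : ℂ) * u, v) h) = u := by
  rw [dirOne, zOne_ptOf, norm_mul, hu, Complex.norm_real, Real.norm_of_nonneg hθ.le, mul_one,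
    mul_div_cancel_left₀ _ (by exact_mod_cast hθ.ne')]

theorem dirTwo_ptOf (k : Sphere3) {u v : ℂ} (hv : ‖v‖ = 1) {θ : ℝ} (hθ : 0 < Real.sin θ) (h) :
    dirTwo k (ptOf k (u, (Real.sin θ : ℂ) * v) h) = v := by
  rw [dirTwo, zTwo_ptOf, norm_mul, hv, Complex.norm_real, Real.norm_of_nonneg hθ.le, mul_one,
    mul_div_cancel_left₀ _ (by exact_mod_cast hθ.ne')]

theorem eq_norm_mul_dirOne {x : C2} (h : zOne k x ≠ 0) : zOne k x = (‖zOne k x‖ : ℂ) * dirOne k x := by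
  have : (‖zOne k x‖ : ℂ) ≠ 0 := by simpa using h
  rw [dirOne]; field_simp

theorem eq_norm_mul_dirTwo {x : C2} (h : zTwo k x ≠ 0) : zTwo k x = (‖zTwo k x‖ : ℂ) * dirTwo k x := by
  have : (‖zTwo k x‖ : ℂ) ≠ 0 := by simpa using h
  rw [dirTwo]; field_simp

theorem normSq_norms (k x : Sphere3) : ‖zOne k x‖ ^ 2 + ‖zTwo k x‖ ^ 2 = 1 := by
  have := normSq_coords k x
  rwa [Complex.normSq_eq_norm_sq, Complex.normSq_eq_norm_sq] at this

theorem zOne_ne_zero_of_lt {x : Sphere3} (h : ‖zTwo k x‖ < 1) : zOne k x ≠ 0 := by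
  intro h0
  have := normSq_norms k x
  rw [h0, norm_zero] at this
  nlinarith [norm_nonneg (zTwo k (x : C2))]

/-- Every point near the orbit of `k` is given by its polar coordinates. -/
theorem eq_ptOf {x : Sphere3} (h0 : zTwo k x ≠ 0) (h1 : ‖zTwo k x‖ < 1) (h) :
    x = ptOf k ((Real.cos (Real.arcsin ‖zTwo k x‖) : ℂ) * dirOne k x,
      (Real.sin (Real.arcsin ‖zTwo k x‖) : ℂ) * dirTwo k x) h := by
  have hz := zOne_ne_zero_of_lt h1
  have hn := norm_nonneg (zTwo k (x : C2))
  have e1 : Real.cos (Real.arcsin ‖zTwo k x‖) = ‖zOne k x‖ := by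
    rw [Real.cos_arcsin, ← Real.sqrt_sq (norm_nonneg (zOne k (x : C2)))]
    congr 1
    linarith [normSq_norms k x]
  apply sphere3_ext k
  · rw [zOne_ptOf, e1]; exact eq_norm_mul_dirOne hz
  · rw [zTwo_ptOf, Real.sin_arcsin (by linarith) h1.le]; exact eq_norm_mul_dirTwo h0

/-- With `m = n - 1` these are the times at which an orbit returns to the straight surface: the
multiples of 2π/|m| in one period. -/
theorem encard_exp_eq_one {m : ℤ} (hm : m ≠ 0) :
    {t : ℝ | t ∈ Ioc 0 (2 * Real.pi) ∧ Complex.exp (m * (t * Complex.I)) = 1}.encard =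
      m.natAbs := by
  have hπ := Real.pi_pos
  set N := m.natAbs with hN
  have hN0 : 0 < N := Int.natAbs_pos.2 hm
  have hN0' : (0 : ℝ) < N := by exact_mod_cast hN0
  have key : ∀ t : ℝ, Complex.exp (m * (t * Complex.I)) = 1 ↔ ∃ j : ℤ, N * t = j * (2 * Real.pi) := by
    intro t
    have h1 : Complex.exp (m * (t * Complex.I)) = 1 ↔ ∃ j : ℤ, m * t = j * (2 * Real.pi) := by
      rw [Complex.exp_eq_one_iff]
      refine exists_congr fun j => ?_
      rw [show (m : ℂ) * (t * Complex.I) = ((m * t : ℝ) : ℂ) * Complex.I by push_cast; ring,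
        show (j : ℂ) * (2 * Real.pi * Complex.I) = ((j * (2 * Real.pi) : ℝ) : ℂ) * Complex.I by
          push_cast; ring, mul_left_inj' Complex.I_ne_zero, Complex.ofReal_inj]
    rw [h1]
    rcases Int.natAbs_eq m with h | h
    · have : (m : ℝ) = N := (congrArg (fun z : ℤ => (z : ℝ)) h).trans (Int.cast_natCast _)
      rw [this]
    · have : (m : ℝ) = -N := by
        have := congrArg (fun z : ℤ => (z : ℝ)) h
        simp only [Int.cast_neg, Int.cast_natCast] at this
        exact this
      rw [this]
      constructor
      · rintro ⟨j, hj⟩; exact ⟨-j, by push_cast; linarith⟩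
      · rintro ⟨j, hj⟩; exact ⟨-j, by push_cast; linarith⟩
  have himg : {t : ℝ | t ∈ Ioc 0 (2 * Real.pi) ∧ Complex.exp (m * (t * Complex.I)) = 1} =
      (fun j : ℕ => (j : ℝ) * (2 * Real.pi) / N) '' (Finset.Icc 1 N : Set ℕ) := by
    ext t
    rw [mem_ofPred_eq, key]
    constructor
    · rintro ⟨⟨h0, h1⟩, j, hj⟩
      have hj0 : (0 : ℝ) < j := by
        have : 0 < j * (2 * Real.pi) := by rw [← hj]; positivity
        exact pos_of_mul_pos_left this (by positivity)
      have hjN : (j : ℝ) ≤ N := by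
        have : j * (2 * Real.pi) ≤ N * (2 * Real.pi) := by rw [← hj]; gcongr
        exact le_of_mul_le_mul_right this (by positivity)
      have hj0' : 0 < j := by exact_mod_cast hj0
      lift j to ℕ using hj0'.le
      refine ⟨j, ?_, ?_⟩
      · simp only [Finset.coe_Icc, mem_Icc]
        exact ⟨by omega, by exact_mod_cast hjN⟩
      · simp only
        rw [div_eq_iff hN0'.ne', mul_comm t]
        exact_mod_cast hj.symm
    · rintro ⟨j, hj, rfl⟩
      simp only [Finset.coe_Icc, mem_Icc] at hj
      have h1 : (1 : ℝ) ≤ j := by exact_mod_cast hj.1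
      have h2 : (j : ℝ) ≤ N := by exact_mod_cast hj.2
      refine ⟨⟨by positivity, ?_⟩, j, ?_⟩
      · rw [div_le_iff₀ hN0', mul_comm (2 * Real.pi)]; gcongr
      · push_cast; field_simp
  rw [himg, Set.InjOn.encard_image, Set.encard_coe_eq_coe_finsetCard, Nat.card_Icc]
  · simp
  · intro i _ j _ hij
    simp only at hij
    field_simp at hij
    exact_mod_cast hij

/-- Near a boundary orbit along which it is straight, a section consists of all the points with
`dirTwo = dirOne ^ n`. -/
theorem IsDSection.mem_of_straight (hd : 1 ≤ d) (hS : IsDSection hopfFlow d S) {δ : ℝ} (hδ : 0 < δ)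
    (hδ1 : δ ≤ 1) (hn : n ≠ 1)
    (hb : ∀ x : Sphere3, ‖zTwo k x‖ < δ → x ∈ surfBoundary S → zTwo k x = 0)
    (hW : ∀ x ∈ S, zTwo k x ≠ 0 → ‖zTwo k x‖ < δ → dirTwo k x = dirOne k x ^ n)
    {x : Sphere3} (hx0 : zTwo k x ≠ 0) (hx : ‖zTwo k x‖ < δ)
    (hxW : dirTwo k x = dirOne k x ^ n) : x ∈ S := by
  have hu : ∀ t : ℝ, ‖Complex.exp (t * Complex.I)‖ = 1 := Complex.norm_exp_ofReal_mul_I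
  have hv : ∀ t : ℝ, ‖Complex.exp (t * Complex.I) ^ n‖ = 1 := fun t => by
    rw [norm_zpow, hu, one_zpow]
  -- Polar coordinates parametrise the straight surface by a strip, which is connected. The preimage
  -- of `S` in it is closed and nonempty, so openness suffices.
  set γ : ℝ × ℝ → Sphere3 := fun q => ptOf k ((Real.cos q.2 : ℂ) * Complex.exp (q.1 * Complex.I),
    (Real.sin q.2 : ℂ) * Complex.exp (q.1 * Complex.I) ^ n)
    (normSq_cos_add_sin (hu q.1) (hv q.1) q.2) with hγ
  have hγc : Continuous γ := by
    apply continuous_ptOf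
    have h1 : Continuous fun q : ℝ × ℝ => Complex.exp (q.1 * Complex.I) := by fun_prop
    have h2 : Continuous fun q : ℝ × ℝ => Complex.exp (q.1 * Complex.I) ^ n :=
      h1.zpow₀ n fun q => Or.inl (Complex.exp_ne_zero _)
    have h3 : Continuous fun q : ℝ × ℝ => (Real.cos q.2 : ℂ) := by fun_prop
    have h4 : Continuous fun q : ℝ × ℝ => (Real.sin q.2 : ℂ) := by fun_prop
    exact (h3.mul h1).prodMk (h4.mul h2)
  set s : Set (ℝ × ℝ) := univ ×ˢ Ioo 0 (Real.arcsin δ) with hs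
  have hsp : IsPreconnected s := isPreconnected_univ.prod isPreconnected_Ioo
  have hso : IsOpen s := isOpen_univ.prod isOpen_Ioo
  have hsθ : ∀ q ∈ s, 0 < Real.sin q.2 ∧ Real.sin q.2 < δ ∧ 0 < Real.cos q.2 := by
    rintro q ⟨-, h0, h1⟩
    have hle := Real.arcsin_le_pi_div_two δ
    have hπ := Real.pi_pos
    refine ⟨Real.sin_pos_of_pos_of_lt_pi h0 (by linarith), ?_,
      Real.cos_pos_of_mem_Ioo ⟨by linarith, by linarith⟩⟩
    rw [← Real.sin_arcsin (by linarith) hδ1]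
    exact Real.sin_lt_sin_of_lt_of_le_pi_div_two (by linarith) hle h1
  have hγz : ∀ q ∈ s, ‖zTwo k (γ q)‖ < δ ∧ zTwo k (γ q) ≠ 0 := by
    intro q hq
    obtain ⟨h1, h2, -⟩ := hsθ q hq
    have : ‖zTwo k (γ q)‖ = Real.sin q.2 := by
      simp only [hγ, zTwo_ptOf, norm_mul, hv, Complex.norm_real, Real.norm_of_nonneg h1.le, mul_one]
    exact ⟨by rw [this]; exact h2, by rw [← norm_ne_zero_iff, this]; exact h1.ne'⟩
  have hγ1 : ∀ q ∈ s, dirOne k (γ q) = Complex.exp (q.1 * Complex.I) := fun q hq =>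
    dirOne_ptOf k (hu q.1) (hsθ q hq).2.2 _
  have hγ2 : ∀ q ∈ s, dirTwo k (γ q) = Complex.exp (q.1 * Complex.I) ^ n := fun q hq =>
    dirTwo_ptOf k (hv q.1) (hsθ q hq).1 _
  have hpar : ∀ y : Sphere3, zTwo k y ≠ 0 → ‖zTwo k y‖ < δ → dirTwo k y = dirOne k y ^ n →
      ∃ q ∈ s, γ q = y := by
    intro y hy0 hy hyW
    have hz := zOne_ne_zero_of_lt (hy.trans_le hδ1)
    have hexp : Complex.exp ((dirOne k y).arg * Complex.I) = dirOne k y := by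
      rw [exp_arg_mul_I (dirOne_ne_zero hz), norm_dirOne hz]; simp
    refine ⟨((dirOne k y).arg, Real.arcsin ‖zTwo k y‖), ⟨mem_univ _, ?_, ?_⟩, ?_⟩
    · exact Real.arcsin_pos.2 (norm_pos_iff.2 hy0)
    · exact Real.strictMonoOn_arcsin ⟨by linarith [norm_nonneg (zTwo k (y : C2))],
        (hy.trans_le hδ1).le⟩ ⟨by linarith, hδ1⟩ hy
    · have := eq_ptOf hy0 (hy.trans_le hδ1)
        (normSq_cos_add_sin (norm_dirOne hz) (norm_dirTwo hy0) _)
      simp only [hγ, hexp, ← hyW]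
      exact this.symm
  set u : Set (ℝ × ℝ) := s ∩ γ ⁻¹' S with hudef
  -- A point of the straight surface near `S` reaches `S` after a small time `τ`, and by `hW` it is
  -- then on the straight surface again. This forces `(n - 1) * τ` to be a multiple of 2π, and as `n
  -- ≠ 1`, smallness gives `τ = 0`: the point was on `S`.
  have huo : IsOpen u := by
    rw [isOpen_iff_mem_nhds]
    rintro q0 ⟨hq0, hq0S⟩
    have hi : hopfFlow 0 (γ q0) ∈ surfInterior S := by
      rw [isSmoothFlow_hopfFlow.zero]
      exact hS.compactSurface.mem_surfInterior_iff.2 ⟨hq0S, fun h =>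
        (hγz q0 hq0).2 (hb _ (hγz q0 hq0).1 h)⟩
    obtain ⟨τ, hτs, hτ0, hτ⟩ := hS.isTransverse.exists_hittingTime isSmoothFlow_hopfFlow hi
    have hc : Tendsto (fun q => (τ (γ q), γ q)) (𝓝 q0) (𝓝 ((0 : ℝ), γ q0)) := by
      have h1 : ContinuousAt (fun q => (τ (γ q), γ q)) q0 :=
        (ContinuousAt.comp (g := τ) hτs.continuousAt hγc.continuousAt).prodMk hγc.continuousAt
      have h2 := h1.tendsto
      rwa [hτ0] at h2
    have hm : (0 : ℝ) < |(n : ℝ) - 1| := abs_pos.2 (sub_ne_zero.2 (by exact_mod_cast hn))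
    have hsmall : ∀ᶠ q in 𝓝 q0, |((n : ℝ) - 1) * τ (γ q)| < 2 * Real.pi := by
      have h1 : ContinuousAt (fun q => |((n : ℝ) - 1) * τ (γ q)|) q0 :=
        (continuousAt_const.mul
          (ContinuousAt.comp (g := τ) hτs.continuousAt hγc.continuousAt)).abs
      refine h1.eventually (gt_mem_nhds ?_)
      simp only [hτ0, mul_zero, abs_zero]
      exact Real.two_pi_pos
    filter_upwards [hso.mem_nhds hq0, hc.eventually hτ, hsmall] with q hq h1 h2
    refine ⟨hq, ?_⟩
    have h3 : hopfFlow (τ (γ q)) (γ q) ∈ S := h1.2 rfl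
    have h4 := hW _ h3 (by
      rw [← norm_ne_zero_iff, norm_zTwo_hopfFlow, norm_ne_zero_iff]; exact (hγz q hq).2) (by
      rw [norm_zTwo_hopfFlow]; exact (hγz q hq).1)
    rw [dirTwo_hopfFlow, dirOne_hopfFlow, hγ1 q hq, hγ2 q hq, mul_zpow] at h4
    have h5 := mul_right_cancel₀ (zpow_ne_zero n (Complex.exp_ne_zero _)) h4
    rw [← Complex.exp_int_mul] at h5
    obtain ⟨j, hj⟩ := Complex.exp_eq_exp_iff_exists_int.1 h5
    have h6 : (n - 1) * τ (γ q) = -j * (2 * Real.pi) := by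
      have := congrArg Complex.im hj
      simp at this
      linarith
    have h7 : j = 0 := by
      rw [h6, abs_mul, abs_of_pos Real.two_pi_pos, abs_neg] at h2
      have h8 : |(j : ℝ)| < 1 := by
        by_contra! hge
        have := mul_le_mul_of_nonneg_right hge Real.two_pi_pos.le
        linarith
      have h9 : |j| < 1 := by exact_mod_cast h8
      exact Int.abs_lt_one_iff.1 h9
    have h8 : τ (γ q) = 0 := by
      rw [h7, Int.cast_zero, neg_zero, zero_mul] at h6
      exact (mul_eq_zero.1 h6).resolve_left (abs_pos.1 hm)
    rw [h8, isSmoothFlow_hopfFlow.zero] at h3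
    exact h3
  have hucl : closure u ∩ s ⊆ u := by
    rintro q ⟨hq, hqs⟩
    exact ⟨hqs, closure_minimal inter_subset_right
      (hS.compactSurface.1.isClosed.preimage hγc) hq⟩
  have hune : (s ∩ u).Nonempty := by
    obtain ⟨y, hy, -, -⟩ := exists_sphere3 k (half_pos hδ) (by linarith) (u := 1) (v := 1)
      (by simp) (by simp)
    have hy0 : zTwo k y ≠ 0 := by rw [← norm_ne_zero_iff, hy]; positivity
    have hyδ : ‖zTwo k y‖ < δ := by rw [hy]; linarith
    have hcard := hS.encard_of_notMem (x := y) fun h => hy0 (hb y hyδ h)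
    have hne : (flowOrbit hopfFlow y ∩ S).Nonempty := by
      rw [← Set.encard_ne_zero, hcard]
      exact_mod_cast (by omega : d ≠ 0)
    obtain ⟨_, ⟨t, rfl⟩, hyS⟩ := hne
    have h0 : zTwo k (hopfFlow t y) ≠ 0 := by
      rw [← norm_ne_zero_iff, norm_zTwo_hopfFlow, norm_ne_zero_iff]; exact hy0
    have h1 : ‖zTwo k (hopfFlow t y)‖ < δ := by rw [norm_zTwo_hopfFlow]; exact hyδ
    obtain ⟨q, hq, hqy⟩ := hpar _ h0 h1 (hW _ hyS h0 h1)
    exact ⟨q, hq, hq, by rw [mem_preimage, hqy]; exact hyS⟩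
  obtain ⟨q, hq, rfl⟩ := hpar x hx0 hx hxW
  exact (hsp.subset_of_closure_inter_subset huo hune hucl hq).2

/-- A section which is straight near a boundary orbit is invariant there. -/
theorem IsDSection.invariant_of_straight (hd : 1 ≤ d) (hS : IsDSection hopfFlow d S) {δ : ℝ}
    (hδ : 0 < δ) (hδ1 : δ ≤ 1) (hn : n ≠ 1)
    (hb : ∀ x : Sphere3, ‖zTwo k x‖ < δ → (x ∈ surfBoundary S ↔ zTwo k x = 0))
    (hW : ∀ x ∈ S, zTwo k x ≠ 0 → ‖zTwo k x‖ < δ → dirTwo k x = dirOne k x ^ n)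
    {x : Sphere3} (hx : ‖zTwo k x‖ < δ) : hopfFlow (2 * Real.pi / d) x ∈ S ↔ x ∈ S := by
  have hd0 : (d : ℝ) ≠ 0 := by exact_mod_cast (by omega : d ≠ 0)
  have hiff : ∀ y : Sphere3, zTwo k y ≠ 0 → ‖zTwo k y‖ < δ →
      (y ∈ S ↔ dirTwo k y = dirOne k y ^ n) := fun y h0 h1 =>
    ⟨fun h => hW y h h0 h1, hS.mem_of_straight hd hδ hδ1 hn (fun y hy => (hb y hy).1) hW h0 h1⟩
  have hflow : ∀ (t : ℝ) (y : Sphere3), zTwo k y ≠ 0 → ‖zTwo k y‖ < δ →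
      dirTwo k y = dirOne k y ^ n →
      (hopfFlow t y ∈ S ↔ Complex.exp ((n - 1 : ℤ) * (t * Complex.I)) = 1) := by
    intro t y h0 h1 h2
    have h3 : dirTwo k y ≠ 0 := dirTwo_ne_zero h0
    rw [hiff _ (by rw [← norm_ne_zero_iff, norm_zTwo_hopfFlow, norm_ne_zero_iff]; exact h0)
      (by rw [norm_zTwo_hopfFlow]; exact h1), dirTwo_hopfFlow, dirOne_hopfFlow, mul_zpow, ← h2,
      mul_left_inj' h3, ← Complex.exp_int_mul, Int.cast_sub, Int.cast_one, sub_mul, one_mul,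
      Complex.exp_sub, div_eq_one_iff_eq (Complex.exp_ne_zero _)]
    exact eq_comm
  -- The hits of an orbit in the tube solve an equation with |n - 1| solutions per period, but a
  -- `d`-section has `d` hits.
  have hcard : (n - 1).natAbs = d := by
    obtain ⟨y, hy, hy1, hy2⟩ := exists_sphere3 k (half_pos hδ) (by linarith) (u := 1) (v := 1)
      (by simp) (by simp)
    have hy0 : zTwo k y ≠ 0 := by rw [← norm_ne_zero_iff, hy]; positivity
    have hyδ : ‖zTwo k y‖ < δ := by rw [hy]; linarith
    have h1 := hS.encard_of_notMem (x := y) fun h => hy0 ((hb y hyδ).1 h)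
    rw [encard_orbit_inter S y 0, zero_add] at h1
    have h2 := encard_exp_eq_one (sub_ne_zero.2 hn)
    simp only [hflow _ y hy0 hyδ (by rw [hy1, hy2, one_zpow])] at h1
    rw [h1] at h2
    exact_mod_cast h2.symm
  by_cases hx0 : zTwo k x = 0
  · have h1 := (hb x hx).2 hx0
    exact iff_of_true (hS.hopfFlow_mem_surfBoundary h1 _).1 h1.1
  · have hexp : Complex.exp ((n - 1 : ℤ) * ((2 * Real.pi / d : ℝ) * Complex.I)) = 1 := by
      rw [Complex.exp_eq_one_iff]
      have hdc : (d : ℂ) ≠ 0 := by exact_mod_cast hd0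
      rcases Int.natAbs_eq (n - 1) with h | h
      · refine ⟨1, ?_⟩
        rw [h, hcard]; push_cast; field_simp
      · refine ⟨-1, ?_⟩
        rw [h, hcard]; push_cast; field_simp
    have h0 : zTwo k (hopfFlow (2 * Real.pi / d) x) ≠ 0 := by
      rw [← norm_ne_zero_iff, norm_zTwo_hopfFlow, norm_ne_zero_iff]; exact hx0
    have h1 : ‖zTwo k (hopfFlow (2 * Real.pi / d) x)‖ < δ := by rw [norm_zTwo_hopfFlow]; exact hx
    rw [hiff _ h0 h1, hiff _ hx0 hx, dirTwo_hopfFlow, dirOne_hopfFlow, mul_zpow,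
      ← Complex.exp_int_mul]
    have h2 : Complex.exp (n * ((2 * Real.pi / d : ℝ) * Complex.I)) =
        Complex.exp ((2 * Real.pi / d : ℝ) * Complex.I) := by
      rw [Int.cast_sub, Int.cast_one, sub_mul, one_mul, Complex.exp_sub,
        div_eq_one_iff_eq (Complex.exp_ne_zero _)] at hexp
      exact hexp
    rw [h2]
    exact mul_right_inj' (Complex.exp_ne_zero _)

end HopfSection

namespace HopfSection
open scoped Topology
open Set Filter

/-! ### Straightening a section near its boundary -/

variable {d : ℕ} {S : Set Sphere3} {k : Sphere3} {n : ℤ}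

theorem tubeCutoff_rotFlow (k : Sphere3) (ε t : ℝ) (x : Sphere3) :
    tubeCutoff k ε (rotFlow k t x) = tubeCutoff k ε x := by
  simp only [tubeCutoff, Complex.normSq_eq_norm_sq, norm_zTwo_rotFlow]

theorem tubeCutoff_eq_zero {ε : ℝ} (hε : 0 < ε) {x : Sphere3} (hx : ‖zTwo k x‖ ≤ ε / 2) :
    tubeCutoff k ε x = 0 := by
  apply Real.smoothTransition.zero_of_nonpos
  rw [Complex.normSq_eq_norm_sq, sub_nonpos, div_le_one (by positivity)]
  nlinarith [norm_nonneg (zTwo k (x : C2))]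

/-- The algebra behind the transversality of the straightened section: `X`, `Y` are the normal
speeds of the Hopf flow and of the rotation, `a`, `b` the derivatives of the angle. -/
theorem shear_pos {X Y a b m l χ s : ℝ} (hX : l * X = a + m) (hY : l * Y = b - 1) (hb : |b| < 1)
    (h0 : 0 ≤ χ) (h1 : χ ≤ 1) (hs : s = 1 ∨ s = -1) (hsa : 0 < s * (a + m)) (hsm : 0 < s * m) :
    0 < X * (X - -χ * a / (1 + -χ * b) * Y) := by
  obtain ⟨hb1, hb2⟩ := abs_lt.1 hb
  have hden : 0 < 1 + -χ * b := by nlinarith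
  have hm : 0 < (a + m) * m := by
    have := mul_pos hsa hsm
    rcases hs with rfl | rfl <;> nlinarith
  have hQ : 0 < (a + m) * (a + m) := by
    have := mul_pos hsa hsa
    rcases hs with rfl | rfl <;> nlinarith
  -- The factor `l ^ 2` replaces the unknown speeds by `a + m` and `b - 1`. What remains is a convex
  -- combination, with weight `χ`, of `(a + m) ^ 2` and `(a + m) * m * (1 - b)`, over a positive
  -- denominator; the equal signs of `a + m` and `m` make both terms positive.
  have key : l ^ 2 * (X * (X - -χ * a / (1 + -χ * b) * Y)) =
      ((1 - χ) * ((a + m) * (a + m)) + χ * ((a + m) * m) * (1 - b)) / (1 + -χ * b) := by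
    have : l ^ 2 * (X * (X - -χ * a / (1 + -χ * b) * Y)) =
        (l * X) * (l * X - -χ * a / (1 + -χ * b) * (l * Y)) := by ring
    rw [this, hX, hY, eq_div_iff hden.ne']
    have e : -χ * a / (1 + -χ * b) * (1 + -χ * b) = -χ * a := div_mul_cancel₀ _ hden.ne'
    linear_combination (-(a + m) * (b - 1)) * e
  have hpos : 0 < ((1 - χ) * ((a + m) * (a + m)) + χ * ((a + m) * m) * (1 - b)) /
      (1 + -χ * b) := by
    apply div_pos _ hden
    rcases h0.eq_or_lt with h | h
    · rw [← h]; linarith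
    · have e1 := mul_pos (mul_pos h hm) (sub_pos.2 hb2)
      have e2 := mul_nonneg (sub_nonneg.2 h1) hQ.le
      linarith
  rw [← key] at hpos
  exact pos_of_mul_pos_right hpos (sq_nonneg l)

/-- Locally constant functions on an interval are constant; testing equality with `f b` gives a
continuous Boolean function. -/
theorem eq_of_eventually_eq {f : ℝ → ℕ∞} {a b : ℝ} (hab : a ≤ b)
    (h : ∀ t ∈ Icc a b, ∀ᶠ s in 𝓝 t, f s = f t) : f a = f b := by
  classical
  have hc : ContinuousOn (fun t => decide (f t = f b)) (Icc a b) := by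
    intro t ht
    refine ContinuousAt.continuousWithinAt ?_
    refine (continuousAt_const (y := decide (f t = f b))).congr ?_
    filter_upwards [h t ht] with s hs
    rw [hs]
  have := isPreconnected_Icc.constant hc (left_mem_Icc.2 hab) (right_mem_Icc.2 hab)
  simpa using this

/-- The number of hits is the same for all orbits in a tube. -/
theorem encard_orbit_eq_of_tube (hS : IsCompactSurface S) (hT : IsTransverse hopfFlow S) {ε : ℝ}
    (hε1 : ε < 1) (hb : ∀ x : Sphere3, ‖zTwo k x‖ ≤ ε → x ∈ surfBoundary S → zTwo k x = 0)
    (hn : ∀ x : Sphere3, ‖zTwo k x‖ = ε → (flowOrbit hopfFlow x ∩ S).encard = d)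
    {x : Sphere3} (hx0 : zTwo k x ≠ 0) (hx : ‖zTwo k x‖ ≤ ε) :
    (flowOrbit hopfFlow x ∩ S).encard = d := by
  have hr0 : 0 < ‖zTwo k x‖ := norm_pos_iff.2 hx0
  have hε : 0 < ε := hr0.trans_le hx
  have hz := zOne_ne_zero_of_lt (hx.trans_lt hε1)
  have hu := norm_dirOne hz
  have hv := norm_dirTwo hx0
  -- A radial path from `x` to the edge of the tube, with both directions fixed. It avoids the
  -- boundary orbits, so the number of hits is locally constant along it.
  set γ : ℝ → Sphere3 := fun θ => ptOf k ((Real.cos θ : ℂ) * dirOne k x,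
    (Real.sin θ : ℂ) * dirTwo k x) (normSq_cos_add_sin hu hv θ) with hγ
  have hγc : Continuous γ := by
    apply continuous_ptOf
    have h3 : Continuous fun θ : ℝ => (Real.cos θ : ℂ) := by fun_prop
    have h4 : Continuous fun θ : ℝ => (Real.sin θ : ℂ) := by fun_prop
    exact (h3.mul continuous_const).prodMk (h4.mul continuous_const)
  have hγz : ∀ θ, ‖zTwo k (γ θ)‖ = |Real.sin θ| := fun θ => by
    simp only [hγ, zTwo_ptOf, norm_mul, hv, Complex.norm_real, Real.norm_eq_abs, mul_one]
  have hmon : Real.arcsin ‖zTwo k x‖ ≤ Real.arcsin ε := Real.monotone_arcsin hx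
  have h := eq_of_eventually_eq (f := fun θ => (flowOrbit hopfFlow (γ θ) ∩ S).encard) hmon (by
    intro θ hθ
    have h1 : 0 < θ := (Real.arcsin_pos.2 hr0).trans_le hθ.1
    have hle := Real.arcsin_le_pi_div_two ε
    have hs0 : 0 < Real.sin θ :=
      Real.sin_pos_of_pos_of_lt_pi h1 (by linarith [hθ.2, Real.pi_pos])
    have hs1 : Real.sin θ ≤ ε := by
      rw [← Real.sin_arcsin (x := ε) (by linarith) hε1.le]
      exact Real.sin_le_sin_of_le_of_le_pi_div_two (by linarith [Real.pi_pos]) hle hθ.2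
    have hnb : ∀ t, hopfFlow t (γ θ) ∉ surfBoundary S := by
      intro t ht
      have h2 := hb _ (by rw [norm_zTwo_hopfFlow, hγz, abs_of_pos hs0]; exact hs1) ht
      rw [← norm_eq_zero, norm_zTwo_hopfFlow, hγz, abs_of_pos hs0] at h2
      exact hs0.ne' h2
    exact (hγc.tendsto θ).eventually (eventually_encard_orbit_inter_eq hS hT hnb))
  have h1 : γ (Real.arcsin ‖zTwo k x‖) = x :=
    (eq_ptOf hx0 (hx.trans_lt hε1) _).symm
  simp only [h1] at h
  rw [h]
  exact hn _ (by rw [hγz, Real.sin_arcsin (by linarith) hε1.le, abs_of_pos hε])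

/-- Making a section invariant near one boundary orbit by an isotopy supported in a small tube. -/
theorem IsDSection.exists_straighten (hd : 1 ≤ d) (hS : IsDSection hopfFlow d S)
    (hk : k ∈ surfBoundary S) {ρ : ℝ} (hρ : 0 < ρ) :
    ∃ S', IsDSection hopfFlow d S' ∧ surfBoundary S' = surfBoundary S ∧
      IsotopicSections hopfFlow S S' ∧ (∀ x : Sphere3, ρ ≤ ‖zTwo k x‖ → (x ∈ S' ↔ x ∈ S)) ∧
      ∃ δ > 0, ∀ x : Sphere3, ‖zTwo k x‖ < δ → (hopfFlow (2 * Real.pi / d) x ∈ S' ↔ x ∈ S') := by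
  obtain ⟨n, β, ε₀, h₀⟩ := hS.exists_isAngle hd hk
  obtain ⟨s, hs, δ₀, hδ₀, hsQ⟩ := h₀.exists_sign hS
  set ε₁ := min ε₀ (min δ₀ (min ρ 1)) with hε₁
  have hε₁0 : 0 < ε₁ := lt_min h₀.pos (lt_min hδ₀ (lt_min hρ one_pos))
  have h := h₀.mono hε₁0 (min_le_left _ _)
  have hε₁δ : ε₁ ≤ δ₀ := (min_le_right _ _).trans (min_le_left _ _)
  have hε₁ρ : ε₁ ≤ ρ := (min_le_right _ _).trans ((min_le_right _ _).trans (min_le_left _ _))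
  have hε₁1 : ε₁ ≤ 1 := (min_le_right _ _).trans ((min_le_right _ _).trans (min_le_right _ _))
  have hsQ' : ∀ x : Sphere3, ‖zTwo k x‖ < ε₁ → x ∈ S → zTwo k x ≠ 0 →
      0 < s * angleSpeed n β x := fun x hx => hsQ x (hx.trans_le hε₁δ)
  have hsm := h.sign_mul_pos hd hS hs hsQ'
  set ε := ε₁ / 2 with hε
  have hε0 : 0 < ε := by positivity
  have hεlt : ε < ε₁ := by linarith
  set χ : Sphere3 → ℝ := fun x => 1 - tubeCutoff k ε x with hχ
  have hχ0 : ∀ x, 0 ≤ χ x := fun x => sub_nonneg.2 (Real.smoothTransition.le_one _)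
  have hχ1 : ∀ x, χ x ≤ 1 := fun x => by
    have : 0 ≤ tubeCutoff k ε x := Real.smoothTransition.nonneg _
    simp only [hχ]; linarith
  have hχout : ∀ x : Sphere3, ε ≤ ‖zTwo k x‖ → χ x = 0 := by
    intro x hx
    by_contra hne
    exact not_lt.2 hx (norm_lt_of_tubeCutoff_ne_one hε0 fun h1 => hne (by simp [hχ, h1]))
  -- Rotating by `-β` removes the angle. Both flows preserve `‖zTwo k‖`, on which `χ` depends, so
  -- derivatives of `α` involve only those of `β`; `χ` is 1 up to radius `ε / 2` and 0 from radius
  -- `ε` on.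
  set α : Sphere3 → ℝ := fun x => -χ x * β x with hα
  have hαs : ContMDiff (𝓡 3) 𝓘(ℝ, ℝ) ∞ α := by
    intro x
    by_cases hx : ‖zTwo k x‖ < ε₁
    · exact ((contMDiffAt_const.sub (contMDiff_tubeCutoff k ε x)).neg).mul (h.smooth x hx)
    · refine (contMDiffAt_const (c := (0 : ℝ))).congr_of_eventuallyEq ?_
      have : ∀ᶠ y : Sphere3 in 𝓝 x, ε < ‖zTwo k y‖ :=
        (continuous_zTwo k).norm.continuousAt.eventually (lt_mem_nhds (by
          simp only; linarith))
      filter_upwards [this] with y hy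
      simp only [hα, hχout y hy.le, neg_zero, zero_mul]
  have hX : ∀ x, flowDeriv hopfFlow α x = -χ x * flowDeriv hopfFlow β x := by
    intro x
    simp only [flowDeriv, hα, hχ, tubeCutoff_hopfFlow]
    exact deriv_const_mul_field _
  have hYd : ∀ x, flowDeriv (rotFlow k) α x = -χ x * flowDeriv (rotFlow k) β x := by
    intro x
    simp only [flowDeriv, hα, hχ, tubeCutoff_rotFlow]
    exact deriv_const_mul_field _
  have hY : ∀ x, -1 < flowDeriv (rotFlow k) α x := by
    intro x
    rw [hYd]
    by_cases hx : ‖zTwo k x‖ < ε₁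
    · obtain ⟨h1, h2⟩ := abs_lt.1 (h.lt_one x hx)
      nlinarith [hχ0 x, hχ1 x]
    · rw [hχout x (by linarith)]; norm_num
  obtain ⟨D, hD, hiso, hT⟩ := exists_isotopicSections_of_shear (S := S) (isSmoothFlow_rotFlow k)
    isSmoothFlow_hopfFlow (rotFlow_hopfFlow k) hαs hY (fun φ hφ p hp hpS => by
      rw [hX, hYd]
      by_cases hpε : ‖zTwo k p‖ < ε
      · have hpε₁ := hpε.trans hεlt
        obtain ⟨l, hl1, hl2⟩ := h.exists_mul_normalSpeed hφ hp hpS hpε₁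
        have hp0 : zTwo k p ≠ 0 := fun h0 =>
          not_mem_surfBoundary_of_mem_surfInterior ⟨hpS, φ, hφ, hp⟩ ((h.mem_iff p hpε₁).2 h0)
        exact shear_pos hl1 hl2 (h.lt_one p hpε₁) (hχ0 p) (hχ1 p) hs (hsQ' p hpε₁ hpS hp0) hsm
      · rw [hχout p (not_lt.1 hpε)]
        have := mul_self_pos.2 (hS.transverse φ hφ p hp hpS)
        simpa using this)
  have hDz : ∀ x, ‖zTwo k (D x)‖ = ‖zTwo k x‖ := fun x => by rw [hD, norm_zTwo_rotFlow]
  have hDout : ∀ x : Sphere3, ε ≤ ‖zTwo k x‖ → D x = x := fun x hx => by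
    rw [hD]
    simp only [hα, hχout x hx, neg_zero, zero_mul, (isSmoothFlow_rotFlow k).zero]
  have hDcore : ∀ x : Sphere3, zTwo k x = 0 → D x = x := fun x hx => by
    rw [hD, rotFlow_eq_self hx]
  have hSout : ∀ x : Sphere3, ε ≤ ‖zTwo k x‖ → (x ∈ D '' S ↔ x ∈ S) := by
    intro x hx
    constructor
    · rintro ⟨y, hy, rfl⟩
      rw [hDz] at hx
      rwa [hDout y hx]
    · exact fun hxS => ⟨x, hxS, hDout x hx⟩
  have hDb : ∀ x ∈ surfBoundary S, D x = x := by
    intro x hx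
    by_cases hxε : ‖zTwo k x‖ < ε
    · exact hDcore x ((h.mem_iff x (hxε.trans hεlt)).1 hx)
    · exact hDout x (not_lt.1 hxε)
  have hB : D '' surfBoundary S = surfBoundary S := by
    rw [image_congr hDb, image_id']
  have hB' : surfBoundary (D '' S) = surfBoundary S := by rw [image_surfBoundary, hB]
  have hcount : ∀ x : Sphere3, x ∉ surfBoundary S → ε ≤ ‖zTwo k x‖ →
      (flowOrbit hopfFlow x ∩ D '' S).encard = d := by
    intro x hx hxε
    rw [← hS.encard_of_notMem hx]
    congr 1
    ext y
    refine and_congr_right ?_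
    rintro ⟨t, rfl⟩
    exact hSout _ (by rw [norm_zTwo_hopfFlow]; exact hxε)
  have hS' : IsDSection hopfFlow d (D '' S) := by
    refine hS.image hd D hB hT fun x hx => ?_
    -- The rotation does not preserve Hopf orbits, so the count of hits has to be checked. It is
    -- unchanged from radius `ε` on, where points stay fixed, and constancy of the count carries it
    -- inwards.
    by_cases hxε : ‖zTwo k x‖ < ε
    · refine encard_orbit_eq_of_tube (k := k) (hS.compactSurface.image D) hT (ε := ε) (by linarith)
        (fun y hy hyb => ?_) (fun y hy => hcount y (fun hyb => ?_) hy.ge) (fun h0 => ?_) hxε.le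
      · rw [hB'] at hyb
        exact (h.mem_iff y (hy.trans_lt hεlt)).1 hyb
      · have h0 := (h.mem_iff y (hy.trans_lt hεlt)).1 hyb
        rw [h0, norm_zero] at hy
        exact hε0.ne hy
      · exact hx ((h.mem_iff x (hxε.trans hεlt)).2 h0)
    · exact hcount x hx (not_lt.1 hxε)
  refine ⟨D '' S, hS', hB', hiso, fun x hx => hSout x (by linarith), ε / 2, by positivity,
    fun x hx => ?_⟩
  refine hS'.invariant_of_straight (n := n) hd (by positivity) (by linarith) ?_ (fun y hy => ?_) ?_
    hx
  · rintro rfl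
    simp at hsm
  · rw [hB']
    exact h.mem_iff y (by linarith)
  · rintro _ ⟨y, hyS, rfl⟩ hy0 hy
    rw [hDz] at hy
    have hy0' : zTwo k y ≠ 0 := by rwa [← norm_ne_zero_iff, ← hDz, norm_ne_zero_iff]
    have h1 := h.dirTwo_eq y (by linarith) hyS hy0'
    have h2 : α y = -β y := by
      simp only [hα, hχ, tubeCutoff_eq_zero hε0 hy.le]; ring
    rw [hD, dirOne_rotFlow, dirTwo_rotFlow, h2, ← h1, ← mul_assoc, ← Complex.exp_add]
    push_cast
    rw [← add_mul, neg_add_cancel, zero_mul, Complex.exp_zero, one_mul]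

/-- Every section is isotopic to one which is invariant near its boundary. -/
theorem IsDSection.exists_invariant_near_boundary (hd : 1 ≤ d) (hS : IsDSection hopfFlow d S) :
    ∃ S', IsDSection hopfFlow d S' ∧ IsotopicSections hopfFlow S S' ∧
      ∀ k ∈ surfBoundary S', ∃ ε > 0, ∀ x : Sphere3, ‖zTwo k x‖ < ε →
        (hopfFlow (2 * Real.pi / d) x ∈ S' ↔ x ∈ S') := by
  obtain ⟨F, hF, hF'⟩ := hS.exists_finset_orbits hd
  -- Induction over the boundary orbits. Each straightening is confined to half the radius of a tube
  -- containing no other boundary orbit, so the invariance already achieved near the others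
  -- survives.
  have key : ∀ G : Finset Sphere3, G ⊆ F → ∃ S', IsDSection hopfFlow d S' ∧
      surfBoundary S' = surfBoundary S ∧ IsotopicSections hopfFlow S S' ∧
      ∀ k ∈ G, ∀ x : Sphere3, zTwo k x = 0 →
        ∀ᶠ y in 𝓝 x, (hopfFlow (2 * Real.pi / d) y ∈ S' ↔ y ∈ S') := by
    intro G
    induction G using Finset.induction_on with
    | empty => exact fun _ => ⟨S, hS, rfl, IsotopicSections.refl hS.transverse, by simp⟩
    | insert k G hkG ih =>
      intro hG
      obtain ⟨S₁, h1, hb1, hi1, hinv1⟩ := ih ((Finset.subset_insert k G).trans hG)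
      have hk : k ∈ surfBoundary S₁ := by
        rw [hb1]; exact hF k (hG (Finset.mem_insert_self k G))
      obtain ⟨ρ, hρ, htube⟩ := h1.exists_tube hd hk
      obtain ⟨S₂, h2, hb2, hi2, hout, δ, hδ, hinv2⟩ := h1.exists_straighten hd hk (half_pos hρ)
      refine ⟨S₂, h2, hb2.trans hb1, hi1.trans hi2, fun k' hk' x hx => ?_⟩
      by_cases hxk : zTwo k x = 0
      · have : ∀ᶠ y : Sphere3 in 𝓝 x, ‖zTwo k y‖ < δ :=
          (continuous_zTwo k).norm.continuousAt.eventually (gt_mem_nhds (by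
            simp only [hxk, norm_zero, hδ]))
        filter_upwards [this] with y hy using hinv2 y hy
      · have hk'G : k' ∈ G := by
          rcases Finset.mem_insert.1 hk' with rfl | h
          · exact absurd hx hxk
          · exact h
        have hxb : x ∈ surfBoundary S₁ := by
          rw [hb1]
          exact hS.boundary_invariant k' (hF k' (hG hk')) ((mem_hopfOrbit_iff k' x).2 hx)
        have hxρ : ρ ≤ ‖zTwo k x‖ := not_lt.1 fun h => hxk (htube x h hxb)
        have : ∀ᶠ y : Sphere3 in 𝓝 x, ρ / 2 < ‖zTwo k y‖ :=
          (continuous_zTwo k).norm.continuousAt.eventually (lt_mem_nhds (by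
            simp only; linarith))
        filter_upwards [this, hinv1 k' hk'G x hx] with y hy hy'
        rw [hout y hy.le, hout _ (by rw [norm_zTwo_hopfFlow]; exact hy.le)]
        exact hy'
  obtain ⟨S', h1, hb, hi, hinv⟩ := key F subset_rfl
  refine ⟨S', h1, hi, fun k hk => exists_tube_subset k fun x hx => ?_⟩
  have hxb := h1.boundary_invariant k hk hx
  rw [hb] at hxb
  obtain ⟨k', hk', hz⟩ := hF' x hxb
  exact hinv k' hk' x hz

theorem IsDSection.exists_isotopic_invariant (hd : 1 ≤ d) (hS : IsDSection hopfFlow d S) :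
    ∃ S', IsDSection hopfFlow d S' ∧ IsotopicSections hopfFlow S S' ∧
      hopfFlow (2 * Real.pi / d) '' S' = S' := by
  obtain ⟨S₁, h1, hi1, hinv⟩ := hS.exists_invariant_near_boundary hd
  obtain ⟨S₂, h2, hi2, hinv2⟩ := h1.exists_invariant hd hinv
  exact ⟨S₂, h2, hi1.trans hi2, hinv2⟩

end HopfSection

namespace HopfSection
open scoped Topology
open Set Filter

/-! ### Descent to the lens space -/

variable {d : ℕ} {S : Set Sphere3}

theorem lensProj_surjective (d : ℕ) : Function.Surjective (lensProj d) := Quotient.mk_surjective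

theorem isQuotientMap_lensProj (d : ℕ) : Topology.IsQuotientMap (lensProj d) :=
  isQuotientMap_quot_mk

theorem lensFlow_lensProj (d : ℕ) (t : ℝ) (x : Sphere3) :
    lensFlow d t (lensProj d x) = lensProj d (hopfFlow t x) := rfl

theorem lensProj_eq_iff_exists_hopfFlow (d : ℕ) (x y : Sphere3) :
    lensProj d x = lensProj d y ↔ ∃ j : ℤ, hopfFlow (j * (2 * Real.pi / d)) y = x := by
  rw [lensProj_eq_iff]
  constructor
  · rintro ⟨⟨_, j, rfl⟩, rfl⟩
    refine ⟨j, ?_⟩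
    change Circle.exp _ • y = (Circle.exp (2 * Real.pi / d) ^ j) • y
    rw [← Circle.exp_zsmul, zsmul_eq_mul]
  · rintro ⟨j, rfl⟩
    refine ⟨⟨Circle.exp (2 * Real.pi / d) ^ j, j, rfl⟩, ?_⟩
    change (Circle.exp (2 * Real.pi / d) ^ j) • y = Circle.exp _ • y
    rw [← Circle.exp_zsmul, zsmul_eq_mul]

/-- A smooth local section of the projection to the lens space, around every point. -/
theorem exists_local_section (d : ℕ) (q : LensSpace d) :
    ∃ e : OpenPartialHomeomorph (LensSpace d) Sphere3, q ∈ e.source ∧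
      ContMDiffOn (𝓡 3) (𝓡 3) ∞ e e.source ∧ ContMDiffOn (𝓡 3) (𝓡 3) ∞ e.symm e.target ∧
      ∀ y ∈ e.source, lensProj d (e y) = y := by
  set hf := isLocalHomeomorph_lensProj d
  set a : Sphere3 := (Quotient.mk_surjective.hasRightInverse.choose q : Sphere3) with ha
  have haq : lensProj d a = q := Quotient.mk_surjective.hasRightInverse.choose_spec q
  have hψ : chartAt E3 q = (hf.localInverseAt a).trans (chartAt E3 a) := rfl
  set ψ := chartAt E3 q with hψ'
  have hsrc : ∀ y ∈ ψ.source, y ∈ (hf.localInverseAt a).source ∧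
      hf.localInverseAt a y ∈ (chartAt E3 a).source := fun y hy => by
    rw [hψ, OpenPartialHomeomorph.trans_source] at hy; exact hy
  have hval : ∀ y, ψ y = chartAt E3 a (hf.localInverseAt a y) := fun y => by rw [hψ]; rfl
  refine ⟨ψ.trans (chartAt E3 a).symm, ?_, ?_, ?_, ?_⟩
  · rw [OpenPartialHomeomorph.trans_source]
    refine ⟨mem_chart_source E3 q, ?_⟩
    rw [mem_preimage, hval, OpenPartialHomeomorph.symm_source]
    exact (chartAt E3 a).map_source (hsrc q (mem_chart_source E3 q)).2
  · exact contMDiffOn_chart_symm.comp (contMDiffOn_chart.mono fun y hy => hy.1) fun y hy => hy.2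
  · rw [OpenPartialHomeomorph.trans_symm_eq_symm_trans_symm, OpenPartialHomeomorph.symm_symm,
      OpenPartialHomeomorph.trans_target]
    exact contMDiffOn_chart_symm.comp (contMDiffOn_chart.mono fun y hy => hy.1) fun y hy => hy.2
  · intro y hy
    have h1 := hsrc y hy.1
    change lensProj d ((chartAt E3 a).symm (ψ y)) = y
    rw [hval, (chartAt E3 a).left_inv h1.2]
    exact hf.apply_localInverseAt_of_mem h1.1

theorem mem_iff_of_image_eq {c : ℝ} (h : hopfFlow c '' S = S) (j : ℤ) (x : Sphere3) :
    hopfFlow (j * c) x ∈ S ↔ x ∈ S := by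
  have h1 : ∀ x, hopfFlow c x ∈ S ↔ x ∈ S := by
    intro x
    constructor
    · intro hx
      rw [← h] at hx
      obtain ⟨y, hy, hyx⟩ := hx
      have : y = x := by
        rw [← isSmoothFlow_hopfFlow.neg_cancel c y, hyx, isSmoothFlow_hopfFlow.neg_cancel]
      rwa [← this]
    · intro hx
      rw [← h]
      exact ⟨x, hx, rfl⟩
  have h2 : ∀ j : ℤ, hopfFlow ((j + 1 : ℤ) * c) x = hopfFlow c (hopfFlow (j * c) x) := fun j => by
    rw [← isSmoothFlow_hopfFlow.add]; push_cast; ring_nf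
  induction j using Int.induction_on with
  | zero => rw [Int.cast_zero, zero_mul, isSmoothFlow_hopfFlow.zero]
  | succ i ih =>
    rw [h2, h1]
    exact ih
  | pred i ih =>
    rw [← h1, ← h2, sub_add_cancel]
    exact ih

section Descent

theorem lensProj_mem_image_iff (hinv : hopfFlow (2 * Real.pi / d) '' S = S) (x : Sphere3) :
    lensProj d x ∈ lensProj d '' S ↔ x ∈ S := by
  refine ⟨?_, fun hx => ⟨x, hx, rfl⟩⟩
  rintro ⟨y, hy, hyx⟩
  obtain ⟨j, rfl⟩ := (lensProj_eq_iff_exists_hopfFlow d _ _).1 hyx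
  exact (mem_iff_of_image_eq hinv j x).1 hy

/-- An invariant `S` is the full preimage of its image, so a local section of the projection
identifies the image with `S` and transports every local notion. -/
theorem isPairDiffeo_local_section (hinv : hopfFlow (2 * Real.pi / d) '' S = S)
    {e : OpenPartialHomeomorph (LensSpace d) Sphere3}
    (h1 : ContMDiffOn (𝓡 3) (𝓡 3) ∞ e e.source) (h2 : ContMDiffOn (𝓡 3) (𝓡 3) ∞ e.symm e.target)
    (h3 : ∀ y ∈ e.source, lensProj d (e y) = y) : IsPairDiffeo e (lensProj d '' S) S where
  smooth := h1
  smooth_symm := h2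
  mem_iff y hy := by
    rw [← lensProj_mem_image_iff hinv, h3 y hy]

theorem IsDSection.lensProj_mem_surfBoundary_iff (hS : IsDSection hopfFlow d S)
    (hinv : hopfFlow (2 * Real.pi / d) '' S = S) (x : Sphere3) :
    lensProj d x ∈ surfBoundary (lensProj d '' S) ↔ x ∈ surfBoundary S := by
  obtain ⟨e, hq, h1, h2, h3⟩ := exists_local_section d (lensProj d x)
  rw [(isPairDiffeo_local_section hinv h1 h2 h3).mem_surfBoundary_iff hq]
  obtain ⟨j, hj⟩ := (lensProj_eq_iff_exists_hopfFlow d _ _).1 (h3 _ hq)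
  rw [← hj, hS.hopfFlow_mem_surfBoundary_iff]

theorem IsDSection.lensProj_mem_surfInterior_iff (hS : IsDSection hopfFlow d S)
    (hinv : hopfFlow (2 * Real.pi / d) '' S = S) (x : Sphere3) :
    lensProj d x ∈ surfInterior (lensProj d '' S) ↔ x ∈ surfInterior S := by
  obtain ⟨e, hq, h1, h2, h3⟩ := exists_local_section d (lensProj d x)
  rw [(isPairDiffeo_local_section hinv h1 h2 h3).mem_surfInterior_iff hq]
  obtain ⟨j, hj⟩ := (lensProj_eq_iff_exists_hopfFlow d _ _).1 (h3 _ hq)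
  rw [← hj, hS.compactSurface.mem_surfInterior_iff, hS.compactSurface.mem_surfInterior_iff,
    hS.hopfFlow_mem_surfBoundary_iff, mem_iff_of_image_eq hinv]

theorem flowOrbit_lensFlow (d : ℕ) (x : Sphere3) :
    flowOrbit (lensFlow d) (lensProj d x) = lensProj d '' flowOrbit hopfFlow x := by
  unfold flowOrbit
  rw [← range_comp]
  rfl

/-- The deck transformations belong to the flow, so a flow-invariant set is the full preimage of its
image, and the projection is a quotient map. -/
theorem isClosed_image_lensProj {A : Set Sphere3} (hA : IsClosed A)
    (h : ∀ t : ℝ, ∀ x ∈ A, hopfFlow t x ∈ A) : IsClosed (lensProj d '' A) := by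
  rw [← (isQuotientMap_lensProj d).isClosed_preimage]
  convert hA
  ext x
  refine ⟨?_, fun hx => ⟨x, hx, rfl⟩⟩
  rintro ⟨y, hy, hyx⟩
  obtain ⟨j, rfl⟩ := (lensProj_eq_iff_exists_hopfFlow d _ _).1 hyx.symm
  exact h _ _ hy

theorem zTwo_hopfFlow_eq_zero_iff (k : Sphere3) (t : ℝ) (x : Sphere3) :
    zTwo k (hopfFlow t x) = 0 ↔ zTwo k x = 0 := by
  rw [← norm_eq_zero, norm_zTwo_hopfFlow, norm_eq_zero]

/-- The boundary downstairs is covered by finitely many closed orbits. The orbit of `x` and the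
union of the other ones are disjoint closed sets, so a connected set containing the image of `x`
stays in the first. -/
theorem IsDSection.flowOrbit_lensFlow_eq (hd : 1 ≤ d) (hS : IsDSection hopfFlow d S)
    (hinv : hopfFlow (2 * Real.pi / d) '' S = S) {x : Sphere3} (hx : x ∈ surfBoundary S) :
    flowOrbit (lensFlow d) (lensProj d x) =
      connectedComponentIn (surfBoundary (lensProj d '' S)) (lensProj d x) := by
  have hcont : Continuous (lensProj d) := (isQuotientMap_lensProj d).continuous
  have hmem := hS.lensProj_mem_surfBoundary_iff hinv
  apply Subset.antisymm
  · apply IsPreconnected.subset_connectedComponentIn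
    · rw [flowOrbit_lensFlow]
      exact (isPreconnected_hopfOrbit x).image _ hcont.continuousOn
    · exact ⟨0, by simp only [lensFlow_lensProj, isSmoothFlow_hopfFlow.zero]⟩
    · rintro _ ⟨t, rfl⟩
      simp only [lensFlow_lensProj]
      rw [hmem]
      exact hS.hopfFlow_mem_surfBoundary hx t
  · obtain ⟨F, hF, hF'⟩ := hS.exists_finset_orbits hd
    set R : Set Sphere3 := ⋃ k ∈ {k | k ∈ F ∧ zTwo k x ≠ 0}, {y : Sphere3 | zTwo k y = 0} with hR
    have hcl : ∀ k : Sphere3, IsClosed {y : Sphere3 | zTwo k y = 0} := fun k =>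
      isClosed_eq (continuous_zTwo k) continuous_const
    have hRc : IsClosed (lensProj d '' R) := by
      refine isClosed_image_lensProj (Set.Finite.isClosed_biUnion
        (F.finite_toSet.subset fun k hk => hk.1) fun k _ => hcl k) fun t y hy => ?_
      simp only [hR, mem_iUnion] at hy ⊢
      obtain ⟨k, hk, hy⟩ := hy
      exact ⟨k, hk, (zTwo_hopfFlow_eq_zero_iff k t y).2 hy⟩
    have horb : flowOrbit hopfFlow x = {y : Sphere3 | zTwo x y = 0} := by
      ext y; exact mem_hopfOrbit_iff x y
    have hOc : IsClosed (flowOrbit (lensFlow d) (lensProj d x)) := by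
      rw [flowOrbit_lensFlow, horb]
      exact isClosed_image_lensProj (hcl x) fun t y hy => (zTwo_hopfFlow_eq_zero_iff x t y).2 hy
    have hqR : ∀ y ∈ flowOrbit hopfFlow x, lensProj d y ∉ lensProj d '' R := by
      rintro y hy ⟨z, hz, hzy⟩
      simp only [hR, mem_iUnion] at hz
      obtain ⟨k, ⟨-, hkx⟩, hz⟩ := hz
      obtain ⟨j, rfl⟩ := (lensProj_eq_iff_exists_hopfFlow d _ _).1 hzy
      obtain ⟨t, rfl⟩ := hy
      exact hkx ((zTwo_hopfFlow_eq_zero_iff k _ _).1 ((zTwo_hopfFlow_eq_zero_iff k _ _).1 hz))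
    have hcov : connectedComponentIn (surfBoundary (lensProj d '' S)) (lensProj d x) ⊆
        flowOrbit (lensFlow d) (lensProj d x) ∪ lensProj d '' R := by
      intro q hq
      have hq' := connectedComponentIn_subset _ _ hq
      obtain ⟨y, rfl⟩ := lensProj_surjective d q
      rw [hmem] at hq'
      obtain ⟨k, hk, hky⟩ := hF' y hq'
      by_cases hkx : zTwo k x = 0
      · left
        rw [flowOrbit_lensFlow]
        refine ⟨y, ?_, rfl⟩
        rw [hopfOrbit_eq_of_mem ((mem_hopfOrbit_iff k x).2 hkx)]
        exact (mem_hopfOrbit_iff k y).2 hky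
      · right
        refine ⟨y, ?_, rfl⟩
        simp only [hR, mem_iUnion]
        exact ⟨k, ⟨hk, hkx⟩, hky⟩
    have hself : lensProj d x ∈
        connectedComponentIn (surfBoundary (lensProj d '' S)) (lensProj d x) :=
      mem_connectedComponentIn ((hmem x).2 hx)
    rcases isPreconnected_iff_subset_of_disjoint_closed.1
      (isPreconnected_connectedComponentIn (F := surfBoundary (lensProj d '' S))
        (x := lensProj d x)) _ _ hOc hRc hcov (by
        rw [Set.eq_empty_iff_forall_notMem]
        rintro q ⟨-, hq1, hq2⟩
        rw [flowOrbit_lensFlow] at hq1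
        obtain ⟨y, hy, rfl⟩ := hq1
        exact hqR y hy hq2) with h | h
    · exact h
    · exact absurd (h hself) (hqR x (self_mem_hopfOrbit x))

/-- All the hits of an orbit with an invariant section form one orbit of the deck group. -/
theorem IsDSection.lensProj_eq_of_mem (hd : 1 ≤ d) (hS : IsDSection hopfFlow d S)
    (hinv : hopfFlow (2 * Real.pi / d) '' S = S) {x y z : Sphere3} (hx : x ∉ surfBoundary S)
    (hy : y ∈ flowOrbit hopfFlow x ∩ S) (hz : z ∈ flowOrbit hopfFlow x ∩ S) :
    lensProj d z = lensProj d y := by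
  have hd0 : (d : ℝ) ≠ 0 := by exact_mod_cast (by omega : d ≠ 0)
  -- The `d` deck translates of `y` are distinct hits of the same orbit, and it has only `d` hits.
  set B : Set Sphere3 := (fun j : ℕ => hopfFlow ((j : ℤ) * (2 * Real.pi / d)) y) ''
    (Finset.range d : Set ℕ) with hB
  have hBA : B ⊆ flowOrbit hopfFlow x ∩ S := by
    rintro _ ⟨j, -, rfl⟩
    refine ⟨?_, (mem_iff_of_image_eq hinv j y).2 hy.2⟩
    rw [← hopfOrbit_eq_of_mem hy.1]
    exact ⟨_, rfl⟩
  have hBcard : B.encard = d := by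
    rw [hB, Set.InjOn.encard_image, Set.encard_coe_eq_coe_finsetCard, Finset.card_range]
    intro i hi j hj hij
    simp only [Finset.coe_range, mem_Iio] at hi hj
    obtain ⟨n, hn⟩ := hopfFlow_eq_iff.1 hij
    have hπ := Real.pi_ne_zero
    have h1 : (i : ℝ) = j + n * d := by
      field_simp at hn
      push_cast at hn
      linarith
    have h2 : (i : ℤ) = j + n * d := by exact_mod_cast h1
    have h3 : n = 0 := by
      by_contra h0
      have h5 : (d : ℤ) ≤ |n| * d := by
        have := Int.one_le_abs h0
        nlinarith
      have h4 : |n * (d : ℤ)| < d := by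
        rw [show n * (d : ℤ) = i - j by linarith, abs_lt]
        constructor <;> omega
      rw [abs_mul, abs_of_nonneg (by omega : (0 : ℤ) ≤ d)] at h4
      linarith
    rw [h3] at h2
    omega
  have hA := hS.encard_of_notMem hx
  have hfin : (flowOrbit hopfFlow x ∩ S).Finite := Set.finite_of_encard_eq_coe hA
  have heq : B = flowOrbit hopfFlow x ∩ S :=
    (hfin.subset hBA).eq_of_subset_of_encard_le hBA (by rw [hA, hBcard])
  rw [← heq] at hz
  obtain ⟨j, -, rfl⟩ := hz
  exact (lensProj_eq_iff_exists_hopfFlow d _ _).2 ⟨j, rfl⟩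

/-- An invariant `d`-section descends to a `1`-section of the lens space. -/
theorem IsDSection.lensProj_image (hd : 1 ≤ d) (hS : IsDSection hopfFlow d S)
    (hinv : hopfFlow (2 * Real.pi / d) '' S = S) :
    IsDSection (lensFlow d) 1 (lensProj d '' S) := by
  have hcont : Continuous (lensProj d) := (isQuotientMap_lensProj d).continuous
  have hbd := hS.lensProj_mem_surfBoundary_iff hinv
  have hint := hS.lensProj_mem_surfInterior_iff hinv
  refine ⟨⟨hS.compactSurface.1.image hcont, ?_⟩, ?_, ?_, ?_⟩
  · rintro _ ⟨x, hx, rfl⟩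
    rw [hint, hbd]
    exact hS.compactSurface.2 x hx
  · intro q hq
    obtain ⟨x, rfl⟩ := lensProj_surjective d q
    rw [hbd] at hq
    rintro _ ⟨t, rfl⟩
    simp only [lensFlow_lensProj]
    rw [hbd]
    exact hS.hopfFlow_mem_surfBoundary hq t
  · intro φ hφ q hqφ hq
    obtain ⟨e, hqe, h1, h2, h3⟩ := exists_local_section d q
    have hpair := isPairDiffeo_local_section hinv h1 h2 h3
    have hqe' : e.symm (e q) = q := e.left_inv hqe
    have hT := hS.transverse _ (hpair.symm.isSliceChart hφ) (e q) (by
      rw [OpenPartialHomeomorph.trans_source]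
      exact ⟨e.map_source hqe, by rw [mem_preimage, hqe']; exact hqφ⟩)
      ((hpair.mem_iff q hqe).1 hq)
    -- The projection intertwines the two flows, so crossing speeds agree once the chart is pulled
    -- back to the sphere.
    have heq : normalSpeed φ (fun t => lensFlow d t q) =
        normalSpeed (e.symm.trans φ) (fun t => hopfFlow t (e q)) := by
      unfold normalSpeed
      apply Filter.EventuallyEq.deriv_eq
      have hc := (isSmoothFlow_hopfFlow.smooth_curve (e q)).continuous.tendsto 0
      rw [isSmoothFlow_hopfFlow.zero] at hc
      filter_upwards [hc.eventually_mem (e.open_target.mem_nhds (e.map_source hqe))] with t ht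
      have h4 : e.symm (hopfFlow t (e q)) = lensFlow d t q := by
        rw [← h3 _ (e.map_target ht), e.right_inv ht, ← lensFlow_lensProj, h3 q hqe]
      change φ (lensFlow d t q) 2 = φ (e.symm (hopfFlow t (e q))) 2
      rw [h4]
    rw [heq]
    exact hT
  · intro q
    obtain ⟨x, rfl⟩ := lensProj_surjective d q
    by_cases hx : x ∈ surfBoundary S
    · right
      exact ⟨lensProj d x, (hbd x).2 hx, hS.flowOrbit_lensFlow_eq hd hinv hx⟩
    · left
      have hne : (flowOrbit hopfFlow x ∩ S).Nonempty := by
        rw [← Set.encard_ne_zero, hS.encard_of_notMem hx]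
        exact_mod_cast (by omega : d ≠ 0)
      obtain ⟨y, hy⟩ := hne
      have hyi : y ∈ surfInterior S := by
        refine hS.compactSurface.mem_surfInterior_iff.2 ⟨hy.2, fun hb => hx ?_⟩
        obtain ⟨t, rfl⟩ := hy.1
        exact (hS.hopfFlow_mem_surfBoundary_iff t).1 hb
      have : flowOrbit (lensFlow d) (lensProj d x) ∩ surfInterior (lensProj d '' S) =
          {lensProj d y} := by
        rw [flowOrbit_lensFlow]
        ext q
        constructor
        · rintro ⟨⟨z, hz, rfl⟩, hi⟩
          exact hS.lensProj_eq_of_mem hd hinv hx hy ⟨hz, ((hint z).1 hi).1⟩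
        · rintro rfl
          exact ⟨⟨y, hy.1, rfl⟩, (hint y).2 hyi⟩
      rw [this, Set.encard_singleton]
      rfl

end Descent

end HopfSection

theorem proposition3p2 (d : ℕ) (hd : 1 ≤ d) (S : Set HopfSection.Sphere3)
    (hS : HopfSection.IsDSection HopfSection.hopfFlow d S) :
    ∃ S' : Set HopfSection.Sphere3,
      HopfSection.IsDSection HopfSection.hopfFlow d S' ∧
      HopfSection.IsotopicSections HopfSection.hopfFlow S S' ∧
      HopfSection.hopfFlow (2 * Real.pi / d) '' S' = S' ∧
      HopfSection.IsDSection (HopfSection.lensFlow d) 1 (HopfSection.lensProj d '' S') := by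
  obtain ⟨S', h1, h2, h3⟩ := hS.exists_isotopic_invariant hd
  exact ⟨S', h1, h2, h3, h1.lensProj_image hd h3⟩
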